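/- Fix $\beta>0$. Let $\omega(x)=\cosh\beta x$, $\mathcal E=L^2(\mathbb R;\omega\,dx)$ (complex-valued functions), and $\Omega_{\beta/2}=\{z\in\mathbb C:|\operatorname{Im}z|<\beta/2\}$. For $f\in\mathcal E$ let $\hat f(\xi)=\int_{\mathbb R}f(x)e^{-ix\xi}\,dx$, $\xi\in\Omega_{\beta/2}$. Let $\mu(x)=e^{-x^2/2}$, $E=L^2(\mathbb R;\mu^{-1}dx)\subset\mathcal E$, and $\mu_j=(2\pi)^{-1/2}\mu^{(j)}$. For $k\in\mathbb N_0$ let $E_k=\ker(\Pi_0+\dots+\Pi_{k-1})\subset E$, where $\Pi_jf=\frac{\sqrt{2\pi}}{j!}\langle f,\mu_j\rangle_E\,\mu_j$ (so $E_0=E$), and let $\mathcal E_k$ be the closure of $E_k$ in $\mathcal E$. Let $\mathcal L$ be the closure in $\mathcal E$ of the operator $f\mapsto f''+xf'+f$ on $C_0^\infty(\mathbb R)$. Let $\theta$ be a tempered distribution on $\mathbb R$ such that (i) its Fourier transform extends to an analytic function $\hat\theta\in L^\infty(\Omega_{\beta/2})$; (ii) $\hat\theta(0)=0$; (iii) $\xi\mapsto\operatorname{Re}\int_0^1\hat\theta(\xi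 s)/s\,ds$ is essentially bounded on $\Omega_{\beta/2}$; and let $\Theta f=\theta*f$ for $f\in\mathcal E$. Then there is $f_0\in\mathcal E$ with $(\mathcal L+\Theta)f_0=0$ and $$\hat f_0(\xi)=\exp\Big(-\frac{\xi^2}{2}+\int_0^1\frac{\hat\theta(\xi s)}{s}\,ds\Big),\qquad \xi\in\Omega_{\beta/2},$$ and the following holds. For every $k\in\mathbb N_0$, every $\zeta\in\mathbb C$ with $\operatorname{Re}\zeta>-k$ and every $g\in\mathcal E_k$, there is exactly one $f\in\mathcal E_k$ (in the domain of $\mathcal L$) with $(\zeta-\mathcal L-\Theta)f=g$, and its Fourier transform is $$\hat f(\xi)=\hat f_0(\xi)\int_0^1\frac{\hat g(s\xi)}{\hat f_0(s\xi)}\,s^{\zeta-1}\,ds,\qquad \xi\in\Omega_{\beta/2},$$ where $s^{\zeta-1}=e^{(\zeta-1)\log s}$ and the integral converges absolutely. -/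

import Mathlib

open MeasureTheory Complex
open scoped SchwartzMap ContDiff ENNReal

noncomputable section

namespace FokkerPlanck

/-! ### Weighted spaces -/

/-- The measure `ω(x) dx` with the weight `ω(x) = cosh (β x)`. -/
def weightMeasure (β : ℝ) : Measure ℝ :=
  volume.withDensity fun x => ENNReal.ofReal (Real.cosh (β * x))

/-- The Hilbert space `𝓔 = L²(ω)` of complex-valued functions. -/
abbrev WSpace (β : ℝ) : Type := Lp ℂ 2 (weightMeasure β)

/-- The Gaussian `μ(x) = exp (-x² / 2)`. -/
def gauss (x : ℝ) : ℝ := Real.exp (-x ^ 2 / 2)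

/-- The measure `μ(x)⁻¹ dx`, so that `E = L²(1/μ)`. -/
def gaussMeasure : Measure ℝ :=
  volume.withDensity fun x => ENNReal.ofReal (gauss x)⁻¹

/-- The Hermite polynomials `H_k = μ⁻¹ (d/dx)^k μ`. -/
def hermiteFun (k : ℕ) (x : ℝ) : ℝ := (gauss x)⁻¹ * iteratedDeriv k gauss x

/-- The functions `μ_k = (2π)^{-1/2} H_k μ`. -/
def muFun (k : ℕ) (x : ℝ) : ℝ := (Real.sqrt (2 * Real.pi))⁻¹ * hermiteFun k x * gauss x

/-- The inner product `⟨f, g⟩_E = ∫ f ḡ μ⁻¹ dx` of `E`. -/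
def innerE (f g : ℝ → ℂ) : ℂ :=
  ∫ x : ℝ, f x * (starRingEnd ℂ) (g x) * (((gauss x)⁻¹ : ℝ) : ℂ)

/-- The spectral projection `Π_{L,k} f = (√(2π) / k!) ⟨f, μ_k⟩_E μ_k` of the Fokker-Planck
operator in `E`. -/
def specProj (k : ℕ) (f : ℝ → ℂ) (x : ℝ) : ℂ :=
  ((Real.sqrt (2 * Real.pi) / (k.factorial : ℝ) : ℝ) : ℂ) *
    innerE f (fun y => (muFun k y : ℂ)) * (muFun k x : ℂ)

/-- The subspace `E_k = ker (Π_{L,0} + ⋯ + Π_{L,k-1})` of `E` (so `E_0 = E`), seen inside `𝓔`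
through the embedding of `E` into `𝓔`. -/
def gaussKernel (β : ℝ) (k : ℕ) : Set (WSpace β) :=
  {f | MemLp f 2 gaussMeasure ∧ ∀ᵐ x : ℝ, ∑ j ∈ Finset.range k, specProj j f x = 0}

/-- `𝓔_k`, the closure of `E_k` in `𝓔`. -/
def WSub (β : ℝ) (k : ℕ) : Set (WSpace β) := closure (gaussKernel β k)

/-! ### The Fokker-Planck operator in `𝓔` -/

/-- The differential expression `L φ = φ'' + x φ' + φ`. -/
def fpExpr (φ : ℝ → ℂ) (x : ℝ) : ℂ := deriv (deriv φ) x + (x : ℂ) * deriv φ x + φ x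

/-- The graph of `L` restricted to the test functions `C₀^∞(ℝ)`, in `𝓔 × 𝓔`. -/
def fpCoreGraph (β : ℝ) : Set (WSpace β × WSpace β) :=
  {p | ∃ φ : ℝ → ℂ, ContDiff ℝ ∞ φ ∧ HasCompactSupport φ ∧
    (∀ᵐ x : ℝ, p.1 x = φ x) ∧ (∀ᵐ x : ℝ, p.2 x = fpExpr φ x)}

/-- The graph of the Fokker-Planck operator `𝓛` in `𝓔`, the closure of `L` on `C₀^∞(ℝ)`:
`(f, u)` belongs to it iff `f ∈ D(𝓛)` and `𝓛 f = u`. -/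
def fpGraph (β : ℝ) : Set (WSpace β × WSpace β) := closure (fpCoreGraph β)

/-! ### Fourier transforms -/

/-- The open strip `Ω_{β/2} = {z : |Im z| < β/2}`. -/
def strip (β : ℝ) : Set ℂ := {z | |z.im| < β / 2}

/-- The Fourier transform `f̂(z) = ∫ f(x) e^{-ixz} dx`. For `f ∈ 𝓔` and `z = ξ + ib` in the strip,
this is the (absolutely convergent) transform of `e^{bx} f(x)` at `ξ`, i.e. the analytic
continuation of `f̂` to the strip. -/
def fourierT (f : ℝ → ℂ) (z : ℂ) : ℂ := ∫ x : ℝ, f x * cexp (-(I * (x : ℂ) * z))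

/-- The dilation `x ↦ x / (2π)`. -/
def dilation : ℝ ≃L[ℝ] ℝ :=
  ContinuousLinearEquiv.smulLeft (Units.mk0 (2 * Real.pi)⁻¹ (inv_ne_zero Real.two_pi_pos.ne'))

/-- The Fourier transform on Schwartz functions, with the normalization
`φ̂(x) = ∫ φ(ξ) e^{-ixξ} dξ`. -/
def schwartzFourier (φ : 𝓢(ℝ, ℂ)) : 𝓢(ℝ, ℂ) :=
  SchwartzMap.compCLMOfContinuousLinearEquiv ℂ dilation (FourierTransform.fourier φ)

theorem schwartzFourier_apply (φ : 𝓢(ℝ, ℂ)) (x : ℝ) :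
    schwartzFourier φ x = fourierT φ x := by
  have h1 : schwartzFourier φ x = FourierTransform.fourier (φ : ℝ → ℂ) (dilation x) := by
    rw [← SchwartzMap.fourier_coe]
    rfl
  have h2 : dilation x = (2 * Real.pi)⁻¹ * x := rfl
  rw [h1, h2, Real.fourier_real_eq_integral_exp_smul, fourierT]
  refine integral_congr_ae (Filter.Eventually.of_forall fun v => ?_)
  have hpi : (Real.pi : ℂ) ≠ 0 := by exact_mod_cast Real.pi_ne_zero
  simp only [smul_eq_mul]
  rw [mul_comm]
  congr 2
  push_cast
  field_simp

/-! ### The convolution operator -/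

/-- `h = θ * f` for `f, h ∈ 𝓔` and a tempered distribution `θ`: for every Schwartz function `φ`,
`⟨h, φ⟩ = ⟨θ, f̌ * φ⟩`, where `(f̌ * φ)(y) = ∫ f(x) φ(x + y) dx` is again a Schwartz function. -/
def IsConvolution {β : ℝ} (θ : 𝓢'(ℝ, ℂ)) (f h : WSpace β) : Prop :=
  ∀ φ : 𝓢(ℝ, ℂ), ∃ ψ : 𝓢(ℝ, ℂ),
    (∀ y : ℝ, ψ y = ∫ x : ℝ, f x * φ (x + y)) ∧ (∫ x : ℝ, h x * φ x) = θ ψ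

/-- The conditions (C) on the tempered distribution `θ`, with `θhat` the analytic extension of its
Fourier transform to the strip. -/
structure ConditionC (β : ℝ) (θ : 𝓢'(ℝ, ℂ)) (θhat : ℂ → ℂ) : Prop where
  /-- On `ℝ`, the function `θhat` is the Fourier transform of `θ`. -/
  fourier_eq : ∀ φ : 𝓢(ℝ, ℂ), θ (schwartzFourier φ) = ∫ ξ : ℝ, θhat (ξ : ℂ) * φ ξ
  analytic : AnalyticOnNhd ℂ θhat (strip β)
  bounded : ∃ M : ℝ, ∀ᵐ z ∂(volume.restrict (strip β)), ‖θhat z‖ ≤ M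
  zero_mean : θhat 0 = 0
  re_bounded : ∃ M : ℝ, ∀ᵐ z ∂(volume.restrict (strip β)),
    |(∫ s in (0 : ℝ)..1, θhat (z * (s : ℂ)) / (s : ℂ)).re| ≤ M

/-- `f ∈ D(𝓛)` solves `(ζ - 𝓛 - Θ) f = g`, where `Θ f = θ * f ∈ 𝓔`. -/
def SolvesResolvent {β : ℝ} (θ : 𝓢'(ℝ, ℂ)) (ζ : ℂ) (g f : WSpace β) : Prop :=
  ∃ u h : WSpace β, (f, u) ∈ fpGraph β ∧ IsConvolution θ f h ∧ ζ • f - u - h = g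

end FokkerPlanck

end

open FokkerPlanck

/-! On the Fourier side the problem is a first-order equation on the strip. Integration by parts
turns `𝓛` into `F ↦ -z² F - z F'`, and `Θ` becomes multiplication by `θ̂`, so the resolvent equation
reads `z F' = (θ̂ - z² - ζ) F + G` with `F`, `G` the transforms of `f`, `g`. For `ζ = 0`, `G = 0` it
is solved by the nowhere vanishing function `groundFT`. Dividing by it leaves an Euler equation `z
Q' + ζ Q = G / groundFT`, whose analytic solution is the integral of the right-hand side along the
ray from `0` to `z` against `s^(ζ-1)`.

Membership in `𝓔_k` means that the first `k` moments vanish, i.e. that the transform is divisible by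
`z^k` on the strip (`mem_WSub_iff_exists_eq_pow_mul`). This factor shifts the exponent from `ζ` to
`ζ + k`, so the integral converges when `Re ζ > -k`. The same division gives uniqueness: `P /
groundFT` with `F = z^k P` solves the Euler equation with parameter `ζ + k`, and an analytic
solution is determined by its ray integral when that parameter has positive real part
(`eq_resolventFT`).

The return to `𝓔` uses a Paley-Wiener theorem (`exists_fourierT_eq`): an analytic function bounded
on smaller closed strips, with uniformly bounded `L²` norms on horizontal lines, is the transform of
an element of `𝓔`. The estimate rests on condition (iii), which bounds `groundFT z / groundFT (s z)`
by a multiple of `exp(-(1 - s²)(Re z)²/2)`. This Gaussian handles small `s`; for `s` near `1` an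
averaged `L²` bound suffices (`exists_resolvent`).

It remains to see that the Fourier identity characterises the closure of `L` on test functions
(`mem_fpGraph_iff`). Polynomials times the Gaussian lie in the domain, are dense, and are mapped
onto themselves by `2 - L`. The resolvent estimate with `θ = 0`, `ζ = 2` then approximates any pair
satisfying the identity, in the graph norm, by such functions. -/

namespace FokkerPlanck

/-! ### Fourier transforms of exponentially decaying functions -/

/-- `f` is integrable against `e^{c|x|}` for all `c < a`. -/
def ExpDecay (a : ℝ) (f : ℝ → ℂ) : Prop :=
  AEStronglyMeasurable f ∧ ∀ c < a, Integrable fun x : ℝ => ‖f x‖ * Real.exp (c * |x|)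

theorem norm_kernel (x : ℝ) (z : ℂ) : ‖cexp (-(I * (x : ℂ) * z))‖ = Real.exp (x * z.im) := by
  rw [norm_exp]; simp

theorem norm_kernel_le {c : ℝ} {z : ℂ} (hz : |z.im| ≤ c) (x : ℝ) :
    ‖cexp (-(I * (x : ℂ) * z))‖ ≤ Real.exp (c * |x|) := by
  rw [norm_kernel, Real.exp_le_exp]
  calc x * z.im ≤ |x * z.im| := le_abs_self _
    _ = |z.im| * |x| := by rw [abs_mul, mul_comm]
    _ ≤ c * |x| := by gcongr

theorem aestronglyMeasurable_kernel (z : ℂ) :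
    AEStronglyMeasurable fun x : ℝ => cexp (-(I * (x : ℂ) * z)) :=
  (by fun_prop : Continuous fun x : ℝ => cexp (-(I * (x : ℂ) * z))).aestronglyMeasurable

theorem isOpen_strip (β : ℝ) : IsOpen (strip β) :=
  isOpen_lt (by fun_prop) continuous_const

theorem ofReal_mem_strip {β : ℝ} (hβ : 0 < β) (x : ℝ) : (x : ℂ) ∈ strip β := by
  simp [strip, hβ]

theorem mul_mem_strip {β : ℝ} {z : ℂ} (hz : z ∈ strip β) {s : ℝ} (h0 : 0 ≤ s) (h1 : s ≤ 1) :
    (s : ℂ) * z ∈ strip β := by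
  have : |z.im| < β / 2 := hz
  simp only [strip, Set.mem_ofPred_eq, mul_im, ofReal_re, ofReal_im, zero_mul, add_zero, abs_mul,
    abs_of_nonneg h0]
  nlinarith [abs_nonneg z.im]

theorem convex_strip (β : ℝ) : Convex ℝ (strip β) := by
  have : strip β = imLm ⁻¹' (Metric.ball 0 (β / 2)) := by
    ext z; simp [strip]
  rw [this]
  exact (convex_ball _ _).linear_preimage _

namespace ExpDecay

variable {a β : ℝ} {f g : ℝ → ℂ} {z : ℂ}

theorem mul_kernel (hf : ExpDecay (β / 2) f) (hz : z ∈ strip β) :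
    Integrable fun x : ℝ => f x * cexp (-(I * (x : ℂ) * z)) := by
  refine (hf.2 |z.im| hz).mono' (hf.1.mul (aestronglyMeasurable_kernel z))
    (.of_forall fun x => ?_)
  rw [norm_mul]
  gcongr
  exact norm_kernel_le le_rfl x

theorem integrable (ha : 0 < a) (hf : ExpDecay a f) : Integrable f := by
  refine (hf.2 0 ha).mono' hf.1 (.of_forall fun x => by simp)

/-- The factor `|x|` is absorbed by raising the rate from `c` to a midpoint `d < a`. This is
possible because only rates strictly below `a` are required. -/
theorem mul_id (hf : ExpDecay a f) : ExpDecay a fun x : ℝ => (x : ℂ) * f x := by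
  refine ⟨continuous_ofReal.aestronglyMeasurable.mul hf.1, fun c hc => ?_⟩
  set d := (c + a) / 2
  have hcd : 0 < d - c := by simp only [d]; linarith
  refine ((hf.2 d (by simp only [d]; linarith)).const_mul (d - c)⁻¹).mono'
    ((continuous_ofReal.aestronglyMeasurable.mul hf.1).norm.mul
      (by fun_prop)) (.of_forall fun x => ?_)
  have h1 : |x| ≤ (d - c)⁻¹ * Real.exp ((d - c) * |x|) := by
    rw [inv_mul_eq_div, le_div_iff₀ hcd]
    linarith [Real.add_one_le_exp ((d - c) * |x|)]
  have h2 : Real.exp (d * |x|) = Real.exp ((d - c) * |x|) * Real.exp (c * |x|) := by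
    rw [← Real.exp_add]; ring_nf
  rw [Real.norm_of_nonneg (by positivity), norm_mul, norm_real, Real.norm_eq_abs, h2]
  calc |x| * ‖f x‖ * Real.exp (c * |x|)
      ≤ ((d - c)⁻¹ * Real.exp ((d - c) * |x|)) * ‖f x‖ * Real.exp (c * |x|) := by gcongr
    _ = _ := by ring

theorem const_mul (hf : ExpDecay a f) (c : ℂ) : ExpDecay a fun x => c * f x := by
  refine ⟨hf.1.const_mul c, fun d hd => ?_⟩
  simpa [norm_mul, mul_assoc] using (hf.2 d hd).const_mul ‖c‖

theorem pow_mul (hf : ExpDecay a f) (n : ℕ) : ExpDecay a fun x : ℝ => (-(I * (x : ℂ))) ^ n * f x := by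
  induction n with
  | zero => simpa using hf
  | succ n ih =>
    have := (ih.mul_id).const_mul (-I)
    convert this using 2
    ring

theorem hasDerivAt_fourierT (hf : ExpDecay (β / 2) f) (hz : z ∈ strip β) :
    HasDerivAt (fourierT f) (fourierT (fun x : ℝ => -(I * (x : ℂ)) * f x) z) z := by
  -- A rate strictly between `|Im z|` and `β / 2`, so that a single dominating function serves a
  -- whole neighbourhood of `z`.
  set c := (|z.im| + β / 2) / 2
  have hzc : |z.im| < c := by have : |z.im| < β / 2 := hz; simp only [c]; linarith
  have hcb : c < β / 2 := by have : |z.im| < β / 2 := hz; simp only [c]; linarith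
  have hf1 : ExpDecay (β / 2) (fun x : ℝ => -(I * (x : ℂ)) * f x) := by simpa using hf.pow_mul 1
  refine (hasDerivAt_integral_of_dominated_loc_of_deriv_le (μ := volume)
    (F := fun w (x : ℝ) => f x * cexp (-(I * (x : ℂ) * w)))
    (F' := fun w (x : ℝ) => -(I * (x : ℂ)) * f x * cexp (-(I * (x : ℂ) * w)))
    (bound := fun x : ℝ => ‖-(I * (x : ℂ)) * f x‖ * Real.exp (c * |x|))
    (s := {w : ℂ | |w.im| < c}) ((isOpen_lt (by fun_prop) continuous_const).mem_nhds hzc)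
    (.of_forall fun w => hf.1.mul (aestronglyMeasurable_kernel w)) (hf.mul_kernel hz)
    (hf1.1.mul (aestronglyMeasurable_kernel z)) (.of_forall fun x w hw => ?_) (hf1.2 c hcb)
    (.of_forall fun x w _ => ?_)).2
  · rw [norm_mul]
    gcongr
    exact norm_kernel_le (le_of_lt hw) x
  · have h1 : HasDerivAt (fun w : ℂ => -(I * (x : ℂ) * w)) (-(I * (x : ℂ))) w := by
      simpa only [neg_mul, mul_one] using (hasDerivAt_id' w).const_mul (-(I * (x : ℂ)))
    refine (h1.cexp.const_mul (f x)).congr_deriv ?_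
    ring

theorem differentiableOn_fourierT (hf : ExpDecay (β / 2) f) :
    DifferentiableOn ℂ (fourierT f) (strip β) :=
  fun _ hz => (hf.hasDerivAt_fourierT hz).differentiableAt.differentiableWithinAt

theorem norm_fourierT_le {c : ℝ} (hf : ExpDecay a f) (hc : c < a) (hz : |z.im| ≤ c) :
    ‖fourierT f z‖ ≤ ∫ x : ℝ, ‖f x‖ * Real.exp (c * |x|) := by
  refine norm_integral_le_of_norm_le (hf.2 c hc) (.of_forall fun x => ?_)
  rw [norm_mul]
  gcongr
  exact norm_kernel_le hz x

theorem iteratedDeriv_fourierT (hf : ExpDecay (β / 2) f) (n : ℕ) :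
    Set.EqOn (iteratedDeriv n (fourierT f))
      (fourierT (fun x : ℝ => (-(I * (x : ℂ))) ^ n * f x)) (strip β) := by
  induction n with
  | zero => intro z _; simp
  | succ n ih =>
    intro z hz
    rw [iteratedDeriv_succ]
    have h1 := (ih.eventuallyEq_of_mem ((isOpen_strip β).mem_nhds hz)).deriv_eq
    rw [h1, ((hf.pow_mul n).hasDerivAt_fourierT hz).deriv]
    congr 1
    ext x
    ring

end ExpDecay

theorem fourierT_ofReal (f : ℝ → ℂ) (t : ℝ) :
    fourierT f t = FourierTransform.fourier f ((2 * Real.pi)⁻¹ * t) := by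
  rw [Real.fourier_real_eq_integral_exp_smul, fourierT]
  refine integral_congr_ae (.of_forall fun v => ?_)
  have hpi : (Real.pi : ℂ) ≠ 0 := by exact_mod_cast Real.pi_ne_zero
  simp only [smul_eq_mul]
  rw [mul_comm]
  congr 2
  push_cast
  field_simp

/-- All derivatives are bounded, being transforms of a power of `x` times `f`. It makes the product
of this transform with a Schwartz function again Schwartz. -/
theorem ExpDecay.hasTemperateGrowth {β : ℝ} {f : ℝ → ℂ} (hβ : 0 < β) (hf : ExpDecay (β / 2) f) :
    Function.HasTemperateGrowth fun t : ℝ => fourierT f t := by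
  have key : ∀ n : ℕ, iteratedDeriv n (fun t : ℝ => fourierT f t) =
      fun t : ℝ => fourierT (fun x : ℝ => (-(I * (x : ℂ))) ^ n * f x) t := by
    intro n
    induction n with
    | zero => ext t; simp
    | succ n ih =>
      rw [iteratedDeriv_succ, ih]
      ext t
      rw [(((hf.pow_mul n).hasDerivAt_fourierT (ofReal_mem_strip hβ t)).comp_ofReal).deriv]
      congr 1
      ext x
      ring
  have hd : ∀ n : ℕ, Differentiable ℝ (iteratedDeriv n (fun t : ℝ => fourierT f t)) := by
    intro n t
    rw [key]
    exact ((hf.pow_mul n).hasDerivAt_fourierT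
      (ofReal_mem_strip hβ t)).comp_ofReal.differentiableAt
  refine ⟨contDiff_of_differentiable_iteratedDeriv fun n _ => hd n, fun n => ?_⟩
  refine ⟨0, ∫ x : ℝ, ‖(-(I * (x : ℂ))) ^ n * f x‖ * Real.exp (0 * |x|), fun t => ?_⟩
  rw [norm_iteratedFDeriv_eq_norm_iteratedDeriv, key]
  simpa using (hf.pow_mul n).norm_fourierT_le (c := 0) (z := (t : ℂ)) (by linarith) (by simp)

/-- The inverse of `schwartzFourier`. -/
theorem schwartzFourier_surjective (φ : 𝓢(ℝ, ℂ)) : ∃ φ₁ : 𝓢(ℝ, ℂ), schwartzFourier φ₁ = φ := by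
  refine ⟨FourierTransformInv.fourierInv
    (SchwartzMap.compCLMOfContinuousLinearEquiv ℂ dilation.symm φ), ?_⟩
  rw [schwartzFourier, FourierTransform.fourier_fourierInv_eq]
  ext x
  simp

theorem integral_fourierT_mul {f : ℝ → ℂ} (hf : Integrable f) {φ : ℝ → ℂ} (hφ : Integrable φ) :
    ∫ t : ℝ, fourierT f t * φ t = ∫ x : ℝ, f x * fourierT φ x := by
  have hint : Integrable (Function.uncurry fun (t x : ℝ) => f x * cexp (-(I * (x : ℂ) * t)) * φ t)
      (volume.prod volume) := by
    have h0 : Integrable (fun p : ℝ × ℝ => φ p.1 * f p.2) (volume.prod volume) := hφ.mul_prod hf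
    have h1 : Integrable (fun p : ℝ × ℝ => cexp (-(I * (p.2 : ℂ) * p.1)) * (φ p.1 * f p.2))
        (volume.prod volume) := by
      refine h0.bdd_mul (c := 1) (by fun_prop) (.of_forall fun p => ?_)
      rw [norm_kernel]; simp
    refine h1.congr (.of_forall fun p => ?_)
    simp only [Function.uncurry]; ring
  simp only [fourierT, ← integral_mul_const, ← integral_const_mul]
  rw [integral_integral_swap hint]
  refine integral_congr_ae (.of_forall fun x => integral_congr_ae (.of_forall fun t => ?_))
  simp only
  rw [mul_right_comm I (x : ℂ)]
  ring

theorem integral_mul_schwartzFourier {f : ℝ → ℂ} (hf : Integrable f) (φ : 𝓢(ℝ, ℂ)) :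
    ∫ x : ℝ, f x * schwartzFourier φ x = ∫ t : ℝ, fourierT f t * φ t := by
  rw [integral_fourierT_mul hf φ.integrable]
  simp only [schwartzFourier_apply]

theorem ae_eq_of_integral_mul_schwartz {f g : ℝ → ℂ} (hf : LocallyIntegrable f)
    (hg : LocallyIntegrable g)
    (h : ∀ φ : 𝓢(ℝ, ℂ), HasCompactSupport φ → ∫ x, f x * φ x = ∫ x, g x * φ x) : f =ᵐ[volume] g := by
  refine ae_eq_of_integral_contDiff_smul_eq hf hg fun φ hφ hc => ?_
  have hg₁ : HasCompactSupport (Complex.ofRealCLM ∘ φ) := hc.comp_left rfl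
  have hg₂ : ContDiff ℝ ∞ (Complex.ofRealCLM ∘ φ) := by fun_prop
  have := h (hg₁.toSchwartzMap hg₂) hg₁
  simpa [mul_comm] using this

theorem ae_eq_zero_of_fourierT_eq_zero {f : ℝ → ℂ} (hf : Integrable f)
    (h : ∀ t : ℝ, fourierT f t = 0) : f =ᵐ[volume] 0 := by
  refine ae_eq_of_integral_mul_schwartz hf.locallyIntegrable
    (locallyIntegrable_const (0 : ℂ)) fun φ _ => ?_
  obtain ⟨φ₁, rfl⟩ := schwartzFourier_surjective φ
  rw [integral_mul_schwartzFourier hf]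
  simp [h]

end FokkerPlanck

namespace FokkerPlanck

/-! ### The weighted space -/

theorem eLpNorm_two_sq {α : Type*} [MeasurableSpace α] (μ : Measure α) (f : α → ℂ) :
    eLpNorm f 2 μ ^ 2 = ∫⁻ x, ‖f x‖ₑ ^ 2 ∂μ := by
  have h := eLpNorm_nnreal_pow_eq_lintegral (μ := μ) (f := f) (p := 2) two_ne_zero
  simpa only [NNReal.coe_ofNat, ENNReal.rpow_two, ENNReal.coe_ofNat] using h

theorem lintegral_mul_sq_le {α : Type*} [MeasurableSpace α] (μ : Measure α) {f g : α → ℝ≥0∞}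
    (hf : AEMeasurable f μ) (hg : AEMeasurable g μ) :
    (∫⁻ x, f x * g x ∂μ) ^ 2 ≤ (∫⁻ x, f x ^ 2 ∂μ) * ∫⁻ x, g x ^ 2 ∂μ := by
  have h := ENNReal.lintegral_mul_le_Lp_mul_Lq μ Real.HolderConjugate.two_two hf hg
  simp only [Pi.mul_apply, ENNReal.rpow_two] at h
  refine (pow_le_pow_left' h 2).trans_eq ?_
  rw [mul_pow, ← ENNReal.rpow_two, ← ENNReal.rpow_two, ← ENNReal.rpow_mul, ← ENNReal.rpow_mul]
  simp

theorem lintegral_comp_mul_left {a : ℝ} (ha : a ≠ 0) (h : ℝ → ℝ≥0∞) :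
    ∫⁻ x, h (a * x) = ENNReal.ofReal |a⁻¹| * ∫⁻ x, h x := by
  have h1 := lintegral_map_equiv (μ := volume) h (Homeomorph.mulLeft₀ a ha).toMeasurableEquiv
  rw [← smul_eq_mul, ← lintegral_smul_measure, ← Real.map_volume_mul_left ha]
  exact h1.symm

theorem integrable_exp_neg_mul_abs {d : ℝ} (hd : 0 < d) :
    Integrable fun x : ℝ => Real.exp (-d * |x|) := by
  rw [← integrableOn_univ, ← Set.Iic_union_Ioi (a := (0 : ℝ)), integrableOn_union]
  constructor
  · refine (integrableOn_exp_mul_Iic hd 0).congr_fun (fun x hx => ?_) measurableSet_Iic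
    simp [abs_of_nonpos (Set.mem_Iic.1 hx)]
  · refine (integrableOn_exp_mul_Ioi (neg_lt_zero.2 hd) 0).congr_fun (fun x hx => ?_)
      measurableSet_Ioi
    simp [abs_of_pos (Set.mem_Ioi.1 hx)]

variable {β : ℝ}

theorem measurable_weight (β : ℝ) :
    Measurable fun x : ℝ => ENNReal.ofReal (Real.cosh (β * x)) := by
  have : Continuous fun x : ℝ => Real.cosh (β * x) := by fun_prop
  exact this.measurable.ennreal_ofReal

theorem weightMeasure_ac (β : ℝ) : weightMeasure β ≪ volume := withDensity_absolutelyContinuous _ _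

theorem ac_weightMeasure (β : ℝ) : volume ≪ weightMeasure β := by
  refine withDensity_absolutelyContinuous' (measurable_weight β).aemeasurable (.of_forall fun x => ?_)
  simpa using Real.cosh_pos _

theorem aestronglyMeasurable_weight_iff {f : ℝ → ℂ} :
    AEStronglyMeasurable f (weightMeasure β) ↔ AEStronglyMeasurable f :=
  ⟨fun h => h.mono_ac (ac_weightMeasure β), fun h => h.mono_ac (weightMeasure_ac β)⟩

theorem lintegral_weight (h : ℝ → ℝ≥0∞) :
    ∫⁻ x, h x ∂weightMeasure β = ∫⁻ x, ENNReal.ofReal (Real.cosh (β * x)) * h x := by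
  rw [weightMeasure, lintegral_withDensity_eq_lintegral_mul_non_measurable _ (measurable_weight β)
    (by simp)]
  rfl

theorem WSpace.aestronglyMeasurable (f : WSpace β) : AEStronglyMeasurable f :=
  aestronglyMeasurable_weight_iff.1 (Lp.memLp f).1

theorem WSpace.ext {f g : WSpace β} (h : f =ᵐ[volume] g) : f = g :=
  Lp.ext ((weightMeasure_ac β).ae_eq h)

theorem memLp_weight_iff {f : ℝ → ℂ} : MemLp f 2 (weightMeasure β) ↔
    AEStronglyMeasurable f ∧ ∫⁻ x, ENNReal.ofReal (Real.cosh (β * x)) * ‖f x‖ₑ ^ 2 < ⊤ := by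
  rw [MemLp, aestronglyMeasurable_weight_iff, ← lintegral_weight, ← eLpNorm_two_sq]
  simp [ENNReal.pow_lt_top_iff]

theorem coeFn_toLp_weight {f : ℝ → ℂ} (hf : MemLp f 2 (weightMeasure β)) :
    (hf.toLp f : WSpace β) =ᵐ[volume] f := (ac_weightMeasure β).ae_eq hf.coeFn_toLp

theorem ofReal_norm_sq (f : WSpace β) :
    ENNReal.ofReal (‖f‖ ^ 2) = ∫⁻ x, ENNReal.ofReal (Real.cosh (β * x)) * ‖f x‖ₑ ^ 2 := by
  rw [← lintegral_weight, ← eLpNorm_two_sq, Lp.norm_def, ENNReal.ofReal_pow (by positivity),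
    ENNReal.ofReal_toReal (Lp.memLp f).2.ne]

theorem exp_abs_le_cosh (x : ℝ) : Real.exp |x| ≤ 2 * Real.cosh x := by
  rw [← Real.cosh_abs, Real.cosh_eq]
  linarith [Real.exp_pos (-|x|)]

/-- Cauchy-Schwarz with `e^(c|x|) = e^(β|x|/2) e^(-d|x|/2)`, `d = β - 2c > 0`, and `e^(β|x|) ≤ 2
cosh(βx)`. The constant does not depend on `f`, which makes transforms and moments continuous
functionals on `𝓔`. -/
theorem exists_integral_norm_mul_exp_le (hβ : 0 < β) {c : ℝ} (hc : c < β / 2) :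
    ∃ C : ℝ, 0 ≤ C ∧ ∀ f : WSpace β, Integrable (fun x : ℝ => ‖f x‖ * Real.exp (c * |x|)) ∧
      ∫ x : ℝ, ‖f x‖ * Real.exp (c * |x|) ≤ C * ‖f‖ := by
  set d := β - 2 * c
  have hd : 0 < d := by simp only [d]; linarith
  set D : ℝ := ∫ x : ℝ, Real.exp (-d * |x|)
  have hD : ∫⁻ x : ℝ, ENNReal.ofReal (Real.exp (-d * |x|)) = ENNReal.ofReal D :=
    (ofReal_integral_eq_lintegral_ofReal (integrable_exp_neg_mul_abs hd)
      (.of_forall fun x => (Real.exp_pos _).le)).symm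
  have hD0 : 0 ≤ D := integral_nonneg fun x => (Real.exp_pos _).le
  refine ⟨Real.sqrt (2 * D), by positivity, fun f => ?_⟩
  have hm : AEStronglyMeasurable (fun x : ℝ => ‖f x‖ * Real.exp (c * |x|)) :=
    f.aestronglyMeasurable.norm.mul (by fun_prop)
  have key : ∫⁻ x : ℝ, ENNReal.ofReal (‖f x‖ * Real.exp (c * |x|)) ≤
      ENNReal.ofReal (Real.sqrt (2 * D) * ‖f‖) := by
    have h1 := lintegral_mul_sq_le volume
      (f := fun x : ℝ => ENNReal.ofReal (‖f x‖ * Real.exp (β / 2 * |x|)))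
      (g := fun x : ℝ => ENNReal.ofReal (Real.exp (-(d / 2) * |x|)))
      (f.aestronglyMeasurable.norm.mul (by fun_prop)).aemeasurable.ennreal_ofReal
      (by fun_prop)
    have h2 : ∀ x : ℝ, ENNReal.ofReal (‖f x‖ * Real.exp (β / 2 * |x|)) *
        ENNReal.ofReal (Real.exp (-(d / 2) * |x|)) =
        ENNReal.ofReal (‖f x‖ * Real.exp (c * |x|)) := fun x => by
      rw [← ENNReal.ofReal_mul (by positivity), mul_assoc, ← Real.exp_add]
      congr 3
      simp only [d]; ring
    have h3 : ∀ x : ℝ, ENNReal.ofReal (Real.exp (-(d / 2) * |x|)) ^ 2 =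
        ENNReal.ofReal (Real.exp (-d * |x|)) := fun x => by
      rw [← ENNReal.ofReal_pow (by positivity), ← Real.exp_nat_mul]
      congr 2
      push_cast; ring
    have h4 : ∀ x : ℝ, ENNReal.ofReal (‖f x‖ * Real.exp (β / 2 * |x|)) ^ 2 ≤
        ENNReal.ofReal 2 * (ENNReal.ofReal (Real.cosh (β * x)) * ‖f x‖ₑ ^ 2) := fun x => by
      rw [ENNReal.ofReal_mul (by positivity), mul_pow, ofReal_norm, ← ENNReal.ofReal_pow
        (by positivity), ← Real.exp_nat_mul, mul_comm, ← mul_assoc (ENNReal.ofReal 2)]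
      gcongr
      rw [← ENNReal.ofReal_mul (by positivity)]
      refine ENNReal.ofReal_le_ofReal ((le_of_eq ?_).trans (exp_abs_le_cosh _))
      rw [abs_mul, abs_of_pos hβ]
      push_cast
      congr 1; ring
    simp only [h2, h3, hD] at h1
    have h5 : (∫⁻ x : ℝ, ENNReal.ofReal (‖f x‖ * Real.exp (c * |x|))) ^ 2 ≤
        ENNReal.ofReal (Real.sqrt (2 * D) * ‖f‖) ^ 2 := by
      refine h1.trans ((mul_le_mul_left (lintegral_mono h4) _).trans_eq ?_)
      rw [lintegral_const_mul' _ _ (by simp), ← ofReal_norm_sq,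
        ← ENNReal.ofReal_mul (by positivity), ← ENNReal.ofReal_mul (by positivity),
        ← ENNReal.ofReal_pow (by positivity), mul_pow, Real.sq_sqrt (by positivity)]
      congr 1; ring
    exact (ENNReal.pow_le_pow_left_iff two_ne_zero).1 h5
  have hint : Integrable (fun x : ℝ => ‖f x‖ * Real.exp (c * |x|)) := by
    refine ⟨hm, ?_⟩
    rw [hasFiniteIntegral_iff_ofReal (.of_forall fun x => by positivity)]
    exact key.trans_lt ENNReal.ofReal_lt_top
  refine ⟨hint, ?_⟩
  rwa [← ENNReal.ofReal_le_ofReal_iff (by positivity),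
    ofReal_integral_eq_lintegral_ofReal hint (.of_forall fun x => by positivity)]

theorem WSpace.expDecay (hβ : 0 < β) (f : WSpace β) : ExpDecay (β / 2) f :=
  ⟨f.aestronglyMeasurable, fun _ hc =>
    ((exists_integral_norm_mul_exp_le hβ hc).choose_spec.2 f).1⟩

theorem WSpace.integrable_mul (hβ : 0 < β) (f : WSpace β) {k : ℝ → ℂ} (hk : AEStronglyMeasurable k)
    {A c : ℝ} (hc : c < β / 2) (h : ∀ x, ‖k x‖ ≤ A * Real.exp (c * |x|)) :
    Integrable fun x => f x * k x := by
  refine (((f.expDecay hβ).2 c hc).const_mul A).mono' (f.aestronglyMeasurable.mul hk)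
    (.of_forall fun x => ?_)
  rw [norm_mul]
  calc _ ≤ ‖f x‖ * (A * Real.exp (c * |x|)) := by gcongr; exact h x
    _ = _ := by ring

/-- Integration against a kernel of moderate exponential growth is a continuous linear functional. -/
theorem exists_clm_integral_mul (hβ : 0 < β) {k : ℝ → ℂ} (hk : AEStronglyMeasurable k)
    {A c : ℝ} (hc : c < β / 2) (h : ∀ x, ‖k x‖ ≤ A * Real.exp (c * |x|)) :
    ∃ Λ : WSpace β →L[ℂ] ℂ, ∀ f, Λ f = ∫ x, f x * k x := by
  obtain ⟨C, hC, hC'⟩ := exists_integral_norm_mul_exp_le hβ hc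
  have hA : 0 ≤ A := by
    have := (norm_nonneg _).trans (h 0)
    simpa using this
  have hi := fun f : WSpace β => f.integrable_mul hβ hk hc h
  let Λ : WSpace β →ₗ[ℂ] ℂ :=
    { toFun := fun f => ∫ x, f x * k x
      map_add' := fun f g => by
        rw [← integral_add (hi f) (hi g)]
        refine integral_congr_ae ?_
        filter_upwards [(ac_weightMeasure β).ae_le (Lp.coeFn_add f g)] with x hx
        rw [hx, Pi.add_apply, add_mul]
      map_smul' := fun r f => by
        rw [RingHom.id_apply, smul_eq_mul, ← integral_const_mul]
        refine integral_congr_ae ?_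
        filter_upwards [(ac_weightMeasure β).ae_le (Lp.coeFn_smul r f)] with x hx
        rw [hx, Pi.smul_apply, smul_eq_mul, mul_assoc] }
  refine ⟨Λ.mkContinuous (A * C) fun f => ?_, fun f => rfl⟩
  calc ‖∫ x, f x * k x‖ ≤ ∫ x, A * (‖f x‖ * Real.exp (c * |x|)) := by
        refine norm_integral_le_of_norm_le ((hC' f).1.const_mul A) (.of_forall fun x => ?_)
        rw [norm_mul]
        calc _ ≤ ‖f x‖ * (A * Real.exp (c * |x|)) := by gcongr; exact h x
          _ = _ := by ring
    _ ≤ A * C * ‖f‖ := by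
        rw [integral_const_mul, mul_assoc]
        gcongr
        exact (hC' f).2

theorem exists_clm_fourierT (hβ : 0 < β) {z : ℂ} (hz : z ∈ strip β) (n : ℕ) :
    ∃ Λ : WSpace β →L[ℂ] ℂ, ∀ f, Λ f = fourierT (fun x : ℝ => (-(I * (x : ℂ))) ^ n * f x) z := by
  have hz' : |z.im| < β / 2 := hz
  set c := (|z.im| + β / 2) / 2
  have hzc : 0 < c - |z.im| := by simp only [c]; linarith
  have hcb : c < β / 2 := by simp only [c]; linarith
  obtain ⟨Λ, hΛ⟩ := exists_clm_integral_mul hβ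
    (k := fun x : ℝ => (-(I * (x : ℂ))) ^ n * cexp (-(I * (x : ℂ) * z)))
    (A := n.factorial / (c - |z.im|) ^ n)
    (by fun_prop : Continuous _).aestronglyMeasurable hcb (fun x => by
      have h1 : |x| ^ n ≤ n.factorial / (c - |z.im|) ^ n * Real.exp ((c - |z.im|) * |x|) := by
        have := Real.pow_div_factorial_le_exp ((c - |z.im|) * |x|) (by positivity) n
        rw [mul_pow, div_le_iff₀ (by positivity)] at this
        rw [div_mul_eq_mul_div, le_div_iff₀ (by positivity)]
        linarith
      have h2 : Real.exp (c * |x|) = Real.exp ((c - |z.im|) * |x|) * Real.exp (|z.im| * |x|) := by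
        rw [← Real.exp_add]; ring_nf
      rw [norm_mul, h2, ← mul_assoc]
      refine mul_le_mul ?_ (norm_kernel_le le_rfl x) (by positivity) (by positivity)
      simpa using h1)
  refine ⟨Λ, fun f => (hΛ f).trans (integral_congr_ae (.of_forall fun x => ?_))⟩
  simp only
  ring

theorem WSpace.fourierT_sub (hβ : 0 < β) {z : ℂ} (hz : z ∈ strip β) (f g : WSpace β) :
    fourierT (f - g : WSpace β) z = fourierT f z - fourierT g z := by
  obtain ⟨Λ, hΛ⟩ := exists_clm_fourierT hβ hz 0
  simp only [pow_zero, one_mul] at hΛ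
  simp only [← hΛ, map_sub]

theorem WSpace.fourierT_smul (hβ : 0 < β) {z : ℂ} (hz : z ∈ strip β) (r : ℂ) (f : WSpace β) :
    fourierT (r • f : WSpace β) z = r * fourierT f z := by
  obtain ⟨Λ, hΛ⟩ := exists_clm_fourierT hβ hz 0
  simp only [pow_zero, one_mul] at hΛ
  simp only [← hΛ, map_smul, smul_eq_mul]

theorem fourierT_congr_ae {f g : ℝ → ℂ} (h : f =ᵐ[volume] g) (z : ℂ) :
    fourierT f z = fourierT g z :=
  integral_congr_ae (by filter_upwards [h] with x hx; rw [hx])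

theorem WSpace.eq_of_fourierT_eq (hβ : 0 < β) {f g : WSpace β}
    (h : ∀ t : ℝ, fourierT f t = fourierT g t) : f = g := by
  rw [← sub_eq_zero]
  refine WSpace.ext ((ae_eq_zero_of_fourierT_eq_zero
    (((f - g).expDecay hβ).integrable (by positivity)) fun t => ?_).trans ?_)
  · rw [WSpace.fourierT_sub hβ (ofReal_mem_strip hβ t), h, sub_self]
  · exact ((ac_weightMeasure β).ae_eq (Lp.coeFn_zero ℂ 2 (weightMeasure β))).symm

/-! ### Plancherel's theorem -/

theorem continuous_fourierT_ofReal {f : ℝ → ℂ} (hf : Integrable f) :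
    Continuous fun t : ℝ => fourierT f t := by
  refine continuous_of_dominated (bound := fun x => ‖f x‖)
    (fun t => hf.1.mul (aestronglyMeasurable_kernel t)) (fun t => .of_forall fun x => ?_)
    hf.norm (.of_forall fun x => by fun_prop)
  rw [norm_mul, norm_kernel]; simp

theorem integral_mul_fourier {f : ℝ → ℂ} (hf : Integrable f) (φ : 𝓢(ℝ, ℂ)) :
    ∫ x : ℝ, f x * FourierTransform.fourier φ x =
      ∫ t : ℝ, FourierTransform.fourier f t * φ t := by
  have := VectorFourier.integral_fourierIntegral_smul_eq_flip (μ := volume) (ν := volume)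
    (L := innerₗ ℝ) Real.continuous_fourierChar continuous_inner hf φ.integrable
  simp only [flip_innerₗ, smul_eq_mul] at this
  exact this.symm

/-- Both sides have the same pairing with every Schwartz function. This lets the `L²` isometry be
used for transforms given by an integral. -/
theorem fourier_toLp_ae_eq {f : ℝ → ℂ} (hf : Integrable f) (hf2 : MemLp f 2) :
    (FourierTransform.fourier (hf2.toLp f) : Lp ℂ 2 (volume : Measure ℝ)) =ᵐ[volume]
      FourierTransform.fourier f := by
  have hcont : Continuous (FourierTransform.fourier f) := by
    have := (continuous_fourierT_ofReal hf).comp (continuous_const_mul (2 * Real.pi))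
    refine this.congr fun t => ?_
    rw [Function.comp_apply, fourierT_ofReal, inv_mul_cancel_left₀ Real.two_pi_pos.ne']
  refine ae_eq_of_integral_mul_schwartz ((Lp.memLp _).locallyIntegrable one_le_two)
    hcont.locallyIntegrable fun φ _ => ?_
  rw [← integral_mul_fourier hf]
  have h1 := DFunLike.congr_fun (Lp.fourier_toTemperedDistribution_eq (hf2.toLp f)) φ
  rw [TemperedDistribution.fourier_apply, Lp.toTemperedDistribution_apply,
    Lp.toTemperedDistribution_apply] at h1
  simp only [smul_eq_mul, mul_comm (φ _)] at h1
  rw [← h1]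
  refine integral_congr_ae ?_
  filter_upwards [hf2.coeFn_toLp] with x hx
  rw [hx, mul_comm]

theorem lintegral_norm_fourierT_sq {f : ℝ → ℂ} (hf : Integrable f) (hf2 : MemLp f 2) :
    ∫⁻ t : ℝ, ‖fourierT f t‖ₑ ^ 2 = ENNReal.ofReal (2 * Real.pi) * ∫⁻ x, ‖f x‖ₑ ^ 2 := by
  have h1 : eLpNorm (FourierTransform.fourier f) 2 volume = eLpNorm f 2 volume := by
    have h := Lp.norm_fourier_eq (hf2.toLp f)
    rw [Lp.norm_def, Lp.norm_def, ENNReal.toReal_eq_toReal_iff' (Lp.memLp _).2.ne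
      (Lp.memLp _).2.ne] at h
    rwa [eLpNorm_congr_ae (fourier_toLp_ae_eq hf hf2), eLpNorm_congr_ae hf2.coeFn_toLp] at h
  simp only [fourierT_ofReal]
  rw [lintegral_comp_mul_left (inv_ne_zero Real.two_pi_pos.ne')
    (fun t => ‖FourierTransform.fourier f t‖ₑ ^ 2), ← eLpNorm_two_sq, h1, eLpNorm_two_sq, inv_inv,
    abs_of_pos Real.two_pi_pos]

theorem fourierT_add_mul_I (f : ℝ → ℂ) (t b : ℝ) :
    fourierT f (t + b * I) = fourierT (fun x : ℝ => f x * Real.exp (b * x)) t := by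
  refine integral_congr_ae (.of_forall fun x => ?_)
  simp only
  rw [mul_assoc (f x), ofReal_exp, ← Complex.exp_add]
  congr 2
  push_cast
  linear_combination -(x : ℂ) * b * I_sq

/-- The easy half of Paley-Wiener. Plancherel is applied to `e^(bx) f(x)`; the constant is the `2π`
of this normalisation times the `2` from `e^(2bx) ≤ 2 cosh(βx)`. -/
theorem lintegral_norm_fourierT_line_le (hβ : 0 < β) (f : WSpace β) {b : ℝ} (hb : |b| < β / 2) :
    ∫⁻ t : ℝ, ‖fourierT f (t + b * I)‖ₑ ^ 2 ≤
      ENNReal.ofReal (4 * Real.pi) * ENNReal.ofReal (‖f‖ ^ 2) := by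
  have hm : AEStronglyMeasurable (fun x : ℝ => f x * Real.exp (b * x)) :=
    f.aestronglyMeasurable.mul
      (by fun_prop : Continuous fun x : ℝ => (Real.exp (b * x) : ℂ)).aestronglyMeasurable
  have hle : ∀ x : ℝ, ‖f x * Real.exp (b * x)‖ₑ ^ 2 ≤
      ENNReal.ofReal 2 * (ENNReal.ofReal (Real.cosh (β * x)) * ‖f x‖ₑ ^ 2) := fun x => by
    rw [enorm_mul, mul_pow, mul_comm, ← mul_assoc]
    gcongr
    rw [← ofReal_norm, norm_real, Real.norm_of_nonneg (by positivity),
      ← ENNReal.ofReal_pow (by positivity), ← Real.exp_nat_mul, ← ENNReal.ofReal_mul (by positivity)]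
    refine ENNReal.ofReal_le_ofReal (le_trans ?_ (exp_abs_le_cosh _))
    rw [Real.exp_le_exp, abs_mul, abs_of_pos hβ]
    calc ((2 : ℕ) : ℝ) * (b * x) ≤ 2 * (|b| * |x|) := by
          rw [← abs_mul]; push_cast; gcongr; exact le_abs_self _
      _ ≤ 2 * (β / 2 * |x|) := by gcongr
      _ = β * |x| := by ring
  have hlt : ∫⁻ x : ℝ, ‖f x * Real.exp (b * x)‖ₑ ^ 2 ≤ ENNReal.ofReal 2 * ENNReal.ofReal (‖f‖ ^ 2) := by
    refine (lintegral_mono hle).trans_eq ?_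
    rw [lintegral_const_mul' _ _ (by simp), ← ofReal_norm_sq]
  have h2 : MemLp (fun x : ℝ => f x * Real.exp (b * x)) 2 := by
    refine ⟨hm, ?_⟩
    have h := eLpNorm_two_sq volume (fun x : ℝ => f x * Real.exp (b * x)) ▸ hlt
    refine (ENNReal.pow_lt_top_iff.1 (h.trans_lt ?_)).resolve_right two_ne_zero
    exact (ENNReal.mul_lt_top (by simp) ENNReal.ofReal_lt_top)
  have h1 : Integrable (fun x : ℝ => f x * Real.exp (b * x)) := by
    refine f.integrable_mul hβ (by fun_prop : Continuous _).aestronglyMeasurable hb (A := 1)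
      fun x => ?_
    rw [norm_real, Real.norm_of_nonneg (by positivity), one_mul, Real.exp_le_exp, ← abs_mul]
    exact le_abs_self _
  simp only [fourierT_add_mul_I]
  rw [lintegral_norm_fourierT_sq h1 h2]
  refine (mul_le_mul_right hlt _).trans_eq ?_
  rw [← mul_assoc, ← ENNReal.ofReal_mul (by positivity)]
  congr 2
  ring

end FokkerPlanck

namespace FokkerPlanck

open Filter Topology

variable {β : ℝ}

/-! ### The Paley-Wiener theorem for a strip -/

theorem eqOn_strip_of_eq_real (hβ : 0 < β) {F G : ℂ → ℂ} (hF : DifferentiableOn ℂ F (strip β))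
    (hG : DifferentiableOn ℂ G (strip β)) (h : ∀ t : ℝ, F t = G t) : Set.EqOn F G (strip β) := by
  refine (hF.analyticOnNhd (isOpen_strip β)).eqOn_of_preconnected_of_frequently_eq
    (hG.analyticOnNhd (isOpen_strip β)) (convex_strip β).isPreconnected
    (ofReal_mem_strip hβ 0) ?_
  have h1 : Tendsto (fun n : ℕ => (((1 / ((n : ℝ) + 1) : ℝ)) : ℂ)) atTop (𝓝[≠] ((0 : ℝ) : ℂ)) := by
    refine tendsto_nhdsWithin_iff.2 ⟨?_, .of_forall fun n => ?_⟩
    · exact (continuous_ofReal.tendsto 0).comp tendsto_one_div_add_atTop_nhds_zero_nat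
    · simp only [Set.mem_compl_iff, Set.mem_singleton_iff, ofReal_inj]
      positivity
  exact h1.frequently (.of_forall fun n => h _)

theorem add_mul_I_mem_strip {b : ℝ} (hb : |b| < β / 2) (x : ℝ) : (x + b * I : ℂ) ∈ strip β := by
  simpa [strip] using hb

/-- Shifting a horizontal line of integration. -/
theorem integral_line_eq_integral_real {b C ε : ℝ} (hb : |b| < β / 2) {G : ℂ → ℂ} (hε : 0 < ε)
    (hG : DifferentiableOn ℂ G (strip β))
    (hC : ∀ z : ℂ, |z.im| ≤ |b| → ‖G z‖ ≤ C * Real.exp (-ε * z.re ^ 2)) :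
    ∫ x : ℝ, G (x + b * I) = ∫ x : ℝ, G x := by
  have hline : ∀ y : ℝ, |y| ≤ |b| → Integrable fun x : ℝ => G (x + y * I) := by
    intro y hy
    have hcont : Continuous fun x : ℝ => G (x + y * I) := by
      refine hG.continuousOn.comp_continuous (by fun_prop) fun x => ?_
      exact add_mul_I_mem_strip (hy.trans_lt hb) x
    refine ((integrable_exp_neg_mul_sq hε).const_mul C).mono' hcont.aestronglyMeasurable
      (.of_forall fun x => ?_)
    simpa using hC (x + y * I) (by simpa using hy)
  have h0 : Integrable fun x : ℝ => G x := by simpa using hline 0 (by simp)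
  have hgauss : Tendsto (fun n : ℕ => C * Real.exp (-ε * (n : ℝ) ^ 2) * |b|) atTop (𝓝 0) := by
    have h1 : Tendsto (fun n : ℕ => ε * (n : ℝ) ^ 2) atTop atTop :=
      ((tendsto_pow_atTop two_ne_zero).comp tendsto_natCast_atTop_atTop).const_mul_atTop hε
    have h2 := ((Real.tendsto_exp_neg_atTop_nhds_zero.comp h1).const_mul C).mul_const |b|
    simpa [Function.comp_def, neg_mul] using h2
  -- The vertical sides of the rectangle, at real part `±n`; the Gaussian factor in the bound on `G`
  -- kills both.
  have hvert : ∀ (σ : ℝ), σ ^ 2 = 1 → Tendsto (fun n : ℕ =>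
      ∫ y : ℝ in (0 : ℝ)..b, G (((σ * n : ℝ) : ℂ) + y * I)) atTop (𝓝 0) := by
    intro σ hσ
    refine squeeze_zero_norm (fun n => ?_) hgauss
    refine (intervalIntegral.norm_integral_le_of_norm_le_const fun y hy => ?_).trans_eq
      (by rw [sub_zero])
    have hy' : |y| ≤ |b| := by
      have := Set.abs_sub_left_of_mem_uIcc (Set.uIoc_subset_uIcc hy)
      simpa using this
    refine (hC _ (by simpa using hy')).trans_eq ?_
    have : ((((σ * n : ℝ) : ℂ) + y * I).re) = σ * n := by simp
    rw [this, mul_pow, hσ, one_mul]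
  have hrect : ∀ n : ℕ, (∫ x : ℝ in (-n : ℝ)..n, G x) - (∫ x : ℝ in (-n : ℝ)..n, G (x + b * I)) +
      I * (∫ y : ℝ in (0 : ℝ)..b, G (((1 * n : ℝ) : ℂ) + y * I)) -
      I * (∫ y : ℝ in (0 : ℝ)..b, G (((-1 * n : ℝ) : ℂ) + y * I)) = 0 := by
    intro n
    have := integral_boundary_rect_eq_zero_of_differentiableOn G ((-n : ℝ) : ℂ) ((n : ℝ) + b * I)
      (hG.mono fun z hz => ?_)
    · simpa using this
    · have hz2 := (mem_reProdIm.1 hz).2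
      simp only [ofReal_im, add_im, mul_im, ofReal_re, I_im, mul_one, I_re, mul_zero, add_zero,
        zero_add] at hz2
      have := Set.abs_sub_left_of_mem_uIcc hz2
      rw [sub_zero, sub_zero] at this
      exact this.trans_lt hb
  have hneg : Tendsto (fun n : ℕ => (-n : ℝ)) atTop atBot :=
    tendsto_neg_atTop_atBot.comp tendsto_natCast_atTop_atTop
  have l1 := intervalIntegral_tendsto_integral h0 hneg tendsto_natCast_atTop_atTop
  have l2 := intervalIntegral_tendsto_integral (hline b le_rfl) hneg tendsto_natCast_atTop_atTop
  have l3 := (hvert 1 (by norm_num)).const_mul I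
  have l4 := (hvert (-1) (by norm_num)).const_mul I
  have hlim := ((l1.sub l2).add l3).sub l4
  simp only [hrect, mul_zero, add_zero, sub_zero] at hlim
  exact (sub_eq_zero.1 (tendsto_nhds_unique hlim tendsto_const_nhds)).symm

/-- Boundedness on every smaller closed strip. -/
def BoundedOnSubstrips (β : ℝ) (F : ℂ → ℂ) : Prop :=
  ∀ c < β / 2, ∃ K : ℝ, ∀ z : ℂ, |z.im| ≤ c → ‖F z‖ ≤ K

theorem ExpDecay.boundedOnSubstrips {f : ℝ → ℂ} (hf : ExpDecay (β / 2) f) :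
    BoundedOnSubstrips β (fourierT f) :=
  fun _ hc => ⟨_, fun _ hz => hf.norm_fourierT_le hc hz⟩

theorem norm_exp_neg_mul_sq (ε : ℝ) (z : ℂ) :
    ‖cexp (-(ε : ℂ) * z ^ 2)‖ = Real.exp (-ε * z.re ^ 2) * Real.exp (ε * z.im ^ 2) := by
  rw [norm_exp, ← Real.exp_add]
  congr 1
  simp [sq]
  ring

/-- The effect of a translation into the strip, tested against the Fourier transform of `φ`. -/
theorem integral_line_mul_fourierT {b : ℝ} (hb : |b| < β / 2) {F : ℂ → ℂ}
    (hF : DifferentiableOn ℂ F (strip β)) (hFb : BoundedOnSubstrips β F) {φ : ℝ → ℂ}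
    (hφ : Integrable φ) (hφb : Integrable fun x : ℝ => (Real.exp (b * x) : ℂ) * φ x)
    (h1 : Integrable fun t : ℝ => fourierT φ (-t : ℝ))
    (h2 : Integrable fun t : ℝ => fourierT (fun x : ℝ => (Real.exp (b * x) : ℂ) * φ x) (-t : ℝ)) :
    ∫ t : ℝ, F (t + b * I) * fourierT φ (-t : ℝ) =
      ∫ t : ℝ, F t * fourierT (fun x : ℝ => (Real.exp (b * x) : ℂ) * φ x) (-t : ℝ) := by
  obtain ⟨K, hK⟩ := hFb |b| hb
  have hline : ∀ y : ℝ, |y| ≤ |b| → Continuous fun x : ℝ => F (x + y * I) := fun y hy =>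
    hF.continuousOn.comp_continuous (by fun_prop) fun x => add_mul_I_mem_strip (hy.trans_lt hb) x
  have hK0 : 0 ≤ K := (norm_nonneg _).trans (hK 0 (by simp))
  -- the regularised integrals
  have reg : ∀ (y : ℝ), |y| ≤ |b| → ∀ ε : ℝ, 0 < ε → ∀ ψ : ℝ → ℂ, Integrable ψ →
      ∫ t : ℝ, F (t + y * I) * cexp (-(ε : ℂ) * (t + y * I) ^ 2) * fourierT ψ (-t : ℝ) =
        ∫ x : ℝ, (∫ t : ℝ, F (t + y * I) * cexp (-(ε : ℂ) * (t + y * I) ^ 2) *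
          cexp (I * x * t)) * ψ x := by
    intro y hy ε hε ψ hψ
    set u : ℝ → ℂ := fun t => F ((-t : ℝ) + y * I) * cexp (-(ε : ℂ) * ((-t : ℝ) + y * I) ^ 2) with hu
    have hu1 : Integrable u := by
      have hc : Continuous fun t : ℝ => F (t + y * I) * cexp (-(ε : ℂ) * (t + y * I) ^ 2) :=
        (hline y hy).mul (by fun_prop)
      refine ((integrable_exp_neg_mul_sq hε).const_mul (K * Real.exp (ε * y ^ 2))).mono'
        (hc.comp continuous_neg).aestronglyMeasurable (.of_forall fun t => ?_)
      simp only [hu]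
      rw [norm_mul, norm_exp_neg_mul_sq]
      have := hK ((-t : ℝ) + y * I) (by simpa using hy)
      calc _ ≤ K * (Real.exp (-ε * (((-t : ℝ) + y * I : ℂ)).re ^ 2) *
            Real.exp (ε * (((-t : ℝ) + y * I : ℂ)).im ^ 2)) := by gcongr
        _ = _ := by simp; ring
    have h := integral_fourierT_mul hψ hu1
    rw [← integral_neg_eq_self]
    simp only [neg_neg]
    calc _ = ∫ t : ℝ, fourierT ψ t * u t := by
          refine integral_congr_ae (.of_forall fun t => ?_)
          simp only [hu]; ring
      _ = ∫ x : ℝ, ψ x * fourierT u x := h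
      _ = _ := by
          refine integral_congr_ae (.of_forall fun x => ?_)
          simp only
          rw [mul_comm, fourierT, ← integral_neg_eq_self]
          simp only [hu, neg_neg]
          congr 1
          refine integral_congr_ae (.of_forall fun t => ?_)
          simp only
          congr 2
          push_cast
          ring
  -- `F` is only bounded on the relevant lines, so moving the contour needs the Gaussian regulariser
  -- for decay at infinity. The shift turns the translation by `ib` into the factor `e^(bx)`.
  have shift : ∀ ε : ℝ, 0 < ε → ∀ x : ℝ,
      ∫ t : ℝ, F (t + b * I) * cexp (-(ε : ℂ) * (t + b * I) ^ 2) * cexp (I * x * t) =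
        Real.exp (b * x) * ∫ t : ℝ, F t * cexp (-(ε : ℂ) * t ^ 2) * cexp (I * x * t) := by
    intro ε hε x
    have h := integral_line_eq_integral_real (C := K * Real.exp (ε * b ^ 2) * Real.exp (|b| * |x|))
      hb (G := fun z => F z * cexp (-(ε : ℂ) * z ^ 2) * cexp (I * x * z)) hε
      ((hF.mul (by fun_prop)).mul (by fun_prop)) (fun z hz => ?_)
    · rw [← h, ← integral_const_mul]
      refine integral_congr_ae (.of_forall fun t => ?_)
      simp only
      have : cexp (I * x * t) = Real.exp (b * x) * cexp (I * x * (t + b * I)) := by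
        rw [ofReal_exp, ← Complex.exp_add]
        congr 1
        push_cast
        linear_combination -(x : ℂ) * b * I_sq
      rw [this]; ring
    · rw [norm_mul, norm_mul, norm_exp_neg_mul_sq]
      have e1 : ‖cexp (I * x * z)‖ ≤ Real.exp (|b| * |x|) := by
        have := norm_kernel_le (z := -z) (c := |b|) (by simpa using hz) x
        simpa using this
      have e2 : Real.exp (ε * z.im ^ 2) ≤ Real.exp (ε * b ^ 2) := by
        rw [Real.exp_le_exp]
        exact mul_le_mul_of_nonneg_left (sq_le_sq.2 hz) hε.le
      calc _ ≤ K * (Real.exp (-ε * z.re ^ 2) * Real.exp (ε * b ^ 2)) * Real.exp (|b| * |x|) := by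
            gcongr; exact hK z hz
        _ = _ := by ring
  -- The regulariser is removed along `ε = 1/(n+1)`. Since `ε ≤ 1`, it is bounded by `exp(y²)`
  -- uniformly in `n`, which gives the dominating function.
  have lim : ∀ (y : ℝ), |y| ≤ |b| → ∀ w : ℝ → ℂ, Integrable w →
      Tendsto (fun n : ℕ => ∫ t : ℝ, F (t + y * I) *
        cexp (-((1 / ((n : ℝ) + 1) : ℝ) : ℂ) * (t + y * I) ^ 2) * w t) atTop
        (𝓝 (∫ t : ℝ, F (t + y * I) * w t)) := by
    intro y hy w hw
    refine tendsto_integral_of_dominated_convergence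
      (fun t => K * Real.exp (y ^ 2) * ‖w t‖) (fun n => ?_) (hw.norm.const_mul _)
      (fun n => .of_forall fun t => ?_) (.of_forall fun t => ?_)
    · exact (((hline y hy).mul (by fun_prop)).aestronglyMeasurable).mul hw.1
    · rw [norm_mul, norm_mul, norm_exp_neg_mul_sq]
      have hn0 : 0 < 1 / ((n : ℝ) + 1) := by positivity
      have hn1 : 1 / ((n : ℝ) + 1) ≤ 1 := by
        rw [div_le_one (by positivity)]; linarith [(Nat.cast_nonneg n : (0 : ℝ) ≤ n)]
      have e1 : Real.exp (-(1 / ((n : ℝ) + 1)) * (t + y * I : ℂ).re ^ 2) ≤ 1 := by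
        rw [Real.exp_le_one_iff]
        nlinarith [sq_nonneg (t + y * I : ℂ).re]
      have e2 : Real.exp (1 / ((n : ℝ) + 1) * (t + y * I : ℂ).im ^ 2) ≤ Real.exp (y ^ 2) := by
        rw [Real.exp_le_exp]
        simp only [add_im, ofReal_im, mul_im, ofReal_re, I_im, mul_one, I_re, mul_zero, add_zero,
          zero_add]
        nlinarith [sq_nonneg y]
      calc _ ≤ K * (1 * Real.exp (y ^ 2)) * ‖w t‖ := by
            gcongr; exact hK _ (by simpa using hy)
        _ = _ := by ring
    · have h0 : Tendsto (fun n : ℕ => -(((1 / ((n : ℝ) + 1) : ℝ)) : ℂ) * (t + y * I) ^ 2) atTop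
          (𝓝 0) := by
        have := ((continuous_ofReal.tendsto 0).comp
          tendsto_one_div_add_atTop_nhds_zero_nat).neg.mul_const ((t + y * I : ℂ) ^ 2)
        simpa [Function.comp_def] using this
      have h3 := (((continuous_exp.tendsto 0).comp h0).const_mul (F (t + y * I))).mul_const (w t)
      simpa [Function.comp_def] using h3
  have l1 := lim b le_rfl _ h1
  have l2 := lim 0 (by simp) _ h2
  simp only [ofReal_zero, zero_mul, add_zero] at l2
  refine tendsto_nhds_unique l1 (l2.congr fun n => ?_)
  have hn0 : 0 < 1 / ((n : ℝ) + 1) := by positivity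
  rw [reg b le_rfl _ hn0 φ hφ]
  have r2 := reg 0 (by simp) _ hn0 _ hφb
  simp only [ofReal_zero, zero_mul, add_zero] at r2
  rw [r2]
  refine integral_congr_ae (.of_forall fun x => ?_)
  simp only
  rw [shift _ hn0]
  ring

end FokkerPlanck

/-! ### `L²` Fourier inversion and the converse half of Paley-Wiener. -/

namespace FokkerPlanck

open Filter Topology

variable {β : ℝ}

theorem memLp_two_of_lintegral_lt_top {u : ℝ → ℂ} (hu : AEStronglyMeasurable u)
    (h : ∫⁻ t, ‖u t‖ₑ ^ 2 < ⊤) : MemLp u 2 := by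
  refine ⟨hu, ?_⟩
  rw [← eLpNorm_two_sq] at h
  exact (ENNReal.pow_lt_top_iff.1 h).resolve_right two_ne_zero

/-- A function in `L²` need not be integrable, so its inverse transform is described weakly, by
pairing with Schwartz functions. The dilation `t ↦ 2πt` passes between the two normalisations of the
transform. -/
theorem exists_L2_inverse_fourier {u : ℝ → ℂ} (hu : MemLp u 2) :
    ∃ f : ℝ → ℂ, MemLp f 2 ∧
      ∫⁻ x, ‖f x‖ₑ ^ 2 = ENNReal.ofReal (2 * Real.pi)⁻¹ * ∫⁻ t, ‖u t‖ₑ ^ 2 ∧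
      ∀ φ : 𝓢(ℝ, ℂ), ∫ x, f x * φ x =
        ((2 * Real.pi)⁻¹ : ℝ) * ∫ t : ℝ, u t * fourierT φ (-t : ℝ) := by
  have hpi : (2 * Real.pi) ≠ 0 := Real.two_pi_pos.ne'
  have hvn : ∫⁻ t, ‖u (2 * Real.pi * t)‖ₑ ^ 2 =
      ENNReal.ofReal (2 * Real.pi)⁻¹ * ∫⁻ t, ‖u t‖ₑ ^ 2 := by
    rw [lintegral_comp_mul_left hpi (fun t => ‖u t‖ₑ ^ 2),
      abs_of_pos (inv_pos.2 Real.two_pi_pos)]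
  have hv : MemLp (fun t => u (2 * Real.pi * t)) 2 := by
    refine memLp_two_of_lintegral_lt_top ?_ ?_
    · refine hu.1.comp_quasiMeasurePreserving ⟨measurable_const_mul _, ?_⟩
      rw [Real.map_volume_mul_left hpi]
      exact Measure.smul_absolutelyContinuous
    · rw [hvn, ← eLpNorm_two_sq]
      exact ENNReal.mul_lt_top ENNReal.ofReal_lt_top (ENNReal.pow_lt_top hu.2)
  set V : Lp ℂ 2 (volume : Measure ℝ) := hv.toLp _
  set f : Lp ℂ 2 (volume : Measure ℝ) := FourierTransformInv.fourierInv V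
  refine ⟨f, Lp.memLp f, ?_, fun φ => ?_⟩
  · have h := Lp.norm_fourier_eq f
    rw [FourierTransform.fourier_fourierInv_eq, Lp.norm_def, Lp.norm_def,
      ENNReal.toReal_eq_toReal_iff' (Lp.memLp _).2.ne (Lp.memLp _).2.ne,
      eLpNorm_congr_ae hv.coeFn_toLp] at h
    rw [← eLpNorm_two_sq, ← h, eLpNorm_two_sq, hvn]
  · have h1 := DFunLike.congr_fun (Lp.fourierInv_toTemperedDistribution_eq V) φ
    rw [TemperedDistribution.fourierInv_apply, Lp.toTemperedDistribution_apply,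
      Lp.toTemperedDistribution_apply] at h1
    simp only [smul_eq_mul, mul_comm (φ _)] at h1
    rw [← h1]
    have h2 := Measure.integral_comp_mul_left (fun t : ℝ => u t * fourierT φ (-t : ℝ))
      (2 * Real.pi)
    rw [abs_of_pos (inv_pos.2 Real.two_pi_pos), real_smul] at h2
    rw [← h2]
    refine integral_congr_ae ?_
    filter_upwards [hv.coeFn_toLp] with t ht
    rw [ht, mul_comm, SchwartzMap.fourierInv_coe, Real.fourierInv_eq_fourier_neg, fourierT_ofReal,
      ← mul_neg, inv_mul_cancel_left₀ hpi]

theorem HasCompactSupport.exists_schwartz_exp_mul {φ : 𝓢(ℝ, ℂ)} (hφ : HasCompactSupport φ)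
    (b : ℝ) : ∃ ψ : 𝓢(ℝ, ℂ), ∀ x, ψ x = (Real.exp (b * x) : ℂ) * φ x := by
  have h1 : HasCompactSupport fun x : ℝ => (Real.exp (b * x) : ℂ) * φ x := hφ.mul_left
  have h2 : ContDiff ℝ ∞ fun x : ℝ => (Real.exp (b * x) : ℂ) * φ x := by
    refine ContDiff.mul ?_ φ.smooth'
    exact ofRealCLM.contDiff.comp (by fun_prop : ContDiff ℝ ∞ fun x : ℝ => Real.exp (b * x))
  exact ⟨h1.toSchwartzMap h2, fun x => rfl⟩

theorem integrable_fourierT_schwartz_neg (φ : 𝓢(ℝ, ℂ)) :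
    Integrable fun t : ℝ => fourierT φ (-t : ℝ) := by
  simp only [← schwartzFourier_apply]
  exact (schwartzFourier φ).integrable.comp_neg

theorem fourierT_schwartzFourier_neg (φ : 𝓢(ℝ, ℂ)) (t : ℝ) :
    fourierT (schwartzFourier φ) (-t : ℝ) = 2 * Real.pi * φ t := by
  have h1 := Measure.integral_comp_mul_left
    (fun y : ℝ => cexp (2 * Real.pi * (y * t) * I) * FourierTransform.fourier φ y)
    (2 * Real.pi)⁻¹
  rw [inv_inv, abs_of_pos Real.two_pi_pos] at h1
  have h2 : (FourierTransformInv.fourierInv (FourierTransform.fourier φ) : 𝓢(ℝ, ℂ)) t = φ t := by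
    rw [FourierTransform.fourierInv_fourier_eq]
  rw [SchwartzMap.fourierInv_coe, Real.fourierInv_eq'] at h2
  simp only [smul_eq_mul, RCLike.inner_apply, conj_trivial] at h2
  rw [← h2]
  refine Eq.trans ?_ (h1.trans ?_)
  · refine integral_congr_ae (.of_forall fun x => ?_)
    have hpi : (Real.pi : ℂ) ≠ 0 := by exact_mod_cast Real.pi_ne_zero
    have h3 : schwartzFourier φ x = FourierTransform.fourier φ ((2 * Real.pi)⁻¹ * x) := rfl
    simp only [h3]
    rw [mul_comm]
    congr 2
    push_cast
    field_simp
  · rw [real_smul]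
    push_cast
    congr 1
    refine integral_congr_ae (.of_forall fun x => ?_)
    simp only
    congr 2
    ring

/-- The **Paley-Wiener theorem** for the strip: a bounded family of `L²` norms on horizontal lines
characterises Fourier transforms of functions in `𝓔`. -/
theorem exists_fourierT_eq (hβ : 0 < β) {F : ℂ → ℂ} (hF : DifferentiableOn ℂ F (strip β))
    (hFb : BoundedOnSubstrips β F) {M : ℝ≥0∞} (hM : M ≠ ⊤)
    (h : ∀ b : ℝ, |b| < β / 2 → ∫⁻ t : ℝ, ‖F (t + b * I)‖ₑ ^ 2 ≤ M) :
    ∃ f : WSpace β, (∀ z ∈ strip β, fourierT f z = F z) ∧ ENNReal.ofReal (‖f‖ ^ 2) ≤ M := by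
  have hline : ∀ b : ℝ, |b| < β / 2 → MemLp (fun t : ℝ => F (t + b * I)) 2 := fun b hb =>
    memLp_two_of_lintegral_lt_top (hF.continuousOn.comp_continuous (by fun_prop) fun x =>
      add_mul_I_mem_strip hb x).aestronglyMeasurable ((h b hb).trans_lt hM.lt_top)
  have hβ0 : |(0 : ℝ)| < β / 2 := by simpa using hβ
  obtain ⟨f, hf2, -, hf⟩ := exists_L2_inverse_fourier (hline 0 hβ0)
  have hfm := hf2.1
  have hexp : ∀ b : ℝ, Continuous fun x : ℝ => (Real.exp (b * x) : ℂ) := fun b => by fun_prop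
  -- the weighted bound on each line
  have hb : ∀ b : ℝ, |b| < β / 2 →
      ∫⁻ x : ℝ, ENNReal.ofReal (Real.exp (2 * b * x)) * ‖f x‖ₑ ^ 2 ≤ M := by
    intro b hb
    obtain ⟨g, hg2, hgn, hg⟩ := exists_L2_inverse_fourier (hline b hb)
    -- The inverse transforms on the various lines come from one function: contour shifting shows
    -- that line `b` yields `e^(bx) f`. Compactly supported test functions are used so that `e^(bx)
    -- φ` is still Schwartz.
    have hfg : g =ᵐ[volume] fun x => (Real.exp (b * x) : ℂ) * f x := by
      refine ae_eq_of_integral_mul_schwartz (hg2.locallyIntegrable one_le_two) ?_ fun φ hφ => ?_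
      · exact (hf2.locallyIntegrable one_le_two).continuous_mul (hexp b)
      · obtain ⟨ψ, hψ⟩ := HasCompactSupport.exists_schwartz_exp_mul hφ b
        have hψ' : (ψ : ℝ → ℂ) = fun x => (Real.exp (b * x) : ℂ) * φ x := funext hψ
        have hs := integral_line_mul_fourierT hb hF hFb φ.integrable (hψ' ▸ ψ.integrable)
          (integrable_fourierT_schwartz_neg φ) (hψ' ▸ integrable_fourierT_schwartz_neg ψ)
        rw [hg, hs, ← hψ']
        have := hf ψ
        simp only [ofReal_zero, zero_mul, add_zero] at this
        rw [← this]
        refine integral_congr_ae (.of_forall fun x => ?_)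
        simp only [hψ]; ring
    calc ∫⁻ x : ℝ, ENNReal.ofReal (Real.exp (2 * b * x)) * ‖f x‖ₑ ^ 2 = ∫⁻ x, ‖g x‖ₑ ^ 2 := by
          refine lintegral_congr_ae ?_
          filter_upwards [hfg] with x hx
          rw [hx, enorm_mul, mul_pow, ← ofReal_norm (Real.exp (b * x) : ℂ), norm_real,
            Real.norm_of_nonneg (by positivity), ← ENNReal.ofReal_pow (by positivity),
            ← Real.exp_nat_mul]
          congr 3
          push_cast; ring
      _ ≤ 1 * M := by
          rw [hgn]
          refine mul_le_mul' ?_ (h b hb)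
          rw [ENNReal.ofReal_le_one]
          exact inv_le_one_of_one_le₀ (by linarith [Real.two_le_pi])
      _ = M := one_mul M
  have hcosh : ∀ b : ℝ, |b| < β / 2 →
      ∫⁻ x : ℝ, ENNReal.ofReal (Real.cosh (2 * b * x)) * ‖f x‖ₑ ^ 2 ≤ M := by
    intro b hb'
    have e : ∀ x : ℝ, ENNReal.ofReal (Real.cosh (2 * b * x)) * ‖f x‖ₑ ^ 2 =
        ENNReal.ofReal (1 / 2) * (ENNReal.ofReal (Real.exp (2 * b * x)) * ‖f x‖ₑ ^ 2 +
          ENNReal.ofReal (Real.exp (2 * (-b) * x)) * ‖f x‖ₑ ^ 2) := fun x => by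
      rw [← add_mul, ← mul_assoc, ← ENNReal.ofReal_add (by positivity) (by positivity),
        ← ENNReal.ofReal_mul (by positivity), Real.cosh_eq]
      congr 2
      rw [show 2 * -b * x = -(2 * b * x) by ring]; ring
    simp only [e]
    rw [lintegral_const_mul' _ _ (by simp), lintegral_add_left']
    · calc _ ≤ ENNReal.ofReal (1 / 2) * (M + M) := by
            gcongr
            · exact hb b hb'
            · exact hb (-b) (by rwa [abs_neg])
        _ = M := by
            rw [← two_mul, ← mul_assoc, ← ENNReal.ofReal_ofNat, ← ENNReal.ofReal_mul (by positivity)]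
            norm_num
    · exact (by fun_prop : Measurable fun x : ℝ =>
        ENNReal.ofReal (Real.exp (2 * b * x))).aemeasurable.mul (hfm.enorm.pow_const 2)
  -- The weight `cosh(βx)` corresponds to `b = β/2`, outside the open strip; Fatou's lemma along `b
  -- n → β/2` reaches it with the same bound.
  have hw : ∫⁻ x : ℝ, ENNReal.ofReal (Real.cosh (β * x)) * ‖f x‖ₑ ^ 2 ≤ M := by
    set b : ℕ → ℝ := fun n => β / 2 * (1 - 1 / ((n : ℝ) + 1)) with hbdef
    have hbn : ∀ n, |b n| < β / 2 := fun n => by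
      have hn0 : 0 < 1 / ((n : ℝ) + 1) := by positivity
      have hn1 : 1 / ((n : ℝ) + 1) ≤ 1 := by
        rw [div_le_one (by positivity)]; linarith [(Nat.cast_nonneg n : (0 : ℝ) ≤ n)]
      rw [abs_of_nonneg (mul_nonneg (by positivity) (by linarith))]
      simp only [hbdef]
      nlinarith
    have hblim : Tendsto b atTop (𝓝 (β / 2)) := by
      simpa [hbdef] using (tendsto_one_div_add_atTop_nhds_zero_nat.const_sub (1 : ℝ)).const_mul (β / 2)
    have hlim : ∀ x : ℝ, Tendsto
        (fun n => ENNReal.ofReal (Real.cosh (2 * b n * x)) * ‖f x‖ₑ ^ 2) atTop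
        (𝓝 (ENNReal.ofReal (Real.cosh (β * x)) * ‖f x‖ₑ ^ 2)) := fun x => by
      refine ENNReal.Tendsto.mul_const ?_ (.inr (by simp))
      refine ENNReal.tendsto_ofReal ((Real.continuous_cosh.tendsto _).comp ?_)
      have := (hblim.const_mul 2).mul_const x
      rwa [mul_div_cancel₀ _ (two_ne_zero' ℝ)] at this
    calc _ = ∫⁻ x : ℝ, liminf
          (fun n => ENNReal.ofReal (Real.cosh (2 * b n * x)) * ‖f x‖ₑ ^ 2) atTop := by
          refine lintegral_congr fun x => ((hlim x).liminf_eq).symm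
      _ ≤ liminf (fun n => ∫⁻ x : ℝ,
          ENNReal.ofReal (Real.cosh (2 * b n * x)) * ‖f x‖ₑ ^ 2) atTop := by
          refine lintegral_liminf_le' fun n => ?_
          have : Continuous fun x : ℝ => Real.cosh (2 * b n * x) := by fun_prop
          exact this.measurable.ennreal_ofReal.aemeasurable.mul (hfm.enorm.pow_const 2)
      _ ≤ M := liminf_le_of_le (by isBoundedDefault) fun B hB => by
          obtain ⟨n, hn⟩ := hB.exists
          exact hn.trans (hcosh _ (hbn n))
  have hmem : MemLp f 2 (weightMeasure β) := memLp_weight_iff.2 ⟨hfm, hw.trans_lt hM.lt_top⟩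
  have hae := coeFn_toLp_weight hmem
  refine ⟨hmem.toLp f, eqOn_strip_of_eq_real hβ
    (WSpace.expDecay hβ (hmem.toLp f)).differentiableOn_fourierT hF ?_, ?_⟩
  · have hint : Integrable (hmem.toLp f : WSpace β) :=
      (WSpace.expDecay hβ (hmem.toLp f)).integrable (by positivity)
    have hcF : Continuous fun t : ℝ => F t :=
      hF.continuousOn.comp_continuous (by fun_prop) fun t => ofReal_mem_strip hβ t
    have key : (fun t : ℝ => fourierT (hmem.toLp f : WSpace β) t) =ᵐ[volume] fun t : ℝ => F t := by
      refine ae_eq_of_integral_mul_schwartz (continuous_fourierT_ofReal hint).locallyIntegrable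
        hcF.locallyIntegrable fun φ _ => ?_
      rw [← integral_mul_schwartzFourier hint]
      have h1 := hf (schwartzFourier φ)
      simp only [fourierT_schwartzFourier_neg, ofReal_zero, zero_mul, add_zero] at h1
      calc _ = ∫ x, f x * schwartzFourier φ x := by
            refine integral_congr_ae ?_
            filter_upwards [hae] with x hx
            rw [hx]
        _ = _ := by
            rw [h1, ← integral_const_mul]
            refine integral_congr_ae (.of_forall fun t => ?_)
            have hpi : (Real.pi : ℂ) ≠ 0 := by exact_mod_cast Real.pi_ne_zero
            simp only
            push_cast
            field_simp
    exact fun t => congr_fun ((continuous_fourierT_ofReal hint).ae_eq_iff_eq volume hcF |>.1 key) t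
  · rw [ofReal_norm_sq]
    refine le_trans (le_of_eq (lintegral_congr_ae ?_)) hw
    filter_upwards [hae] with x hx
    rw [hx]

end FokkerPlanck

namespace FokkerPlanck

open Filter Topology

variable {β : ℝ}

/-! ### Integration along rays -/

/-- The integral `∫₀¹ H(sz) s^{ζ-1} ds`. -/
noncomputable def rayIntegral (ζ : ℂ) (H : ℂ → ℂ) (z : ℂ) : ℂ :=
  ∫ s in (0 : ℝ)..1, H ((s : ℂ) * z) * (s : ℂ) ^ (ζ - 1)

theorem uIcc_zero_one {s : ℝ} (hs : s ∈ Set.uIcc (0 : ℝ) 1) : 0 ≤ s ∧ s ≤ 1 := by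
  rwa [Set.uIcc_of_le zero_le_one] at hs

theorem uIoc_zero_one {s : ℝ} (hs : s ∈ Set.uIoc (0 : ℝ) 1) : 0 < s ∧ s ≤ 1 := by
  rwa [Set.uIoc_of_le zero_le_one] at hs

theorem continuousOn_ray {H : ℂ → ℂ} (hH : ContinuousOn H (strip β)) {z : ℂ} (hz : z ∈ strip β) :
    ContinuousOn (fun s : ℝ => H ((s : ℂ) * z)) (Set.uIcc 0 1) :=
  hH.comp (by fun_prop) fun _ hs => mul_mem_strip hz (uIcc_zero_one hs).1 (uIcc_zero_one hs).2

theorem intervalIntegrable_ray {ζ : ℂ} (hζ : 0 < ζ.re) {H : ℂ → ℂ}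
    (hH : ContinuousOn H (strip β)) {z : ℂ} (hz : z ∈ strip β) :
    IntervalIntegrable (fun s : ℝ => H ((s : ℂ) * z) * (s : ℂ) ^ (ζ - 1)) volume 0 1 :=
  (intervalIntegral.intervalIntegrable_cpow' (by simpa using hζ)).continuousOn_mul
    (continuousOn_ray hH hz)

theorem intervalIntegrable_ray_deriv {ζ : ℂ} (hζ : 0 < ζ.re) {H : ℂ → ℂ}
    (hH : DifferentiableOn ℂ H (strip β)) {z : ℂ} (hz : z ∈ strip β) :
    IntervalIntegrable (fun s : ℝ => (s : ℂ) * deriv H ((s : ℂ) * z) * (s : ℂ) ^ (ζ - 1))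
      volume 0 1 :=
  (intervalIntegral.intervalIntegrable_cpow' (by simpa using hζ)).continuousOn_mul
    ((by fun_prop : ContinuousOn (fun s : ℝ => (s : ℂ)) _).mul
      (continuousOn_ray (hH.deriv (isOpen_strip β)).continuousOn hz))

theorem exists_ray_bound {H : ℂ → ℂ} (hH : ContinuousOn H (strip β)) {K : Set ℂ} (hK : IsCompact K)
    (hKs : K ⊆ strip β) :
    ∃ C : ℝ, ∀ s : ℝ, 0 ≤ s → s ≤ 1 → ∀ w ∈ K, ‖H ((s : ℂ) * w)‖ ≤ C := by
  have hcomp : IsCompact ((fun p : ℝ × ℂ => (p.1 : ℂ) * p.2) '' (Set.Icc (0 : ℝ) 1 ×ˢ K)) :=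
    (isCompact_Icc.prod hK).image (by fun_prop)
  obtain ⟨C, hC⟩ := hcomp.exists_bound_of_continuousOn (f := H) (hH.mono (by
    rintro _ ⟨p, ⟨hp1, hp2⟩, rfl⟩
    exact mul_mem_strip (hKs hp2) hp1.1 hp1.2))
  exact ⟨C, fun s h0 h1 w hw => hC _ ⟨(s, w), ⟨⟨h0, h1⟩, hw⟩, rfl⟩⟩

theorem hasDerivAt_rayIntegral {ζ : ℂ} (hζ : 0 < ζ.re) {H : ℂ → ℂ}
    (hH : DifferentiableOn ℂ H (strip β)) {z : ℂ} (hz : z ∈ strip β) :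
    HasDerivAt (rayIntegral ζ H)
      (∫ s in (0 : ℝ)..1, (s : ℂ) * deriv H ((s : ℂ) * z) * (s : ℂ) ^ (ζ - 1)) z := by
  obtain ⟨r, hr, hrs⟩ := Metric.nhds_basis_closedBall.mem_iff.1 ((isOpen_strip β).mem_nhds hz)
  have hH' : ContinuousOn (deriv H) (strip β) := (hH.deriv (isOpen_strip β)).continuousOn
  obtain ⟨C, hC⟩ := exists_ray_bound hH' (isCompact_closedBall z r) hrs
  have hcp : IntervalIntegrable (fun s : ℝ => (s : ℂ) ^ (ζ - 1)) volume 0 1 :=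
    intervalIntegral.intervalIntegrable_cpow' (by simpa using hζ)
  refine (intervalIntegral.hasDerivAt_integral_of_dominated_loc_of_deriv_le
    (F := fun w (s : ℝ) => H ((s : ℂ) * w) * (s : ℂ) ^ (ζ - 1))
    (F' := fun w (s : ℝ) => (s : ℂ) * deriv H ((s : ℂ) * w) * (s : ℂ) ^ (ζ - 1))
    (bound := fun s : ℝ => C * ‖(s : ℂ) ^ (ζ - 1)‖)
    (Metric.closedBall_mem_nhds z hr) ?_ (intervalIntegrable_ray hζ hH.continuousOn hz)
    ?_ (.of_forall fun s hs w hw => ?_) (hcp.norm.const_mul C)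
    (.of_forall fun s hs w hw => ?_)).2
  · filter_upwards [(isOpen_strip β).mem_nhds hz] with w hw
    exact (intervalIntegrable_ray hζ hH.continuousOn hw).aestronglyMeasurable_restrict_uIoc
  · exact (intervalIntegrable_ray_deriv hζ hH hz).aestronglyMeasurable_restrict_uIoc
  · obtain ⟨h0, h1⟩ := uIoc_zero_one hs
    rw [norm_mul, norm_mul, norm_real, Real.norm_of_nonneg h0.le]
    gcongr
    calc s * ‖deriv H (s * w)‖ ≤ 1 * ‖deriv H (s * w)‖ := by gcongr
      _ ≤ C := by rw [one_mul]; exact hC s h0.le h1 w hw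
  · obtain ⟨h0, h1⟩ := uIoc_zero_one hs
    have hd := (hH.differentiableAt ((isOpen_strip β).mem_nhds
      (mul_mem_strip (hrs hw) h0.le h1))).hasDerivAt
    have h2 : HasDerivAt (fun w : ℂ => (s : ℂ) * w) (s : ℂ) w := by
      simpa using (hasDerivAt_id' w).const_mul (s : ℂ)
    refine ((hd.comp w h2).mul_const _).congr_deriv ?_
    ring

/-- The fundamental theorem of calculus for `s ↦ s^ζ P(sz)` on `[0,1]`. The boundary term at `0`
vanishes because `Re ζ > 0`. -/
theorem ray_ftc {ζ : ℂ} (hζ : 0 < ζ.re) {P : ℂ → ℂ}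
    (hP : DifferentiableOn ℂ P (strip β)) {z : ℂ} (hz : z ∈ strip β) :
    ζ * rayIntegral ζ P z +
      z * (∫ s in (0 : ℝ)..1, (s : ℂ) * deriv P ((s : ℂ) * z) * (s : ℂ) ^ (ζ - 1)) = P z := by
  have i1 := intervalIntegrable_ray hζ hP.continuousOn hz
  have i2 := intervalIntegrable_ray_deriv hζ hP hz
  have hζ0 : ζ ≠ 0 := fun h => by simp [h] at hζ
  rw [rayIntegral, ← intervalIntegral.integral_const_mul, ← intervalIntegral.integral_const_mul,
    ← intervalIntegral.integral_add (i1.const_mul ζ) (i2.const_mul z)]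
  rw [intervalIntegral.integral_eq_sub_of_hasDerivAt_of_le zero_le_one
    (f := fun s : ℝ => (s : ℂ) ^ ζ * P ((s : ℂ) * z)) ?_ (fun s hs => ?_)
    ((i1.const_mul ζ).add (i2.const_mul z))]
  · simp [hζ0]
  · refine (continuous_ofReal_cpow_const hζ).continuousOn.mul ?_
    have := continuousOn_ray hP.continuousOn hz
    rwa [Set.uIcc_of_le zero_le_one] at this
  · have hs0 : (s : ℂ) ≠ 0 := by exact_mod_cast hs.1.ne'
    have h1 : HasDerivAt (fun w : ℂ => w ^ ζ) (ζ * (s : ℂ) ^ (ζ - 1)) (s : ℂ) := by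
      simpa using (hasDerivAt_id' (s : ℂ)).cpow_const (c := ζ) (.inl (by simpa using hs.1))
    have h2 : HasDerivAt (fun w : ℂ => w * z) z (s : ℂ) := by
      simpa using (hasDerivAt_id' (s : ℂ)).mul_const z
    have h3 := (hP.differentiableAt ((isOpen_strip β).mem_nhds
      (mul_mem_strip hz hs.1.le hs.2.le))).hasDerivAt.comp (s : ℂ) h2
    refine ((h1.mul h3).comp_ofReal).congr_deriv ?_
    have h4 : (s : ℂ) ^ ζ = s * (s : ℂ) ^ (ζ - 1) := by
      rw [cpow_sub _ _ hs0, cpow_one, mul_div_cancel₀ _ hs0]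
    simp only [Function.comp_apply, h4]
    ring

theorem differentiableOn_rayIntegral {ζ : ℂ} (hζ : 0 < ζ.re) {H : ℂ → ℂ}
    (hH : DifferentiableOn ℂ H (strip β)) : DifferentiableOn ℂ (rayIntegral ζ H) (strip β) :=
  fun _ hz => (hasDerivAt_rayIntegral hζ hH hz).differentiableAt.differentiableWithinAt

section vanishing

variable {ζ : ℂ} {k : ℕ} {G H : ℂ → ℂ}

/-- A zero of order `k` pays for the singularity at `s = 0`: the factor `(sz)^k` contributes `s^k`,
raising the exponent `ζ - 1` to `ζ + k - 1`. -/
theorem ray_integrand_eq (hG : ∀ z ∈ strip β, G z = z ^ k * H z) {z : ℂ} (hz : z ∈ strip β) :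
    Set.EqOn (fun s : ℝ => z ^ k * (H ((s : ℂ) * z) * (s : ℂ) ^ (ζ + k - 1)))
      (fun s : ℝ => G ((s : ℂ) * z) * (s : ℂ) ^ (ζ - 1)) (Set.uIoc 0 1) := fun s hs => by
  obtain ⟨h0, h1⟩ := uIoc_zero_one hs
  have hs0 : (s : ℂ) ≠ 0 := by exact_mod_cast h0.ne'
  simp only
  rw [hG _ (mul_mem_strip hz h0.le h1), show ζ + k - 1 = (ζ - 1) + k by ring, cpow_add _ _ hs0,
    cpow_natCast]
  ring

theorem intervalIntegrable_ray_of_vanishing (hζ : -(k : ℝ) < ζ.re)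
    (hH : DifferentiableOn ℂ H (strip β)) (hG : ∀ z ∈ strip β, G z = z ^ k * H z)
    {z : ℂ} (hz : z ∈ strip β) :
    IntervalIntegrable (fun s : ℝ => G ((s : ℂ) * z) * (s : ℂ) ^ (ζ - 1)) volume 0 1 :=
  ((intervalIntegrable_ray (ζ := ζ + k) (by simp; linarith) hH.continuousOn hz).const_mul
    (z ^ k)).congr (ray_integrand_eq hG hz)

theorem rayIntegral_of_vanishing (hG : ∀ z ∈ strip β, G z = z ^ k * H z)
    {z : ℂ} (hz : z ∈ strip β) :
    rayIntegral ζ G z = z ^ k * rayIntegral (ζ + k) H z := by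
  rw [rayIntegral, rayIntegral, ← intervalIntegral.integral_const_mul]
  exact intervalIntegral.integral_congr_ae
    (.of_forall fun s hs => (ray_integrand_eq hG hz hs).symm)

/-- The Euler equation for the ray integral, beyond `Re ζ > 0`. Stating it for `z * q'` avoids
dividing by `z` at the origin. -/
theorem hasDerivAt_rayIntegral_of_vanishing (hζ : -(k : ℝ) < ζ.re)
    (hH : DifferentiableOn ℂ H (strip β)) (hG : ∀ z ∈ strip β, G z = z ^ k * H z)
    {z : ℂ} (hz : z ∈ strip β) :
    ∃ q' : ℂ, HasDerivAt (rayIntegral ζ G) q' z ∧ z * q' = G z - ζ * rayIntegral ζ G z := by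
  have hζk : 0 < (ζ + k).re := by simp; linarith
  have h1 := hasDerivAt_rayIntegral hζk hH hz
  have h2 := (hasDerivAt_pow k z).mul h1
  have h3 : rayIntegral ζ G =ᶠ[𝓝 z] fun w => w ^ k * rayIntegral (ζ + k) H w := by
    filter_upwards [(isOpen_strip β).mem_nhds hz] with w hw
    exact rayIntegral_of_vanishing hG hw
  refine ⟨_, h2.congr_of_eventuallyEq h3, ?_⟩
  have h4 := ray_ftc hζk hH hz
  rw [rayIntegral_of_vanishing hG hz, hG z hz, ← h4]
  -- The derivative of `z^k` carries the truncated exponent `k - 1`, so `k = 0` is separate.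
  rcases k with _ | k
  · simp
  · simp only [Nat.add_sub_cancel, pow_succ]
    push_cast
    ring

/-- An analytic solution of `z P' + ζ P = H` is given by integration along rays. -/
theorem eq_rayIntegral {P : ℂ → ℂ} (hζ : 0 < ζ.re) (hP : DifferentiableOn ℂ P (strip β))
    (hPH : ∀ z ∈ strip β, z * deriv P z + ζ * P z = H z) {z : ℂ} (hz : z ∈ strip β) :
    P z = rayIntegral ζ H z := by
  have i1 := intervalIntegrable_ray hζ hP.continuousOn hz
  have i2 := intervalIntegrable_ray_deriv hζ hP hz
  rw [← ray_ftc hζ hP hz, rayIntegral, rayIntegral, ← intervalIntegral.integral_const_mul,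
    ← intervalIntegral.integral_const_mul,
    ← intervalIntegral.integral_add (i1.const_mul ζ) (i2.const_mul z)]
  refine intervalIntegral.integral_congr fun s hs => ?_
  obtain ⟨h0, h1⟩ := uIcc_zero_one hs
  rw [← hPH _ (mul_mem_strip hz h0 h1)]
  ring

end vanishing

/-- A function analytic on the strip whose first `k` derivatives vanish at `0` is divisible by
`z ^ k`. -/
theorem exists_eq_pow_mul {F : ℂ → ℂ} (hβ : 0 < β) (hF : DifferentiableOn ℂ F (strip β)) {k : ℕ}
    (h : ∀ j < k, iteratedDeriv j F 0 = 0) :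
    ∃ H : ℂ → ℂ, DifferentiableOn ℂ H (strip β) ∧ ∀ z, F z = z ^ k * H z := by
  have h0 : (0 : ℂ) ∈ strip β := by simpa using ofReal_mem_strip hβ 0
  obtain ⟨H, hH, hFH⟩ :=
    (hF.analyticAt ((isOpen_strip β).mem_nhds h0)).exists_eq_sum_add_pow_mul k
  have hFH' : ∀ z, F z = z ^ k * H z := fun z => by
    rw [hFH z, Finset.sum_eq_zero, zero_add, smul_eq_mul]
    intro i hi
    rw [h i (Finset.mem_range.1 hi), smul_zero]
  refine ⟨H, fun z hz => ?_, hFH'⟩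
  by_cases hz0 : z = 0
  · exact hz0 ▸ hH.differentiableAt.differentiableWithinAt
  · have : H =ᶠ[𝓝 z] fun w => F w / w ^ k := by
      filter_upwards [isOpen_ne.mem_nhds hz0] with w hw
      rw [hFH' w, mul_div_cancel_left₀ _ (pow_ne_zero _ hw)]
    exact (((hF.differentiableAt ((isOpen_strip β).mem_nhds hz)).fun_div
      (differentiableAt_pow k) (pow_ne_zero _ hz0)).congr_of_eventuallyEq this).differentiableWithinAt

theorem iteratedDeriv_pow_mul_eq_zero {H : ℂ → ℂ} (hβ : 0 < β)
    (hH : DifferentiableOn ℂ H (strip β)) {k j : ℕ} (hj : j < k) {F : ℂ → ℂ}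
    (hF : ∀ z ∈ strip β, F z = z ^ k * H z) : iteratedDeriv j F 0 = 0 := by
  have h0 : strip β ∈ 𝓝 (0 : ℂ) :=
    (isOpen_strip β).mem_nhds (by simpa using ofReal_mem_strip hβ 0)
  have hHa := hH.analyticAt h0
  have hev : F =ᶠ[𝓝 0] fun z => z ^ k * H z := by
    filter_upwards [h0] with z hz using hF z hz
  have hFa : AnalyticAt ℂ F 0 := (by fun_prop : AnalyticAt ℂ (fun z => z ^ k * H z) 0).congr hev.symm
  refine (natCast_le_analyticOrderAt_iff_iteratedDeriv_eq_zero hFa).1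
    ((natCast_le_analyticOrderAt hFa).2 ⟨H, hHa, ?_⟩) j hj
  filter_upwards [hev] with z hz
  simpa using hz

end FokkerPlanck

namespace FokkerPlanck

open Filter Topology

variable {β : ℝ} {θ : 𝓢'(ℝ, ℂ)} {θhat : ℂ → ℂ}

/-! ### The multiplier `θ̂` and the function `f̂₀` -/

/-- For a continuous function the set where the bound fails is open, and a null open set is empty.
Essential bounds thus become pointwise ones. -/
theorem le_of_ae_le_strip {f : ℂ → ℝ} (hf : ContinuousOn f (strip β)) {M : ℝ}
    (h : ∀ᵐ z ∂(volume.restrict (strip β)), f z ≤ M) {z : ℂ} (hz : z ∈ strip β) : f z ≤ M := by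
  have hopen : IsOpen (strip β ∩ f ⁻¹' Set.Ioi M) :=
    hf.isOpen_inter_preimage (isOpen_strip β) isOpen_Ioi
  rw [ae_restrict_iff' (isOpen_strip β).measurableSet] at h
  have h0 : volume (strip β ∩ f ⁻¹' Set.Ioi M) = 0 := by
    refine measure_mono_null (fun w hw => ?_) h
    simpa using hw
  have := (hopen.measure_eq_zero_iff volume).1 h0
  by_contra hlt
  exact (Set.ext_iff.1 this z).1 ⟨hz, not_le.1 hlt⟩

/-- The exponent `∫₀¹ θ̂(zs)/s ds`. -/
noncomputable def logMultiplier (θhat : ℂ → ℂ) (z : ℂ) : ℂ :=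
  ∫ s in (0 : ℝ)..1, θhat (z * (s : ℂ)) / (s : ℂ)

theorem logMultiplier_eq (θhat : ℂ → ℂ) : logMultiplier θhat = rayIntegral 0 θhat := by
  ext z
  refine intervalIntegral.integral_congr fun s _ => ?_
  rw [zero_sub, cpow_neg_one, mul_comm z, div_eq_mul_inv]

/-- The Fourier transform of the stationary state. -/
noncomputable def groundFT (θhat : ℂ → ℂ) (z : ℂ) : ℂ := cexp (-z ^ 2 / 2 + logMultiplier θhat z)

theorem groundFT_ne_zero (z : ℂ) : groundFT θhat z ≠ 0 := exp_ne_zero _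

namespace ConditionC

theorem differentiableOn (hθ : ConditionC β θ θhat) : DifferentiableOn ℂ θhat (strip β) :=
  hθ.analytic.differentiableOn

theorem exists_norm_le (hθ : ConditionC β θ θhat) : ∃ M, ∀ z ∈ strip β, ‖θhat z‖ ≤ M := by
  obtain ⟨M, hM⟩ := hθ.bounded
  exact ⟨M, fun z hz => le_of_ae_le_strip hθ.differentiableOn.continuousOn.norm hM hz⟩

/-- The exponent is a ray integral with `ζ = 0`, the borderline case. The condition `θ̂(0) = 0`
provides a zero of order `k = 1`, which restores convergence. -/
theorem hasDerivAt_logMultiplier (hβ : 0 < β) (hθ : ConditionC β θ θhat) {z : ℂ}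
    (hz : z ∈ strip β) : ∃ q', HasDerivAt (logMultiplier θhat) q' z ∧ z * q' = θhat z := by
  obtain ⟨H, hH, hθH⟩ := exists_eq_pow_mul (k := 1) hβ hθ.differentiableOn (by
    simpa using hθ.zero_mean)
  obtain ⟨q', h1, h2⟩ := hasDerivAt_rayIntegral_of_vanishing (ζ := 0) (k := 1) (by simp) hH
    (fun w _ => hθH w) hz
  exact ⟨q', logMultiplier_eq θhat ▸ h1, by simpa using h2⟩

theorem exists_abs_re_le (hβ : 0 < β) (hθ : ConditionC β θ θhat) :
    ∃ M, 0 ≤ M ∧ ∀ z ∈ strip β, |(logMultiplier θhat z).re| ≤ M := by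
  obtain ⟨M, hM⟩ := hθ.re_bounded
  have hc : ContinuousOn (logMultiplier θhat) (strip β) := fun z hz =>
    (hθ.hasDerivAt_logMultiplier hβ hz).choose_spec.1.continuousAt.continuousWithinAt
  have h : ∀ z ∈ strip β, |(logMultiplier θhat z).re| ≤ M := fun z hz =>
    le_of_ae_le_strip (continuous_re.comp_continuousOn hc).abs hM hz
  exact ⟨M, (abs_nonneg _).trans (h _ (ofReal_mem_strip hβ 0)), h⟩

theorem hasDerivAt_groundFT (hβ : 0 < β) (hθ : ConditionC β θ θhat) {z : ℂ}
    (hz : z ∈ strip β) : ∃ q', HasDerivAt (groundFT θhat) q' z ∧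
      z * q' = (θhat z - z ^ 2) * groundFT θhat z := by
  obtain ⟨q', h1, h2⟩ := hθ.hasDerivAt_logMultiplier hβ hz
  have h3 : HasDerivAt (fun w : ℂ => -w ^ 2 / 2) (-z) z := by
    refine ((((hasDerivAt_id' z).pow 2).neg).div_const 2).congr_deriv ?_
    simp only [Nat.cast_ofNat, Nat.add_one_sub_one, pow_one, mul_one]
    ring
  refine ⟨_, (h3.add h1).cexp, ?_⟩
  rw [← h2]
  simp only [groundFT, Pi.add_apply]
  ring

theorem differentiableOn_groundFT (hβ : 0 < β) (hθ : ConditionC β θ θhat) :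
    DifferentiableOn ℂ (groundFT θhat) (strip β) := fun _ hz =>
  (hθ.hasDerivAt_groundFT hβ hz).choose_spec.1.differentiableAt.differentiableWithinAt

/-- The Gaussian bound for quotients of `f̂₀` along rays. -/
theorem exists_groundFT_div_le (hβ : 0 < β) (hθ : ConditionC β θ θhat) :
    ∃ C, 0 ≤ C ∧ ∀ z ∈ strip β, ∀ s : ℝ, 0 ≤ s → s ≤ 1 →
      ‖groundFT θhat z / groundFT θhat (s * z)‖ ≤ C * Real.exp (-(1 - s ^ 2) / 2 * z.re ^ 2) := by
  obtain ⟨M, hM0, hM⟩ := hθ.exists_abs_re_le hβ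
  -- `2M` bounds the real parts of the two exponents, and `β²/8` bounds `(1 - s²)(Im z)²/2` on the
  -- strip.
  refine ⟨Real.exp (2 * M + β ^ 2 / 8), by positivity, fun z hz s h0 h1 => ?_⟩
  have hz' : |z.im| < β / 2 := hz
  rw [groundFT, groundFT, ← Complex.exp_sub, norm_exp, ← Real.exp_add, Real.exp_le_exp]
  have e1 := abs_le.1 (hM z hz)
  have e2 := abs_le.1 (hM _ (mul_mem_strip hz h0 h1))
  have e3 : (-z ^ 2 / 2 + logMultiplier θhat z -
      (-((s : ℂ) * z) ^ 2 / 2 + logMultiplier θhat ((s : ℂ) * z))).re =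
      -(1 - s ^ 2) / 2 * z.re ^ 2 + (1 - s ^ 2) / 2 * z.im ^ 2 + (logMultiplier θhat z).re -
        (logMultiplier θhat ((s : ℂ) * z)).re := by
    have : (-z ^ 2 / 2 + logMultiplier θhat z -
      (-((s : ℂ) * z) ^ 2 / 2 + logMultiplier θhat ((s : ℂ) * z))) =
      ((-(1 - s ^ 2) / 2 : ℝ) : ℂ) * z ^ 2 + logMultiplier θhat z -
        logMultiplier θhat ((s : ℂ) * z) := by push_cast; ring
    rw [this, sub_re, add_re, re_ofReal_mul, sq z, mul_re]
    ring
  rw [e3]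
  have e4 : z.im ^ 2 ≤ (β / 2) ^ 2 := by
    rw [← sq_abs z.im]
    gcongr
  have e5 : 0 ≤ 1 - s ^ 2 := by nlinarith
  nlinarith [mul_le_mul_of_nonneg_left e4 e5, sq_nonneg s, sq_nonneg (β / 2),
    mul_nonneg (sq_nonneg s) (sq_nonneg (β / 2))]

end ConditionC

/-! ### The convolution operator in Fourier variables -/

/-- By Fubini, correlating `f` with the transform of `φ` gives the transform of `f̂ φ`. This
identifies the function `ψ` of `IsConvolution` and shows that it is Schwartz. -/
theorem exists_schwartz_mul_fourierT (hβ : 0 < β) (f : WSpace β) (φ : 𝓢(ℝ, ℂ)) :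
    ∃ χ : 𝓢(ℝ, ℂ), (∀ t : ℝ, χ t = fourierT f t * φ t) ∧
      ∀ y : ℝ, schwartzFourier χ y = ∫ x : ℝ, f x * schwartzFourier φ (x + y) := by
  have hg := (f.expDecay hβ).hasTemperateGrowth hβ
  have hχ : ∀ t : ℝ, SchwartzMap.smulLeftCLM ℂ (fun t : ℝ => fourierT f t) φ t =
      fourierT f t * φ t := fun t => by
    rw [SchwartzMap.smulLeftCLM_apply_apply hg, smul_eq_mul]
  refine ⟨_, hχ, fun y => ?_⟩
  have hf := (f.expDecay hβ).integrable (by positivity)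
  have hφy : Integrable fun t : ℝ => cexp (-(I * t * y)) * φ t := by
    refine φ.integrable.bdd_mul (c := 1) (aestronglyMeasurable_kernel y) (.of_forall fun t => ?_)
    rw [norm_kernel]; simp
  have h := integral_fourierT_mul hf hφy
  rw [schwartzFourier_apply, fourierT]
  refine Eq.trans ?_ (h.trans ?_)
  · refine integral_congr_ae (.of_forall fun t => ?_)
    simp only [hχ]; ring
  · refine integral_congr_ae (.of_forall fun x => ?_)
    simp only
    rw [schwartzFourier_apply]
    congr 1
    refine integral_congr_ae (.of_forall fun t => ?_)
    simp only
    rw [mul_comm (cexp _), mul_assoc, ← Complex.exp_add]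
    congr 2
    push_cast
    ring

/-- Every Schwartz function is itself a transform, so the defining pairings can be moved to the
Fourier side, where `θ` acts through `θ̂`. Equality on the real line spreads to the strip by
analyticity. -/
theorem isConvolution_iff (hβ : 0 < β) (hθ : ConditionC β θ θhat) (f h : WSpace β) :
    IsConvolution θ f h ↔ ∀ z ∈ strip β, fourierT h z = θhat z * fourierT f z := by
  have hf := f.expDecay hβ
  have hh := h.expDecay hβ
  have hhi := hh.integrable (by positivity)
  have pair : ∀ φ χ : 𝓢(ℝ, ℂ), (∀ t : ℝ, χ t = fourierT f t * φ t) →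
      θ (schwartzFourier χ) = ∫ t : ℝ, θhat t * fourierT f t * φ t := fun φ χ hχ => by
    rw [hθ.fourier_eq]
    simp only [hχ, mul_assoc]
  constructor
  · intro hc
    have hcθ : Continuous fun t : ℝ => θhat t * fourierT f t :=
      (hθ.differentiableOn.mul hf.differentiableOn_fourierT).continuousOn.comp_continuous
        (by fun_prop) fun t => ofReal_mem_strip hβ t
    refine eqOn_strip_of_eq_real hβ hh.differentiableOn_fourierT
      (hθ.differentiableOn.mul hf.differentiableOn_fourierT) ?_
    have key : (fun t : ℝ => fourierT h t) =ᵐ[volume] fun t : ℝ => θhat t * fourierT f t := by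
      refine ae_eq_of_integral_mul_schwartz (continuous_fourierT_ofReal hhi).locallyIntegrable
        hcθ.locallyIntegrable fun φ _ => ?_
      obtain ⟨χ, hχ, hχ'⟩ := exists_schwartz_mul_fourierT hβ f φ
      obtain ⟨ψ, hψ, hψ'⟩ := hc (schwartzFourier φ)
      have : ψ = schwartzFourier χ := by ext y; rw [hψ, hχ']
      rw [← integral_mul_schwartzFourier hhi, hψ', this, pair φ χ hχ]
    exact fun t => congr_fun ((continuous_fourierT_ofReal hhi).ae_eq_iff_eq volume hcθ |>.1 key) t
  · intro hc φ
    obtain ⟨φ₁, rfl⟩ := schwartzFourier_surjective φ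
    obtain ⟨χ, hχ, hχ'⟩ := exists_schwartz_mul_fourierT hβ f φ₁
    refine ⟨schwartzFourier χ, hχ', ?_⟩
    rw [integral_mul_schwartzFourier hhi, pair φ₁ χ hχ]
    refine integral_congr_ae (.of_forall fun t => ?_)
    simp only
    rw [hc _ (ofReal_mem_strip hβ t)]

/-- Multiplication by the bounded function `θ̂` preserves the line-wise `L²` bounds, so Paley-Wiener
applies to `θ̂ f̂`. -/
theorem exists_isConvolution (hβ : 0 < β) (hθ : ConditionC β θ θhat) (f : WSpace β) :
    ∃ h : WSpace β, IsConvolution θ f h := by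
  obtain ⟨M, hM⟩ := hθ.exists_norm_le
  have hf := f.expDecay hβ
  have hM0 : 0 ≤ M := (norm_nonneg _).trans (hM _ (ofReal_mem_strip hβ 0))
  have hb : BoundedOnSubstrips β fun z => θhat z * fourierT f z := fun c hc => by
    obtain ⟨K, hK⟩ := hf.boundedOnSubstrips c hc
    refine ⟨M * K, fun z hz => ?_⟩
    rw [norm_mul]
    exact mul_le_mul (hM z (hz.trans_lt hc)) (hK z hz) (norm_nonneg _) hM0
  obtain ⟨h, hh, -⟩ := exists_fourierT_eq hβ
    (hθ.differentiableOn.mul hf.differentiableOn_fourierT) hb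
    (M := ENNReal.ofReal (M ^ 2) * (ENNReal.ofReal (4 * Real.pi) * ENNReal.ofReal (‖f‖ ^ 2)))
    (by finiteness) (fun b hb => by
      refine le_trans ?_ (mul_le_mul_right (lintegral_norm_fourierT_line_le hβ f hb) _)
      rw [← lintegral_const_mul' _ _ (by simp)]
      refine lintegral_mono fun t => ?_
      rw [Pi.mul_apply, enorm_mul, mul_pow, ENNReal.ofReal_pow hM0, ← ofReal_norm (θhat _)]
      gcongr
      exact hM _ (add_mul_I_mem_strip hb t))
  exact ⟨h, (isConvolution_iff hβ hθ f h).2 hh⟩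

end FokkerPlanck

namespace FokkerPlanck

open Filter Topology

variable {β : ℝ} {θ : 𝓢'(ℝ, ℂ)} {θhat : ℂ → ℂ}

/-! ### The resolvent in Fourier variables -/

/-- The Fourier transform of the solution of the resolvent equation with right-hand side `G`. -/
noncomputable def resolventFT (θhat : ℂ → ℂ) (ζ : ℂ) (G : ℂ → ℂ) (z : ℂ) : ℂ :=
  groundFT θhat z * rayIntegral ζ (fun w => G w / groundFT θhat w) z

section

variable {ζ : ℂ} {k : ℕ} {G H : ℂ → ℂ}

theorem ConditionC.differentiableOn_div (hβ : 0 < β) (hθ : ConditionC β θ θhat)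
    (hH : DifferentiableOn ℂ H (strip β)) :
    DifferentiableOn ℂ (fun w => H w / groundFT θhat w) (strip β) :=
  hH.div (hθ.differentiableOn_groundFT hβ) fun _ _ => groundFT_ne_zero _

theorem div_groundFT_eq (hG : ∀ z ∈ strip β, G z = z ^ k * H z) :
    ∀ z ∈ strip β, G z / groundFT θhat z = z ^ k * (H z / groundFT θhat z) := fun z hz => by
  rw [hG z hz, mul_div_assoc]

theorem resolventFT_eq (hG : ∀ z ∈ strip β, G z = z ^ k * H z) {z : ℂ} (hz : z ∈ strip β) :
    resolventFT θhat ζ G z = z ^ k *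
      (groundFT θhat z * rayIntegral (ζ + k) (fun w => H w / groundFT θhat w) z) := by
  rw [resolventFT, rayIntegral_of_vanishing (div_groundFT_eq hG) hz]
  ring

theorem differentiableOn_resolventFT (hβ : 0 < β) (hθ : ConditionC β θ θhat)
    (hζ : -(k : ℝ) < ζ.re) (hH : DifferentiableOn ℂ H (strip β))
    (hG : ∀ z ∈ strip β, G z = z ^ k * H z) :
    DifferentiableOn ℂ (resolventFT θhat ζ G) (strip β) := fun _ hz =>
  ((hθ.hasDerivAt_groundFT hβ hz).choose_spec.1.differentiableAt.mul
    (hasDerivAt_rayIntegral_of_vanishing hζ (hθ.differentiableOn_div hβ hH)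
      (div_groundFT_eq hG) hz).choose_spec.1.differentiableAt).differentiableWithinAt

theorem resolventFT_ode (hβ : 0 < β) (hθ : ConditionC β θ θhat)
    (hζ : -(k : ℝ) < ζ.re) (hH : DifferentiableOn ℂ H (strip β))
    (hG : ∀ z ∈ strip β, G z = z ^ k * H z) {z : ℂ} (hz : z ∈ strip β) :
    z * deriv (resolventFT θhat ζ G) z =
      (θhat z - z ^ 2 - ζ) * resolventFT θhat ζ G z + G z := by
  obtain ⟨p, hp, hp'⟩ := hθ.hasDerivAt_groundFT hβ hz
  obtain ⟨q, hq, hq'⟩ := hasDerivAt_rayIntegral_of_vanishing hζ (hθ.differentiableOn_div hβ hH)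
      (div_groundFT_eq hG) hz
  have h : deriv (resolventFT θhat ζ G) z = _ := (hp.mul hq).deriv
  rw [h, resolventFT, mul_add, ← mul_assoc, hp', mul_left_comm, hq']
  have := groundFT_ne_zero (θhat := θhat) z
  field_simp
  ring

theorem eqOn_strip_of_eq_punctured {F G : ℂ → ℂ} (hβ : 0 < β)
    (hF : DifferentiableOn ℂ F (strip β)) (hG : DifferentiableOn ℂ G (strip β))
    (h : ∀ z ∈ strip β, z ≠ 0 → F z = G z) : Set.EqOn F G (strip β) := by
  have h0 : (0 : ℂ) ∈ strip β := by simpa using ofReal_mem_strip hβ 0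
  refine (hF.analyticOnNhd (isOpen_strip β)).eqOn_of_preconnected_of_frequently_eq
    (hG.analyticOnNhd (isOpen_strip β)) (convex_strip β).isPreconnected h0
    (Eventually.frequently ?_)
  filter_upwards [self_mem_nhdsWithin, mem_nhdsWithin_of_mem_nhds ((isOpen_strip β).mem_nhds h0)]
    with z hz0 hz using h z hz hz0

/-- Uniqueness for the resolvent equation in Fourier variables, in the class of analytic functions
vanishing to order `k` at the origin. -/
theorem eq_resolventFT {F P : ℂ → ℂ} (hβ : 0 < β) (hθ : ConditionC β θ θhat)
    (hζ : -(k : ℝ) < ζ.re) (hH : DifferentiableOn ℂ H (strip β))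
    (hG : ∀ z ∈ strip β, G z = z ^ k * H z)
    (hP : DifferentiableOn ℂ P (strip β)) (hFP : ∀ z ∈ strip β, F z = z ^ k * P z)
    (hode : ∀ z ∈ strip β, z * deriv F z = (θhat z - z ^ 2 - ζ) * F z + G z) :
    Set.EqOn F (resolventFT θhat ζ G) (strip β) := by
  have hζk : 0 < (ζ + k).re := by simp; linarith
  -- the quotient `P / groundFT` solves a first-order equation away from the origin
  set R : ℂ → ℂ := fun w => P w / groundFT θhat w
  have hR : DifferentiableOn ℂ R (strip β) := hθ.differentiableOn_div hβ hP
  have hRode0 : ∀ z ∈ strip β, z ≠ 0 →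
      z * deriv R z + (ζ + k) * R z = H z / groundFT θhat z := by
    intro z hz hz0
    have hnhds := (isOpen_strip β).mem_nhds hz
    obtain ⟨p, hp, hp'⟩ := hθ.hasDerivAt_groundFT hβ hz
    have hPd := (hP.differentiableAt hnhds).hasDerivAt
    have hFd : deriv F z = k * z ^ (k - 1) * P z + z ^ k * deriv P z := by
      have h1 : F =ᶠ[𝓝 z] fun w => w ^ k * P w := by
        filter_upwards [hnhds] with w hw using hFP w hw
      exact h1.deriv_eq.trans ((hasDerivAt_pow k z).mul hPd).deriv
    have hRd : deriv R z = (deriv P z * groundFT θhat z - P z * p) / groundFT θhat z ^ 2 :=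
      (hPd.div hp (groundFT_ne_zero z)).deriv
    have hk : z * (k * z ^ (k - 1)) = k * z ^ k := by
      rcases k with _ | k
      · simp
      · simp only [Nat.add_sub_cancel, pow_succ]; ring
    have h2 := hode z hz
    rw [hFd, hFP z hz, hG z hz, mul_add, ← mul_assoc, hk] at h2
    have h3 : z * deriv P z = (θhat z - z ^ 2 - ζ - k) * P z + H z := by
      -- Cancelling `z^k` requires `z ≠ 0`; the origin is recovered afterwards because both sides of
      -- the reduced equation are analytic.
      refine mul_left_cancel₀ (pow_ne_zero k hz0) ?_
      linear_combination h2
    have h4 : z * deriv R z =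
        (z * deriv P z * groundFT θhat z - P z * (z * p)) / groundFT θhat z ^ 2 := by
      rw [hRd]; ring
    rw [h4, h3, hp']
    have := groundFT_ne_zero (θhat := θhat) z
    simp only [R]
    field_simp
    ring
  have hRode : ∀ z ∈ strip β, z * deriv R z + (ζ + k) * R z = H z / groundFT θhat z := by
    refine eqOn_strip_of_eq_punctured hβ ?_ (hθ.differentiableOn_div hβ hH) hRode0
    exact (differentiableOn_id.mul (hR.deriv (isOpen_strip β))).add (hR.const_mul _)
  intro z hz
  rw [resolventFT_eq hG hz, ← eq_rayIntegral hζk hR hRode hz, hFP z hz]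
  simp only [R]
  rw [mul_div_cancel₀ _ (groundFT_ne_zero z)]

end

end FokkerPlanck

/-! ### Norm estimates for the resolvent. -/

namespace FokkerPlanck

open Filter Topology

variable {β : ℝ} {θ : 𝓢'(ℝ, ℂ)} {θhat : ℂ → ℂ}

section

variable {ζ : ℂ} {k : ℕ} {G H : ℂ → ℂ}

/-- Absorbing polynomial growth in a Gaussian. -/
theorem norm_pow_mul_exp_le (k : ℕ) {z : ℂ} (hz : z ∈ strip β) :
    ‖z‖ ^ k * Real.exp (-(3 / 8) * z.re ^ 2) ≤
      k.factorial * Real.exp (β / 2 + 1) * Real.exp (-(1 / 8) * z.re ^ 2) := by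
  have hz' : |z.im| < β / 2 := hz
  have h1 : ‖z‖ ≤ |z.re| + β / 2 := (norm_le_abs_re_add_abs_im z).trans (by linarith)
  have h2 : ‖z‖ ^ k ≤ k.factorial * Real.exp ‖z‖ := by
    have := Real.pow_div_factorial_le_exp ‖z‖ (norm_nonneg _) k
    rwa [div_le_iff₀' (by positivity)] at this
  have h3 : Real.exp ‖z‖ ≤ Real.exp (β / 2 + 1) * Real.exp (1 / 4 * z.re ^ 2) := by
    rw [← Real.exp_add, Real.exp_le_exp]
    nlinarith [sq_nonneg (|z.re| - 2), sq_abs z.re]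
  have h4 : Real.exp (-(1 / 8) * z.re ^ 2) =
      Real.exp (1 / 4 * z.re ^ 2) * Real.exp (-(3 / 8) * z.re ^ 2) := by
    rw [← Real.exp_add]; ring_nf
  calc _ ≤ k.factorial * (Real.exp (β / 2 + 1) * Real.exp (1 / 4 * z.re ^ 2)) *
        Real.exp (-(3 / 8) * z.re ^ 2) := by
        gcongr
        exact h2.trans (by gcongr)
    _ = _ := by rw [h4]; ring

/-- The ray is split at `s = 1/2`. On the lower half `1 - s² ≥ 3/4`, so the Gaussian quotient bound
beats `‖z‖^k`, and `sz` stays in `|Im| ≤ β/4`, where the bound by `A` is available. On the upper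
half the quotient and the power of `s` are merely bounded, leaving an average of `‖G‖` along the
ray. `C` depends on neither `G` nor `A`. -/
theorem exists_norm_resolventFT_le (hβ : 0 < β) (hθ : ConditionC β θ θhat)
    (hζ : -(k : ℝ) < ζ.re) : ∃ C : ℝ, 0 ≤ C ∧ ∀ G H : ℂ → ℂ, DifferentiableOn ℂ H (strip β) →
      (∀ z ∈ strip β, G z = z ^ k * H z) → ∀ A : ℝ, 0 ≤ A →
      (∀ z : ℂ, |z.im| ≤ β / 4 → ‖G z‖ ≤ A * ‖z‖ ^ k) → ∀ z ∈ strip β,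
      ‖resolventFT θhat ζ G z‖ ≤ C * (A * Real.exp (-(1 / 8) * z.re ^ 2)) +
        C * ∫ s in (1 / 2 : ℝ)..1, ‖G ((s : ℂ) * z)‖ := by
  obtain ⟨C₀, hC₀, hq⟩ := hθ.exists_groundFT_div_le hβ
  set D : ℝ := ∫ s in (0 : ℝ)..(1 / 2), s ^ (ζ.re + k - 1)
  have hD : 0 ≤ D := intervalIntegral.integral_nonneg (by norm_num) fun s hs =>
    Real.rpow_nonneg hs.1 _
  -- An upper bound for `s^(Re ζ - 1)` on `[1/2, 1]`, whatever the sign of the exponent.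
  set L : ℝ := (1 / 2 : ℝ) ^ (-|ζ.re - 1|)
  have hL : 0 ≤ L := by positivity
  set B : ℝ := k.factorial * Real.exp (β / 2 + 1)
  have hB : 0 ≤ B := by positivity
  refine ⟨C₀ * B * D + C₀ * L, by positivity, fun G H hH hG A hA hGA z hz => ?_⟩
  have hGd : ContinuousOn G (strip β) :=
    ((continuousOn_pow k).mul hH.continuousOn).congr hG
  set u : ℝ → ℂ := fun s => groundFT θhat z * (G ((s : ℂ) * z) / groundFT θhat ((s : ℂ) * z) *
    (s : ℂ) ^ (ζ - 1))
  have hu : IntervalIntegrable u volume 0 1 :=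
    (intervalIntegrable_ray_of_vanishing hζ (hθ.differentiableOn_div hβ hH)
      (div_groundFT_eq hG) hz).const_mul _
  have hub : ∀ s : ℝ, 0 < s → s ≤ 1 → ‖u s‖ ≤
      C₀ * Real.exp (-(1 - s ^ 2) / 2 * z.re ^ 2) * ‖G ((s : ℂ) * z)‖ * s ^ (ζ.re - 1) := by
    intro s h0 h1
    have e : u s = groundFT θhat z / groundFT θhat (s * z) * G (s * z) * (s : ℂ) ^ (ζ - 1) := by
      simp only [u]; ring
    rw [e, norm_mul, norm_mul, norm_cpow_eq_rpow_re_of_pos h0, sub_re, one_re]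
    gcongr
    exact hq z hz s h0.le h1
  have hsub1 : Set.uIcc (0 : ℝ) (1 / 2) ⊆ Set.uIcc 0 1 := by
    rw [Set.uIcc_of_le (by norm_num), Set.uIcc_of_le (by norm_num)]
    exact Set.Icc_subset_Icc le_rfl (by norm_num)
  have hsub2 : Set.uIcc (1 / 2 : ℝ) 1 ⊆ Set.uIcc 0 1 := by
    rw [Set.uIcc_of_le (by norm_num), Set.uIcc_of_le (by norm_num)]
    exact Set.Icc_subset_Icc (by norm_num) le_rfl
  have hu1 := hu.mono_set hsub1
  have hu2 := hu.mono_set hsub2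
  have e1 : ‖∫ s in (0 : ℝ)..(1 / 2), u s‖ ≤
      C₀ * A * (‖z‖ ^ k * Real.exp (-(3 / 8) * z.re ^ 2)) * D := by
    rw [← intervalIntegral.integral_const_mul]
    refine intervalIntegral.norm_integral_le_of_norm_le (by norm_num)
      (.of_forall fun s hs => ?_)
      ((intervalIntegral.intervalIntegrable_rpow' (by linarith)).const_mul _)
    obtain ⟨h0, h1⟩ := hs
    refine (hub s h0 (by linarith)).trans ?_
    have hz' : |z.im| < β / 2 := hz
    have g1 : ‖G ((s : ℂ) * z)‖ ≤ A * (s ^ k * ‖z‖ ^ k) := by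
      refine (hGA _ ?_).trans_eq ?_
      · rw [im_ofReal_mul, abs_mul, abs_of_pos h0]
        nlinarith [abs_nonneg z.im]
      · rw [norm_mul, norm_real, Real.norm_of_nonneg h0.le, mul_pow]
    have g2 : Real.exp (-(1 - s ^ 2) / 2 * z.re ^ 2) ≤ Real.exp (-(3 / 8) * z.re ^ 2) := by
      rw [Real.exp_le_exp]
      have : s ^ 2 ≤ 1 / 4 := by nlinarith
      nlinarith [sq_nonneg z.re]
    have g3 : s ^ (ζ.re + k - 1) = s ^ k * s ^ (ζ.re - 1) := by
      rw [← Real.rpow_natCast s k, ← Real.rpow_add h0]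
      congr 1; ring
    calc _ ≤ C₀ * Real.exp (-(3 / 8) * z.re ^ 2) * (A * (s ^ k * ‖z‖ ^ k)) * s ^ (ζ.re - 1) := by
          gcongr
      _ = _ := by rw [g3]; ring
  have hGi : IntervalIntegrable (fun s : ℝ => ‖G ((s : ℂ) * z)‖) volume (1 / 2) 1 :=
    ((continuousOn_ray hGd hz).norm.mono hsub2).intervalIntegrable
  have e2 : ‖∫ s in (1 / 2 : ℝ)..1, u s‖ ≤ C₀ * L * ∫ s in (1 / 2 : ℝ)..1, ‖G ((s : ℂ) * z)‖ := by
    rw [← intervalIntegral.integral_const_mul]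
    refine intervalIntegral.norm_integral_le_of_norm_le (by norm_num)
      (.of_forall fun s hs => ?_) (hGi.const_mul _)
    obtain ⟨h0, h1⟩ := hs
    have h0' : 0 < s := by linarith
    refine (hub s h0' h1).trans ?_
    have g1 : Real.exp (-(1 - s ^ 2) / 2 * z.re ^ 2) ≤ 1 := by
      rw [Real.exp_le_one_iff]
      have : s ^ 2 ≤ 1 := by nlinarith
      nlinarith [mul_nonneg (sub_nonneg.2 this) (sq_nonneg z.re)]
    have g2 : s ^ (ζ.re - 1) ≤ L :=
      (Real.rpow_le_rpow_of_exponent_ge h0' h1 (neg_abs_le _)).trans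
        (Real.rpow_le_rpow_of_nonpos (by norm_num) h0.le (by simp))
    calc _ ≤ C₀ * 1 * ‖G ((s : ℂ) * z)‖ * L := by gcongr
      _ = _ := by ring
  have e3 : resolventFT θhat ζ G z = (∫ s in (0 : ℝ)..(1 / 2), u s) + ∫ s in (1 / 2 : ℝ)..1, u s := by
    rw [intervalIntegral.integral_add_adjacent_intervals hu1 hu2, resolventFT, rayIntegral,
      ← intervalIntegral.integral_const_mul]
  have hI : 0 ≤ ∫ s in (1 / 2 : ℝ)..1, ‖G ((s : ℂ) * z)‖ :=
    intervalIntegral.integral_nonneg (by norm_num) fun s _ => norm_nonneg _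
  rw [e3]
  calc _ ≤ C₀ * A * (B * Real.exp (-(1 / 8) * z.re ^ 2)) * D +
        C₀ * L * ∫ s in (1 / 2 : ℝ)..1, ‖G ((s : ℂ) * z)‖ := by
        refine (norm_add_le _ _).trans (add_le_add (e1.trans ?_) e2)
        exact mul_le_mul_of_nonneg_right (mul_le_mul_of_nonneg_left
          (norm_pow_mul_exp_le k hz) (by positivity)) hD
    _ ≤ _ := by
        have t1 : 0 ≤ C₀ * B * D * ∫ s in (1 / 2 : ℝ)..1, ‖G ((s : ℂ) * z)‖ := by positivity
        have t2 : 0 ≤ C₀ * L * (A * Real.exp (-(1 / 8) * z.re ^ 2)) := by positivity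
        nlinarith

end

/-- Cauchy-Schwarz in `s`, then Tonelli. For fixed `s` the substitution `t ↦ st` leads to the line
at height `sb`, still in the strip, at the cost of `1/s ≤ 2`. -/
theorem lintegral_ray_sq_le (hβ : 0 < β) (g : WSpace β) {b : ℝ} (hb : |b| < β / 2) :
    ∫⁻ t : ℝ, ENNReal.ofReal (∫ s in (1 / 2 : ℝ)..1, ‖fourierT g ((s : ℂ) * (t + b * I))‖) ^ 2 ≤
      ENNReal.ofReal (4 * Real.pi) * ENNReal.ofReal (‖g‖ ^ 2) := by
  have hg := (g.expDecay hβ).differentiableOn_fourierT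
  have hmem : ∀ t s : ℝ, s ∈ Set.Ioc (1 / 2 : ℝ) 1 → (s : ℂ) * (t + b * I) ∈ strip β :=
    fun t s hs => mul_mem_strip (add_mul_I_mem_strip hb t) (by linarith [hs.1]) hs.2
  have hsub : Set.uIcc (1 / 2 : ℝ) 1 ⊆ Set.uIcc 0 1 := by
    rw [Set.uIcc_of_le (by norm_num), Set.uIcc_of_le (by norm_num)]
    exact Set.Icc_subset_Icc (by norm_num) le_rfl
  have hpt : ∀ t : ℝ,
      ENNReal.ofReal (∫ s in (1 / 2 : ℝ)..1, ‖fourierT g ((s : ℂ) * (t + b * I))‖) ^ 2 ≤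
        ENNReal.ofReal (1 / 2) *
          ∫⁻ s in Set.Ioc (1 / 2 : ℝ) 1, ‖fourierT g ((s : ℂ) * (t + b * I))‖ₑ ^ 2 := by
    intro t
    have hc := (continuousOn_ray hg.continuousOn (add_mul_I_mem_strip hb t)).mono hsub
    have hi : IntegrableOn (fun s : ℝ => fourierT g ((s : ℂ) * (t + b * I)))
        (Set.Ioc (1 / 2 : ℝ) 1) :=
      (intervalIntegrable_iff_integrableOn_Ioc_of_le (by norm_num)).1 hc.intervalIntegrable
    rw [intervalIntegral.integral_of_le (by norm_num), ofReal_integral_norm_eq_lintegral_enorm hi]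
    have h := lintegral_mul_sq_le (volume.restrict (Set.Ioc (1 / 2 : ℝ) 1))
      (f := fun _ => 1) aemeasurable_const hi.1.enorm
    simp only [one_mul, one_pow, lintegral_const, Measure.restrict_apply MeasurableSet.univ,
      Set.univ_inter, Real.volume_Ioc] at h
    refine h.trans_eq ?_
    norm_num
  refine (lintegral_mono hpt).trans ?_
  rw [lintegral_const_mul' _ _ (by simp), lintegral_lintegral_swap]
  · calc _ ≤ ENNReal.ofReal (1 / 2) * ∫⁻ s in Set.Ioc (1 / 2 : ℝ) 1,
          ENNReal.ofReal 2 * (ENNReal.ofReal (4 * Real.pi) * ENNReal.ofReal (‖g‖ ^ 2)) := by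
          refine mul_le_mul_right (setLIntegral_mono' measurableSet_Ioc fun s hs => ?_) _
          have h0 : 0 < s := by linarith [hs.1]
          have hsb : |s * b| < β / 2 := by
            rw [abs_mul, abs_of_pos h0]
            nlinarith [abs_nonneg b, hs.2]
          have e : ∀ t : ℝ, (s : ℂ) * (t + b * I) = ((s * t : ℝ) : ℂ) + ((s * b : ℝ) : ℂ) * I :=
            fun t => by push_cast; ring
          simp only [e]
          rw [lintegral_comp_mul_left h0.ne'
            (fun t : ℝ => ‖fourierT g (t + ((s * b : ℝ) : ℂ) * I)‖ₑ ^ 2)]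
          refine mul_le_mul' (ENNReal.ofReal_le_ofReal ?_)
            (lintegral_norm_fourierT_line_le hβ g hsb)
          rw [abs_of_pos (inv_pos.2 h0), inv_le_comm₀ h0 (by norm_num)]
          linarith [hs.1]
      _ ≤ _ := by
          rw [setLIntegral_const, Real.volume_Ioc]
          set X := ENNReal.ofReal (4 * Real.pi) * ENNReal.ofReal (‖g‖ ^ 2)
          calc _ = (ENNReal.ofReal (1 / 2) * ENNReal.ofReal 2 * ENNReal.ofReal (1 - 1 / 2)) * X := by
                ring
            _ ≤ 1 * X := by
                gcongr
                rw [← ENNReal.ofReal_mul (by norm_num), ← ENNReal.ofReal_mul (by norm_num)]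
                norm_num
            _ = X := one_mul X
  · have hco : ContinuousOn (fun p : ℝ × ℝ => fourierT g ((p.2 : ℂ) * (p.1 + b * I)))
        (Set.univ ×ˢ Set.Ioc (1 / 2 : ℝ) 1) :=
      hg.continuousOn.comp (by fun_prop) fun p hp => hmem p.1 p.2 hp.2
    have hm := hco.aestronglyMeasurable (μ := volume.prod volume)
      (MeasurableSet.univ.prod measurableSet_Ioc)
    rw [← Measure.prod_restrict, Measure.restrict_univ] at hm
    exact hm.enorm.pow_const 2

theorem ENNReal.add_sq_le_four_mul (a b : ℝ≥0∞) : (a + b) ^ 2 ≤ 4 * (a ^ 2 + b ^ 2) := by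
  rcases le_total a b with h | h
  · calc (a + b) ^ 2 ≤ (b + b) ^ 2 := by gcongr
      _ = 4 * b ^ 2 := by ring
      _ ≤ _ := by gcongr; exact le_add_self
  · calc (a + b) ^ 2 ≤ (a + a) ^ 2 := by gcongr
      _ = 4 * a ^ 2 := by ring
      _ ≤ _ := by gcongr; exact le_self_add

/-- Besides existence it gives a bound whose constant is uniform in `g`; for `θ = 0` this becomes
the a priori estimate behind the description of the domain. -/
theorem exists_resolvent (hβ : 0 < β) (hθ : ConditionC β θ θhat) {ζ : ℂ} {k : ℕ}
    (hζ : -(k : ℝ) < ζ.re) : ∃ C : ℝ, 0 ≤ C ∧ ∀ (g : WSpace β) (H : ℂ → ℂ),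
      DifferentiableOn ℂ H (strip β) → (∀ z ∈ strip β, fourierT g z = z ^ k * H z) →
      ∀ A : ℝ, 0 ≤ A → (∀ z : ℂ, |z.im| ≤ β / 4 → ‖fourierT g z‖ ≤ A * ‖z‖ ^ k) →
      ∃ f : WSpace β, (∀ z ∈ strip β, fourierT f z = resolventFT θhat ζ (fourierT g) z) ∧
        ‖f‖ ≤ C * (A + ‖g‖) := by
  obtain ⟨C, hC, hbound⟩ := exists_norm_resolventFT_le hβ hθ hζ
  set N : ℝ := ∫ t : ℝ, Real.exp (-(1 / 4) * t ^ 2)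
  have hN0 : 0 ≤ N := integral_nonneg fun t => (Real.exp_pos _).le
  have hN : ∫⁻ t : ℝ, ENNReal.ofReal (Real.exp (-(1 / 4) * t ^ 2)) = ENNReal.ofReal N :=
    (ofReal_integral_eq_lintegral_ofReal (integrable_exp_neg_mul_sq (by norm_num))
      (.of_forall fun t => (Real.exp_pos _).le)).symm
  -- The `4` is from `(a + b)² ≤ 4(a² + b²)`, `N` is the squared `L²` norm of the Gaussian term, and
  -- `4π` comes from `lintegral_ray_sq_le`.
  set X : ℝ := 4 * C ^ 2 * N + 4 * C ^ 2 * (4 * Real.pi)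
  have hX : 0 ≤ X := by positivity
  refine ⟨Real.sqrt X, by positivity, fun g H hH hg A hA hgA => ?_⟩
  have hb := hbound _ H hH hg A hA hgA
  have hsubstrips : BoundedOnSubstrips β (resolventFT θhat ζ (fourierT g)) := fun c hc => by
    obtain ⟨K, hK⟩ := (g.expDecay hβ).boundedOnSubstrips c hc
    refine ⟨C * (A * 1) + C * (K * |1 - 1 / 2|), fun z hz => (hb z (hz.trans_lt hc)).trans ?_⟩
    gcongr
    · rw [Real.exp_le_one_iff]; nlinarith [sq_nonneg z.re]
    · refine (Real.le_norm_self _).trans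
        (intervalIntegral.norm_integral_le_of_norm_le_const fun s hs => ?_)
      rw [Set.uIoc_of_le (by norm_num)] at hs
      rw [norm_norm]
      refine hK _ ?_
      rw [im_ofReal_mul, abs_mul, abs_of_pos (by linarith [hs.1])]
      nlinarith [abs_nonneg z.im, hs.1, hs.2]
  have hline : ∀ b : ℝ, |b| < β / 2 →
      ∫⁻ t : ℝ, ‖resolventFT θhat ζ (fourierT g) (t + b * I)‖ₑ ^ 2 ≤
        ENNReal.ofReal (X * (A + ‖g‖) ^ 2) := by
    intro b hb'
    have hpt : ∀ t : ℝ, ‖resolventFT θhat ζ (fourierT g) (t + b * I)‖ₑ ^ 2 ≤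
        ENNReal.ofReal (4 * C ^ 2 * A ^ 2) * ENNReal.ofReal (Real.exp (-(1 / 4) * t ^ 2)) +
        ENNReal.ofReal (4 * C ^ 2) * ENNReal.ofReal
          (∫ s in (1 / 2 : ℝ)..1, ‖fourierT g ((s : ℂ) * (t + b * I))‖) ^ 2 := by
      intro t
      have hI : 0 ≤ ∫ s in (1 / 2 : ℝ)..1, ‖fourierT g ((s : ℂ) * (t + b * I))‖ :=
        intervalIntegral.integral_nonneg (by norm_num) fun s _ => norm_nonneg _
      have h1 := hb _ (add_mul_I_mem_strip hb' t)
      have hre : (t + b * I : ℂ).re = t := by simp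
      rw [hre] at h1
      rw [← ofReal_norm]
      refine (pow_le_pow_left' (ENNReal.ofReal_le_ofReal h1) 2).trans ?_
      rw [ENNReal.ofReal_add (by positivity) (by positivity)]
      refine (ENNReal.add_sq_le_four_mul _ _).trans_eq ?_
      have he : Real.exp (-(1 / 4) * t ^ 2) = Real.exp (-(1 / 8) * t ^ 2) ^ 2 := by
        rw [← Real.exp_nat_mul]; congr 1; push_cast; ring
      rw [mul_add, ← ENNReal.ofReal_pow (by positivity), ← ENNReal.ofReal_pow (by positivity),
        ← ENNReal.ofReal_pow (by positivity), ← ENNReal.ofReal_ofNat,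
        ← ENNReal.ofReal_mul (by positivity), ← ENNReal.ofReal_mul (by positivity),
        ← ENNReal.ofReal_mul (by positivity), ← ENNReal.ofReal_mul (by positivity), he]
      congr 2 <;> ring
    refine (lintegral_mono hpt).trans ?_
    rw [lintegral_add_left (by fun_prop), lintegral_const_mul' _ _ ENNReal.ofReal_ne_top,
      lintegral_const_mul' _ _ ENNReal.ofReal_ne_top, hN]
    refine (add_le_add le_rfl (mul_le_mul_right (lintegral_ray_sq_le hβ g hb') _)).trans ?_
    rw [← ENNReal.ofReal_mul (by positivity), ← ENNReal.ofReal_mul (by positivity),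
      ← ENNReal.ofReal_mul (by positivity), ← ENNReal.ofReal_add (by positivity) (by positivity)]
    refine ENNReal.ofReal_le_ofReal ?_
    have t1 : A ^ 2 ≤ (A + ‖g‖) ^ 2 := by gcongr; linarith [norm_nonneg g]
    have t2 : ‖g‖ ^ 2 ≤ (A + ‖g‖) ^ 2 := by gcongr; linarith
    calc _ = 4 * C ^ 2 * N * A ^ 2 + 4 * C ^ 2 * (4 * Real.pi) * ‖g‖ ^ 2 := by ring
      _ ≤ 4 * C ^ 2 * N * (A + ‖g‖) ^ 2 + 4 * C ^ 2 * (4 * Real.pi) * (A + ‖g‖) ^ 2 := by gcongr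
      _ = _ := by ring
  obtain ⟨f, hf, hfn⟩ := exists_fourierT_eq hβ (differentiableOn_resolventFT hβ hθ hζ hH hg)
    hsubstrips ENNReal.ofReal_ne_top hline
  refine ⟨f, hf, ?_⟩
  rw [ENNReal.ofReal_le_ofReal_iff (by positivity)] at hfn
  refine abs_le_of_sq_le_sq' (hfn.trans_eq ?_) (by positivity) |>.2
  rw [mul_pow, Real.sq_sqrt hX]

end FokkerPlanck

namespace FokkerPlanck

open Filter Topology

variable {β : ℝ}

/-! ### The graph of the Fokker-Planck operator in Fourier variables -/

theorem exists_clm_deriv_fourierT (hβ : 0 < β) {z : ℂ} (hz : z ∈ strip β) :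
    ∃ Λ : WSpace β →L[ℂ] ℂ, ∀ f : WSpace β, Λ f = deriv (fourierT f) z := by
  obtain ⟨Λ, hΛ⟩ := exists_clm_fourierT hβ hz 1
  refine ⟨Λ, fun f => ?_⟩
  rw [hΛ, ((f.expDecay hβ).hasDerivAt_fourierT hz).deriv]
  simp only [pow_one]

theorem hasCompactSupport_integrable_mul_kernel {φ : ℝ → ℂ} (hφ : Continuous φ)
    (hc : HasCompactSupport φ) (z : ℂ) : Integrable fun x : ℝ => φ x * cexp (-(I * x * z)) :=
  (hφ.mul (by fun_prop)).integrable_of_hasCompactSupport hc.mul_right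

/-- The three integrands combine into the exact derivative of `(φ' + xφ + izφ) e^(-ixz)`, whose
integral is zero. -/
theorem fourierT_fpExpr {φ : ℝ → ℂ} (hφ : ContDiff ℝ ∞ φ) (hc : HasCompactSupport φ) (z : ℂ) :
    fourierT (fpExpr φ) z =
      -z ^ 2 * fourierT φ z - z * fourierT (fun x : ℝ => -(I * (x : ℂ)) * φ x) z := by
  have hφ' : ContDiff ℝ ∞ (deriv φ) := (contDiff_infty_iff_deriv.1 hφ).2
  have hφ'' : ContDiff ℝ ∞ (deriv (deriv φ)) := (contDiff_infty_iff_deriv.1 hφ').2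
  have hd0 : ∀ x, HasDerivAt φ (deriv φ x) x := fun x =>
    ((contDiff_infty_iff_deriv.1 hφ).1 x).hasDerivAt
  have hd1 : ∀ x, HasDerivAt (deriv φ) (deriv (deriv φ) x) x := fun x =>
    ((contDiff_infty_iff_deriv.1 hφ').1 x).hasDerivAt
  have ho : Continuous fun x : ℝ => (x : ℂ) := continuous_ofReal
  have hL : Continuous (fpExpr φ) := (hφ''.continuous.add (ho.mul hφ'.continuous)).add hφ.continuous
  have hLc : HasCompactSupport (fpExpr φ) := (hc.deriv.deriv.add hc.deriv.mul_left).add hc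
  have i0 := hasCompactSupport_integrable_mul_kernel hφ.continuous hc z
  have i1 := hasCompactSupport_integrable_mul_kernel (φ := fun x : ℝ => -(I * (x : ℂ)) * φ x)
    ((by fun_prop : Continuous fun x : ℝ => -(I * (x : ℂ))).mul hφ.continuous) hc.mul_left z
  have i2 := hasCompactSupport_integrable_mul_kernel hL hLc z
  have i3 : Integrable fun x : ℝ =>
      (deriv φ x + x * φ x + I * z * φ x) * cexp (-(I * x * z)) :=
    hasCompactSupport_integrable_mul_kernel
      ((hφ'.continuous.add (ho.mul hφ.continuous)).add (hφ.continuous.const_mul _))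
      ((hc.deriv.add hc.mul_left).add hc.mul_left) z
  have i4 := (i2.add (i0.const_mul (z ^ 2))).add (i1.const_mul z)
  have key := integral_eq_zero_of_hasDerivAt_of_integrable
    (f := fun x : ℝ => (deriv φ x + x * φ x + I * z * φ x) * cexp (-(I * x * z)))
    (fun x => ?_) i4 i3
  · rw [integral_add' (i2.add (i0.const_mul (z ^ 2))) (i1.const_mul z), integral_add' i2
      (i0.const_mul (z ^ 2)), integral_const_mul, integral_const_mul] at key
    simp only [fourierT] at *
    linear_combination key
  · have hx : HasDerivAt (fun y : ℝ => (y : ℂ)) 1 x := (hasDerivAt_id x).ofReal_comp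
    have he : HasDerivAt (fun y : ℝ => cexp (-(I * y * z))) (cexp (-(I * x * z)) * -(I * z)) x := by
      refine (((hx.const_mul I).mul_const z).neg).cexp.congr_deriv ?_
      simp
    refine ((((hd1 x).add (hx.mul (hd0 x))).add ((hd0 x).const_mul (I * z))).mul he).congr_deriv ?_
    simp only [fpExpr, Pi.add_apply, Pi.mul_apply]
    linear_combination (-(z ^ 2) * φ x * cexp (-(I * x * z))) * I_sq

/-- The identity holds on test functions and involves only continuous functionals of the pair, so it
survives the closure. -/
theorem fourierT_of_mem_fpGraph (hβ : 0 < β) {f u : WSpace β} (h : (f, u) ∈ fpGraph β) {z : ℂ}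
    (hz : z ∈ strip β) :
    fourierT u z = -z ^ 2 * fourierT f z - z * deriv (fourierT f) z := by
  obtain ⟨Λ₀, h₀⟩ := exists_clm_fourierT hβ hz 0
  obtain ⟨Λ₁, h₁⟩ := exists_clm_deriv_fourierT hβ hz
  simp only [pow_zero, one_mul] at h₀
  have hclosed : IsClosed {p : WSpace β × WSpace β | Λ₀ p.2 = -z ^ 2 * Λ₀ p.1 - z * Λ₁ p.1} :=
    isClosed_eq (by fun_prop) (by fun_prop)
  have hsub : fpCoreGraph β ⊆ {p | Λ₀ p.2 = -z ^ 2 * Λ₀ p.1 - z * Λ₁ p.1} := by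
    rintro ⟨f, u⟩ ⟨φ, hφ, hc, hf, hu⟩
    simp only [Set.mem_ofPred_eq, h₀, h₁]
    rw [((f.expDecay hβ).hasDerivAt_fourierT hz).deriv, fourierT_congr_ae hu, fourierT_congr_ae hf,
      fourierT_fpExpr hφ hc]
    congr 2
    refine fourierT_congr_ae ?_ z
    filter_upwards [hf] with x hx
    rw [hx]
  have := closure_minimal hsub hclosed h
  simpa only [Set.mem_ofPred_eq, h₀, h₁] using this

/-! ### Smooth functions in the domain -/

theorem tendsto_WSpace {F : ℕ → WSpace β} {f : WSpace β} {D : ℝ → ℝ}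
    (hDint : ∫⁻ x : ℝ, ENNReal.ofReal (Real.cosh (β * x)) * ENNReal.ofReal (D x) ^ 2 ≠ ⊤)
    (hle : ∀ n, ∀ᵐ x : ℝ, ‖F n x - f x‖ ≤ D x)
    (hev : ∀ᵐ x : ℝ, ∀ᶠ n in atTop, F n x = f x) : Tendsto F atTop (𝓝 f) := by
  have hsub : ∀ n, (F n - f : WSpace β) =ᵐ[volume] fun x => F n x - f x := fun n =>
    (ac_weightMeasure β).ae_eq (Lp.coeFn_sub _ _)
  have key : Tendsto (fun n => ∫⁻ x : ℝ, ENNReal.ofReal (Real.cosh (β * x)) *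
      ‖F n x - f x‖ₑ ^ 2) atTop (𝓝 (∫⁻ _ : ℝ, 0)) := by
    refine tendsto_lintegral_of_dominated_convergence' _ (fun n => ?_) (fun n => ?_) hDint ?_
    · exact (measurable_weight β).aemeasurable.mul
        (((F n).aestronglyMeasurable.sub f.aestronglyMeasurable).enorm.pow_const 2)
    · filter_upwards [hle n] with x hx
      rw [← ofReal_norm]
      gcongr
    · filter_upwards [hev] with x hx
      refine tendsto_const_nhds.congr' ?_
      filter_upwards [hx] with n hn
      simp [hn]
  have h2 : Tendsto (fun n => ENNReal.ofReal (‖F n - f‖ ^ 2)) atTop (𝓝 0) := by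
    rw [lintegral_zero] at key
    refine key.congr fun n => ?_
    rw [ofReal_norm_sq]
    refine lintegral_congr_ae ?_
    filter_upwards [hsub n] with x hx
    rw [hx]
  rw [tendsto_iff_norm_sub_tendsto_zero]
  have h3 : Tendsto (fun n => ‖F n - f‖ ^ 2) atTop (𝓝 0) := by
    refine ((ENNReal.tendsto_toReal ENNReal.zero_ne_top).comp h2).congr fun n => ?_
    simp
  have h4 := (Real.continuous_sqrt.tendsto 0).comp h3
  rw [Real.sqrt_zero] at h4
  refine h4.congr fun n => ?_
  simp

theorem hasDerivAt_cutoff_mul {χ : ℝ → ℝ} (hχ : Differentiable ℝ χ) {φ : ℝ → ℂ} {φ' : ℂ} {x : ℝ}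
    (hφ : HasDerivAt φ φ' x) (a : ℝ) :
    HasDerivAt (fun y : ℝ => (χ (a * y) : ℂ) * φ y)
      ((a * deriv χ (a * x) : ℝ) * φ x + (χ (a * x) : ℂ) * φ') x := by
  have h1 : HasDerivAt (fun y : ℝ => χ (a * y)) (a * deriv χ (a * x)) x := by
    have h2 : HasDerivAt (fun y : ℝ => a * y) a x := by
      simpa using (hasDerivAt_id' x).const_mul a
    exact ((hχ (a * x)).hasDerivAt.comp x h2).congr_deriv (mul_comm _ _)
  exact h1.ofReal_comp.mul hφ

theorem fpExpr_cutoff_mul {χ : ℝ → ℝ} (hχ : ContDiff ℝ ∞ χ) {φ : ℝ → ℂ} (hφ : ContDiff ℝ ∞ φ)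
    (a x : ℝ) :
    fpExpr (fun y : ℝ => (χ (a * y) : ℂ) * φ y) x = (χ (a * x) : ℂ) * fpExpr φ x +
      ((2 * a * deriv χ (a * x) : ℝ) : ℂ) * deriv φ x +
      ((a ^ 2 * deriv (deriv χ) (a * x) + (a * x) * deriv χ (a * x) : ℝ) : ℂ) * φ x := by
  have hχ' : ContDiff ℝ ∞ (deriv χ) := (contDiff_infty_iff_deriv.1 hχ).2
  have hφ' : ContDiff ℝ ∞ (deriv φ) := (contDiff_infty_iff_deriv.1 hφ).2
  have hd0 : ∀ x, HasDerivAt φ (deriv φ x) x := fun x =>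
    ((contDiff_infty_iff_deriv.1 hφ).1 x).hasDerivAt
  have hd1 : ∀ x, HasDerivAt (deriv φ) (deriv (deriv φ) x) x := fun x =>
    ((contDiff_infty_iff_deriv.1 hφ').1 x).hasDerivAt
  have e1 : deriv (fun y : ℝ => (χ (a * y) : ℂ) * φ y) = fun x =>
      (a : ℂ) * (((deriv χ (a * x) : ℝ) : ℂ) * φ x) + (χ (a * x) : ℂ) * deriv φ x := by
    ext x
    rw [(hasDerivAt_cutoff_mul (contDiff_infty_iff_deriv.1 hχ).1 (hd0 x) a).deriv]
    push_cast; ring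
  have e2 := ((hasDerivAt_cutoff_mul (contDiff_infty_iff_deriv.1 hχ').1 (hd0 x) a).const_mul
    (a : ℂ)).add (hasDerivAt_cutoff_mul (contDiff_infty_iff_deriv.1 hχ).1 (hd1 x) a)
  have e3 := (congrArg (fun g : ℝ → ℂ => deriv g x) e1).trans e2.deriv
  rw [fpExpr, e3, e1]
  simp only [fpExpr]
  push_cast
  ring

/-- Approximation by the cutoffs `χ(x/(n+1)) φ`, with dominated convergence of both components of
the graph. -/
theorem mem_fpGraph_of_contDiff {φ : ℝ → ℂ} (hφ : ContDiff ℝ ∞ φ) {f u : WSpace β}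
    (hf : ∀ᵐ x : ℝ, f x = φ x) (hu : ∀ᵐ x : ℝ, u x = fpExpr φ x)
    (hint : ∫⁻ x : ℝ, ENNReal.ofReal (Real.cosh (β * x)) *
      ENNReal.ofReal (‖fpExpr φ x‖ + ‖deriv φ x‖ + ‖φ x‖) ^ 2 ≠ ⊤) : (f, u) ∈ fpGraph β := by
  let χ : ContDiffBump (0 : ℝ) := ⟨1, 2, one_pos, one_lt_two⟩
  have hχ : ContDiff ℝ ∞ χ := χ.contDiff
  have hχ' : ContDiff ℝ ∞ (deriv χ) := (contDiff_infty_iff_deriv.1 hχ).2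
  have hχ'' : ContDiff ℝ ∞ (deriv (deriv χ)) := (contDiff_infty_iff_deriv.1 hχ').2
  have hχc : HasCompactSupport χ := χ.hasCompactSupport
  obtain ⟨C₁, hC₁⟩ := hχ'.continuous.bounded_above_of_compact_support hχc.deriv
  obtain ⟨C₂, hC₂⟩ := hχ''.continuous.bounded_above_of_compact_support hχc.deriv.deriv
  -- The drift falling on the cutoff produces `ax χ'(ax)`. It is bounded uniformly in `a` because `y
  -- χ'(y)` is bounded, despite the unbounded coefficient `x`.
  obtain ⟨C₃, hC₃⟩ := (continuous_id.mul hχ'.continuous).bounded_above_of_compact_support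
    hχc.deriv.mul_left
  have hC₁0 : 0 ≤ C₁ := (norm_nonneg _).trans (hC₁ 0)
  have hC₂0 : 0 ≤ C₂ := (norm_nonneg _).trans (hC₂ 0)
  have hC₃0 : 0 ≤ C₃ := (norm_nonneg _).trans (hC₃ 0)
  have hφ' : ContDiff ℝ ∞ (deriv φ) := (contDiff_infty_iff_deriv.1 hφ).2
  have hφ'' : ContDiff ℝ ∞ (deriv (deriv φ)) := (contDiff_infty_iff_deriv.1 hφ').2
  have hLcont : ∀ ψ : ℝ → ℂ, ContDiff ℝ ∞ ψ → Continuous (fpExpr ψ) := fun ψ hψ => by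
    have hψ' : ContDiff ℝ ∞ (deriv ψ) := (contDiff_infty_iff_deriv.1 hψ).2
    have hψ'' : ContDiff ℝ ∞ (deriv (deriv ψ)) := (contDiff_infty_iff_deriv.1 hψ').2
    exact (hψ''.continuous.add (continuous_ofReal.mul hψ'.continuous)).add hψ.continuous
  set a : ℕ → ℝ := fun n => 1 / ((n : ℝ) + 1)
  have ha0 : ∀ n, 0 < a n := fun n => by positivity
  have ha1 : ∀ n, a n ≤ 1 := fun n => by
    simp only [a]
    rw [div_le_one (by positivity)]; linarith [(Nat.cast_nonneg n : (0 : ℝ) ≤ n)]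
  set φn : ℕ → ℝ → ℂ := fun n y => (χ (a n * y) : ℂ) * φ y
  have hφn : ∀ n, ContDiff ℝ ∞ (φn n) := fun n => by
    refine ContDiff.mul ?_ hφ
    exact ofRealCLM.contDiff.comp (hχ.comp (contDiff_const.mul contDiff_id))
  have hφnc : ∀ n, HasCompactSupport (φn n) := fun n => by
    have h1 : HasCompactSupport fun y : ℝ => χ (a n * y) :=
      hχc.comp_homeomorph (Homeomorph.mulLeft₀ (a n) (ha0 n).ne')
    have h2 : HasCompactSupport fun y : ℝ => (χ (a n * y) : ℂ) := h1.comp_left ofReal_zero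
    exact h2.mul_right
  have hLc : ∀ n, HasCompactSupport (fpExpr (φn n)) := fun n =>
    ((hφnc n).deriv.deriv.add (hφnc n).deriv.mul_left).add (hφnc n)
  have hmem : ∀ ψ : ℝ → ℂ, Continuous ψ → HasCompactSupport ψ → MemLp ψ 2 (weightMeasure β) := by
    intro ψ hψ hψc
    rw [memLp_weight_iff]
    refine ⟨hψ.aestronglyMeasurable, ?_⟩
    have h1 : Continuous fun x => Real.cosh (β * x) * ‖ψ x‖ ^ 2 := by fun_prop
    have h2 : HasCompactSupport fun x => Real.cosh (β * x) * ‖ψ x‖ ^ 2 := by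
      refine HasCompactSupport.mul_left ?_
      exact hψc.comp_left (g := fun w : ℂ => ‖w‖ ^ 2) (by simp)
    refine lt_of_eq_of_lt ?_ (h1.integrable_of_hasCompactSupport (μ := volume) h2).lintegral_lt_top
    refine lintegral_congr fun x => ?_
    rw [ENNReal.ofReal_mul (Real.cosh_pos _).le, ENNReal.ofReal_pow (norm_nonneg _), ofReal_norm]
  have hχeq : ∀ x : ℝ, ∀ᶠ n : ℕ in atTop, φn n =ᶠ[𝓝 x] φ := by
    intro x
    filter_upwards [eventually_gt_atTop ⌈|x|⌉₊] with n hn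
    have hn' : |x| < n + 1 := ((Nat.le_ceil _).trans_lt (by exact_mod_cast hn)).trans
      (lt_add_one _)
    filter_upwards [(isOpen_lt continuous_abs continuous_const).mem_nhds hn'] with y hy
    have hy' : |y| < n + 1 := hy
    have h1 : χ (a n * y) = 1 := by
      refine χ.one_of_mem_closedBall ?_
      have hχin : χ.rIn = 1 := rfl
      rw [hχin, mem_closedBall_zero_iff, Real.norm_eq_abs, abs_mul, abs_of_pos (ha0 n)]
      simp only [a]
      rw [one_div_mul_eq_div, div_le_one (by positivity)]
      exact hy'.le
    simp only [φn, h1, ofReal_one, one_mul]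
  have hχle : ∀ y : ℝ, |χ y - 1| ≤ 1 := fun y => by
    have h0 : 0 ≤ χ y := χ.nonneg
    have h1 : χ y ≤ 1 := χ.le_one
    rw [abs_le]; constructor <;> linarith
  set C : ℝ := 1 + 2 * C₁ + C₂ + C₃
  set D : ℝ → ℝ := fun x => C * (‖fpExpr φ x‖ + ‖deriv φ x‖ + ‖φ x‖)
  have hDint : ∫⁻ x : ℝ, ENNReal.ofReal (Real.cosh (β * x)) * ENNReal.ofReal (D x) ^ 2 ≠ ⊤ := by
    have e : ∀ x : ℝ, ENNReal.ofReal (Real.cosh (β * x)) * ENNReal.ofReal (D x) ^ 2 =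
        ENNReal.ofReal C ^ 2 * (ENNReal.ofReal (Real.cosh (β * x)) *
          ENNReal.ofReal (‖fpExpr φ x‖ + ‖deriv φ x‖ + ‖φ x‖) ^ 2) := fun x => by
      simp only [D]
      rw [ENNReal.ofReal_mul (by positivity)]
      ring
    simp only [e]
    rw [lintegral_const_mul' _ _ (by finiteness)]
    exact ENNReal.mul_ne_top (by finiteness) hint
  set F : ℕ → WSpace β := fun n => (hmem _ (hφn n).continuous (hφnc n)).toLp
  set U : ℕ → WSpace β := fun n => (hmem _ (hLcont _ (hφn n)) (hLc n)).toLp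
  have hF : ∀ n, (F n : ℝ → ℂ) =ᵐ[volume] φn n := fun n => coeFn_toLp_weight _
  have hU : ∀ n, (U n : ℝ → ℂ) =ᵐ[volume] fpExpr (φn n) := fun n => coeFn_toLp_weight _
  have hFlim : Tendsto F atTop (𝓝 f) := by
    refine tendsto_WSpace hDint (fun n => ?_) ?_
    · filter_upwards [hF n, hf] with x h1 h2
      rw [h1, h2]
      have e : φn n x - φ x = ((χ (a n * x) - 1 : ℝ) : ℂ) * φ x := by
        simp only [φn]; push_cast; ring
      rw [e, norm_mul, norm_real, Real.norm_eq_abs]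
      calc |χ (a n * x) - 1| * ‖φ x‖ ≤ 1 * ‖φ x‖ := by gcongr; exact hχle _
        _ ≤ C * (‖fpExpr φ x‖ + ‖deriv φ x‖ + ‖φ x‖) := by
          refine mul_le_mul ?_ ?_ (norm_nonneg _) (by positivity)
          · simp only [C]; linarith
          · linarith [norm_nonneg (fpExpr φ x), norm_nonneg (deriv φ x)]
    · filter_upwards [ae_all_iff.2 hF, hf] with x h1 h2
      filter_upwards [hχeq x] with n hn
      rw [h1, h2, hn.eq_of_nhds]
  have hUlim : Tendsto U atTop (𝓝 u) := by
    refine tendsto_WSpace hDint (fun n => ?_) ?_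
    · filter_upwards [hU n, hu] with x h1 h2
      rw [h1, h2]
      have e : fpExpr (φn n) x - fpExpr φ x = ((χ (a n * x) - 1 : ℝ) : ℂ) * fpExpr φ x +
          ((2 * a n * deriv χ (a n * x) : ℝ) : ℂ) * deriv φ x +
          ((a n ^ 2 * deriv (deriv χ) (a n * x) + (a n * x) * deriv χ (a n * x) : ℝ) : ℂ) * φ x := by
        rw [fpExpr_cutoff_mul hχ hφ]; push_cast; ring
      have b1 : |2 * a n * deriv χ (a n * x)| ≤ 2 * C₁ := by
        have h3 := hC₁ (a n * x)
        rw [Real.norm_eq_abs] at h3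
        rw [abs_mul, abs_of_pos (mul_pos two_pos (ha0 n))]
        calc _ ≤ 2 * 1 * C₁ := by gcongr; exact ha1 n
          _ = _ := by ring
      have b2 : |a n ^ 2 * deriv (deriv χ) (a n * x) + (a n * x) * deriv χ (a n * x)| ≤
          C₂ + C₃ := by
        have h3 := hC₂ (a n * x)
        have h4 := hC₃ (a n * x)
        rw [Real.norm_eq_abs] at h3 h4
        refine (abs_add_le _ _).trans (add_le_add ?_ h4)
        rw [abs_mul, abs_of_nonneg (sq_nonneg _)]
        calc _ ≤ 1 * C₂ := by
              gcongr
              exact pow_le_one₀ (ha0 n).le (ha1 n)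
          _ = _ := one_mul _
      rw [e]
      refine (norm_add₃_le).trans ?_
      rw [norm_mul, norm_mul, norm_mul, norm_real, norm_real, norm_real, Real.norm_eq_abs,
        Real.norm_eq_abs, Real.norm_eq_abs]
      calc _ ≤ 1 * ‖fpExpr φ x‖ + 2 * C₁ * ‖deriv φ x‖ + (C₂ + C₃) * ‖φ x‖ := by
            gcongr
            exact hχle _
        _ ≤ C * ‖fpExpr φ x‖ + C * ‖deriv φ x‖ + C * ‖φ x‖ := by
            gcongr <;> simp only [C] <;> linarith
        _ = _ := by simp only [D]; ring
    · filter_upwards [ae_all_iff.2 hU, hu] with x h1 h2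
      filter_upwards [hχeq x] with n hn
      rw [h1, h2]
      simp only [fpExpr]
      rw [hn.deriv.deriv_eq, hn.deriv_eq, hn.eq_of_nhds]
  exact mem_closure_of_tendsto (hFlim.prodMk_nhds hUlim)
    (.of_forall fun n => ⟨φn n, hφn n, hφnc n, hF n, hU n⟩)

end FokkerPlanck

namespace FokkerPlanck

open Filter Topology
open Polynomial (derivative)

variable {β : ℝ}

/-! ### Gaussian polynomials -/

/-- The function `p μ` for a polynomial `p`. -/
noncomputable def gaussPoly (p : Polynomial ℂ) (x : ℝ) : ℂ := p.eval (x : ℂ) * (gauss x : ℂ)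

theorem hasDerivAt_gauss (x : ℝ) : HasDerivAt gauss (-x * gauss x) x := by
  have h : HasDerivAt (fun y : ℝ => -y ^ 2 / 2) (-x) x := by
    refine (((hasDerivAt_pow 2 x).neg).div_const 2).congr_deriv ?_
    norm_num
    ring
  exact h.exp.congr_deriv (mul_comm _ _)

theorem contDiff_gauss : ContDiff ℝ ∞ gauss := by unfold gauss; fun_prop

theorem gauss_pos (x : ℝ) : 0 < gauss x := Real.exp_pos _

theorem contDiff_gaussPoly (p : Polynomial ℂ) : ContDiff ℝ ∞ (gaussPoly p) := by
  have h1 : ContDiff ℂ ∞ fun z : ℂ => p.eval z := by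
    simpa using p.contDiff_aeval (𝕜 := ℂ) ∞
  exact ((h1.restrict_scalars ℝ).comp ofRealCLM.contDiff).mul
    (ofRealCLM.contDiff.comp contDiff_gauss)

theorem deriv_gaussPoly (p : Polynomial ℂ) :
    deriv (gaussPoly p) = gaussPoly (derivative p - Polynomial.X * p) := by
  ext x
  have h := ((p.hasDerivAt (x : ℂ)).comp_ofReal).mul (hasDerivAt_gauss x).ofReal_comp
  refine h.deriv.trans ?_
  simp only [gaussPoly, Polynomial.eval_sub, Polynomial.eval_mul, Polynomial.eval_X]
  push_cast
  ring

/-- Factoring out the Gaussian turns `L` into `p ↦ p'' - x p'`, which does not raise degrees. -/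
theorem fpExpr_gaussPoly (p : Polynomial ℂ) :
    fpExpr (gaussPoly p) = gaussPoly (derivative (derivative p) - Polynomial.X * derivative p) := by
  ext x
  rw [fpExpr, deriv_gaussPoly, deriv_gaussPoly]
  simp only [gaussPoly, Polynomial.eval_sub, Polynomial.eval_mul, Polynomial.eval_X,
    Polynomial.derivative_sub, Polynomial.derivative_mul, Polynomial.derivative_X, one_mul,
    Polynomial.eval_add]
  ring

theorem exists_norm_eval_le (p : Polynomial ℂ) :
    ∃ C : ℝ, 0 ≤ C ∧ ∀ x : ℝ, ‖p.eval (x : ℂ)‖ ≤ C * Real.exp |x| := by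
  induction p using Polynomial.induction_on' with
  | add p q hp hq =>
    obtain ⟨C, hC, h⟩ := hp
    obtain ⟨D, hD, h'⟩ := hq
    refine ⟨C + D, by positivity, fun x => ?_⟩
    rw [Polynomial.eval_add, add_mul]
    exact (norm_add_le _ _).trans (add_le_add (h x) (h' x))
  | monomial n a =>
    refine ⟨‖a‖ * n.factorial, by positivity, fun x => ?_⟩
    rw [Polynomial.eval_monomial, norm_mul, norm_pow, norm_real, Real.norm_eq_abs, mul_assoc]
    gcongr
    have := Real.pow_div_factorial_le_exp |x| (abs_nonneg x) n
    rwa [div_le_iff₀' (by positivity)] at this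

theorem lintegral_cosh_mul_gaussPoly (β : ℝ) {φ : ℝ → ℝ} {C : ℝ}
    (h : ∀ x, φ x ≤ C * (Real.exp |x| * gauss x)) :
    ∫⁻ x : ℝ, ENNReal.ofReal (Real.cosh (β * x)) * ENNReal.ofReal (φ x) ^ 2 ≠ ⊤ := by
  have hi : Integrable fun x : ℝ => Real.exp ((|β| + 2) ^ 2 / 2) * C ^ 2 *
      Real.exp (-(1 / 2) * x ^ 2) :=
    (integrable_exp_neg_mul_sq (by norm_num)).const_mul _
  refine ne_top_of_le_ne_top hi.lintegral_lt_top.ne (lintegral_mono fun x => ?_)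
  have hC : 0 ≤ C ∨ φ x ≤ 0 := by
    by_contra! hc
    have := h x
    have hp : 0 < Real.exp |x| * gauss x := mul_pos (Real.exp_pos _) (gauss_pos x)
    nlinarith [hc.1, hc.2]
  rcases hC with hC | hφ
  · have h1 : ENNReal.ofReal (φ x) ^ 2 ≤ ENNReal.ofReal ((C * (Real.exp |x| * gauss x)) ^ 2) := by
      rw [ENNReal.ofReal_pow (mul_nonneg hC (mul_nonneg (Real.exp_pos _).le (gauss_pos x).le))]
      gcongr
      exact h x
    refine (mul_le_mul_right h1 _).trans ?_
    rw [← ENNReal.ofReal_mul (Real.cosh_pos _).le]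
    refine ENNReal.ofReal_le_ofReal ?_
    have h2 : Real.cosh (β * x) ≤ Real.exp (|β| * |x|) := by
      rw [← abs_mul, ← Real.cosh_abs, Real.cosh_eq]
      have := Real.exp_le_exp.2 (neg_le_self (abs_nonneg (β * x)))
      linarith
    have h3 : Real.exp (|β| * |x|) * (Real.exp |x| * gauss x) ^ 2 ≤
        Real.exp ((|β| + 2) ^ 2 / 2) * Real.exp (-(1 / 2) * x ^ 2) := by
      rw [gauss, ← Real.exp_add, ← Real.exp_nat_mul, ← Real.exp_add, ← Real.exp_add,
        Real.exp_le_exp]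
      push_cast
      nlinarith [sq_nonneg (|x| - (|β| + 2)), sq_abs x]
    calc Real.cosh (β * x) * (C * (Real.exp |x| * gauss x)) ^ 2
        ≤ Real.exp (|β| * |x|) * (C * (Real.exp |x| * gauss x)) ^ 2 := by gcongr
      _ = C ^ 2 * (Real.exp (|β| * |x|) * (Real.exp |x| * gauss x) ^ 2) := by ring
      _ ≤ C ^ 2 * (Real.exp ((|β| + 2) ^ 2 / 2) * Real.exp (-(1 / 2) * x ^ 2)) := by gcongr
      _ = _ := by ring
  · simp [ENNReal.ofReal_of_nonpos hφ]

theorem exists_norm_gaussPoly_le (p : Polynomial ℂ) :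
    ∃ C : ℝ, 0 ≤ C ∧ ∀ x : ℝ, ‖gaussPoly p x‖ ≤ C * (Real.exp |x| * gauss x) := by
  obtain ⟨C, hC, h⟩ := exists_norm_eval_le p
  refine ⟨C, hC, fun x => ?_⟩
  rw [gaussPoly, norm_mul, norm_real, Real.norm_of_nonneg (gauss_pos x).le, ← mul_assoc]
  gcongr
  · exact (gauss_pos x).le
  · exact h x

theorem memLp_gaussPoly (β : ℝ) (p : Polynomial ℂ) : MemLp (gaussPoly p) 2 (weightMeasure β) := by
  obtain ⟨C, -, h⟩ := exists_norm_gaussPoly_le p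
  refine memLp_weight_iff.2 ⟨(contDiff_gaussPoly p).continuous.aestronglyMeasurable, ?_⟩
  have := lintegral_cosh_mul_gaussPoly β h
  simp only [ofReal_norm] at this
  exact this.lt_top

/-- Gaussian polynomials as elements of `𝓔`. -/
noncomputable def gaussPolyW (β : ℝ) : Polynomial ℂ →ₗ[ℂ] WSpace β where
  toFun p := (memLp_gaussPoly β p).toLp
  map_add' p q := by
    rw [← MemLp.toLp_add]
    congr 1
    ext x
    simp [gaussPoly, add_mul]
  map_smul' r p := by
    rw [RingHom.id_apply, ← MemLp.toLp_const_smul]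
    congr 1
    ext x
    simp [gaussPoly, mul_assoc]

theorem coeFn_gaussPolyW (p : Polynomial ℂ) : (gaussPolyW β p : ℝ → ℂ) =ᵐ[volume] gaussPoly p :=
  coeFn_toLp_weight (memLp_gaussPoly β p)

theorem gaussPolyW_mem_fpGraph (p : Polynomial ℂ) :
    (gaussPolyW β p, gaussPolyW β (derivative (derivative p) - Polynomial.X * derivative p)) ∈
      fpGraph β := by
  refine mem_fpGraph_of_contDiff (contDiff_gaussPoly p) (coeFn_gaussPolyW p)
    (by rw [fpExpr_gaussPoly]; exact coeFn_gaussPolyW _) ?_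
  rw [fpExpr_gaussPoly, deriv_gaussPoly]
  obtain ⟨C₁, -, h₁⟩ :=
    exists_norm_gaussPoly_le (derivative (derivative p) - Polynomial.X * derivative p)
  obtain ⟨C₂, -, h₂⟩ := exists_norm_gaussPoly_le (derivative p - Polynomial.X * p)
  obtain ⟨C₃, -, h₃⟩ := exists_norm_gaussPoly_le p
  refine lintegral_cosh_mul_gaussPoly β (C := C₁ + C₂ + C₃) fun x => ?_
  rw [add_mul, add_mul]
  exact add_le_add (add_le_add (h₁ x) (h₂ x)) (h₃ x)

/-- On monomials the operator is triangular with diagonal entries `n + 2 ≠ 0`, so strong induction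
on `n` reaches every `X^n`. -/
theorem exists_two_sub_fp_eq (q : Polynomial ℂ) : ∃ p : Polynomial ℂ,
    (2 : ℂ) • p - (derivative (derivative p) - Polynomial.X * derivative p) = q := by
  let T : Polynomial ℂ →ₗ[ℂ] Polynomial ℂ :=
    (2 : ℂ) • LinearMap.id - (derivative ∘ₗ derivative - LinearMap.mulLeft ℂ Polynomial.X ∘ₗ derivative)
  suffices h : LinearMap.range T = ⊤ by
    obtain ⟨p, hp⟩ := LinearMap.range_eq_top.1 h q
    exact ⟨p, hp⟩
  have hX : ∀ n : ℕ, (Polynomial.X ^ n : Polynomial ℂ) ∈ LinearMap.range T := by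
    intro n
    induction n using Nat.strong_induction_on with
    | _ n ih =>
      -- The truncated subtractions are harmless: for `n = 0, 1` the coefficient of `X^(n-2)` is
      -- zero.
      have hT : T (Polynomial.X ^ n) = ((n : ℂ) + 2) • Polynomial.X ^ n -
          ((n : ℂ) * ((n - 1 : ℕ) : ℂ)) • Polynomial.X ^ (n - 2) := by
        simp only [T, LinearMap.sub_apply, LinearMap.smul_apply, LinearMap.id_apply,
          LinearMap.comp_apply, LinearMap.mulLeft_apply, Polynomial.derivative_X_pow,
          Polynomial.derivative_C_mul, Polynomial.smul_eq_C_mul]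
        rcases n with _ | n
        · simp
        · simp only [Nat.add_sub_cancel, pow_succ, show n + 1 - 2 = n - 1 by omega,
            map_add, map_mul, map_natCast]
          push_cast
          simp only [map_ofNat]
          ring
      have hlow : ((n : ℂ) * ((n - 1 : ℕ) : ℂ)) • (Polynomial.X ^ (n - 2) : Polynomial ℂ) ∈
          LinearMap.range T := by
        rcases n with _ | n
        · simp
        · exact Submodule.smul_mem _ _ (ih _ (by omega))
      have h1 : ((n : ℂ) + 2) • (Polynomial.X ^ n : Polynomial ℂ) ∈ LinearMap.range T := by
        have := Submodule.add_mem _ (LinearMap.mem_range_self T (Polynomial.X ^ n)) hlow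
        rwa [hT, sub_add_cancel] at this
      have hn : (n : ℂ) + 2 ≠ 0 := by
        have : ((n + 2 : ℕ) : ℂ) ≠ 0 := Nat.cast_ne_zero.2 (by omega)
        simpa using this
      exact (Submodule.smul_mem_iff _ hn).1 h1
  rw [eq_top_iff]
  rintro p -
  induction p using Polynomial.induction_on' with
  | add p q hp hq => exact Submodule.add_mem _ hp hq
  | monomial n a =>
    rw [← Polynomial.C_mul_X_pow_eq_monomial, ← Polynomial.smul_eq_C_mul]
    exact Submodule.smul_mem _ _ (hX n)

end FokkerPlanck

/-! ### Moments, and density of the Gaussian polynomials. -/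

namespace FokkerPlanck

open Filter Topology
open Polynomial (derivative)

variable {β : ℝ}

theorem iteratedDeriv_fourierT_zero (hβ : 0 < β) {f : ℝ → ℂ} (hf : ExpDecay (β / 2) f) (n : ℕ) :
    iteratedDeriv n (fourierT f) 0 = (-I) ^ n * ∫ x : ℝ, f x * (x : ℂ) ^ n := by
  rw [hf.iteratedDeriv_fourierT n (by simpa using ofReal_mem_strip hβ 0), fourierT,
    ← integral_const_mul]
  refine integral_congr_ae (.of_forall fun x => ?_)
  simp only [mul_zero, neg_zero, Complex.exp_zero, mul_one]
  rw [← neg_mul, mul_pow]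
  ring

/-- The moments are, up to constants, the derivatives at `0` of a transform analytic on the strip.
If all vanish, the transform vanishes on the strip, in particular on the real line. -/
theorem ae_eq_zero_of_moments_eq_zero (hβ : 0 < β) {f : ℝ → ℂ} (hf : ExpDecay (β / 2) f)
    (h : ∀ n : ℕ, ∫ x : ℝ, f x * (x : ℂ) ^ n = 0) : f =ᵐ[volume] 0 := by
  have h0 : (0 : ℂ) ∈ strip β := by simpa using ofReal_mem_strip hβ 0
  have han := hf.differentiableOn_fourierT.analyticOnNhd (isOpen_strip β)
  have hev : ∀ᶠ z in 𝓝 (0 : ℂ), fourierT f z = 0 := by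
    rw [← analyticOrderAt_eq_top, ENat.eq_top_iff_forall_ge]
    intro n
    refine (natCast_le_analyticOrderAt_iff_iteratedDeriv_eq_zero (han 0 h0)).2 fun i _ => ?_
    rw [iteratedDeriv_fourierT_zero hβ hf, h, mul_zero]
  refine ae_eq_zero_of_fourierT_eq_zero (hf.integrable (by positivity)) fun t => ?_
  exact han.eqOn_zero_of_preconnected_of_eventuallyEq_zero (convex_strip β).isPreconnected h0 hev
    (ofReal_mem_strip hβ t)

theorem integral_weight (F : ℝ → ℂ) :
    ∫ x, F x ∂weightMeasure β = ∫ x : ℝ, (Real.cosh (β * x) : ℂ) * F x := by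
  rw [weightMeasure, integral_withDensity_eq_integral_toReal_smul (measurable_weight β)
    (.of_forall fun x => ENNReal.ofReal_lt_top)]
  simp only [ENNReal.toReal_ofReal (Real.cosh_pos _).le, real_smul]

theorem cosh_mul_gauss_le (β x : ℝ) : Real.cosh (β * x) * gauss x ≤ Real.exp (β ^ 2 / 2) := by
  have h2 : Real.cosh (β * x) ≤ Real.exp (|β * x|) := by
    rw [← Real.cosh_abs, Real.cosh_eq]
    have := Real.exp_le_exp.2 (neg_le_self (abs_nonneg (β * x)))
    linarith
  refine (mul_le_mul_of_nonneg_right h2 (gauss_pos x).le).trans ?_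
  rw [gauss, ← Real.exp_add, Real.exp_le_exp, abs_mul]
  nlinarith [sq_nonneg (|x| - |β|), sq_abs x, sq_abs β]

/-- If `g` is orthogonal to all `X^n μ`, then `cosh(βx) μ(x) g(x)` has vanishing moments. Its decay
is no worse than that of `g`, since `cosh(βx) μ(x)` is bounded. -/
theorem dense_range_gaussPolyW (hβ : 0 < β) :
    (LinearMap.range (gaussPolyW β)).topologicalClosure = ⊤ := by
  rw [Submodule.topologicalClosure_eq_top_iff, Submodule.eq_bot_iff]
  intro g hg
  have hcont : Continuous fun x : ℝ => ((Real.cosh (β * x) * gauss x : ℝ) : ℂ) :=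
    continuous_ofReal.comp (((by fun_prop : Continuous fun x : ℝ => Real.cosh (β * x))).mul
      contDiff_gauss.continuous)
  have hdec : ExpDecay (β / 2) fun x : ℝ => ((Real.cosh (β * x) * gauss x : ℝ) : ℂ) * g x := by
    have hgd := g.expDecay hβ
    refine ⟨hcont.aestronglyMeasurable.mul hgd.1, fun c hc => ?_⟩
    refine ((hgd.2 c hc).const_mul (Real.exp (β ^ 2 / 2))).mono'
      ((hcont.aestronglyMeasurable.mul hgd.1).norm.mul
        (by fun_prop : Continuous fun x : ℝ => Real.exp (c * |x|)).aestronglyMeasurable)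
      (.of_forall fun x => ?_)
    have hpos : 0 ≤ Real.cosh (β * x) * gauss x :=
      mul_nonneg (Real.cosh_pos _).le (gauss_pos x).le
    rw [Real.norm_of_nonneg (by positivity), norm_mul, norm_real, Real.norm_of_nonneg hpos,
      mul_assoc]
    gcongr
    exact cosh_mul_gauss_le β x
  have hz := ae_eq_zero_of_moments_eq_zero hβ hdec fun n => by
    have h1 := (Submodule.mem_orthogonal _ _).1 hg _ (LinearMap.mem_range_self _ (Polynomial.X ^ n))
    rw [L2.inner_def, integral_weight] at h1
    rw [← h1]
    refine integral_congr_ae ?_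
    filter_upwards [coeFn_gaussPolyW (β := β) (Polynomial.X ^ n)] with x hx
    rw [hx, gaussPoly, Polynomial.eval_pow, Polynomial.eval_X, RCLike.inner_apply]
    simp only [map_mul, map_pow, conj_ofReal]
    push_cast
    ring
  refine WSpace.ext ?_
  filter_upwards [hz, (ac_weightMeasure β).ae_le (Lp.coeFn_zero ℂ 2 (weightMeasure β))] with x hx h0
  rw [h0]
  have hne : ((Real.cosh (β * x) * gauss x : ℝ) : ℂ) ≠ 0 := by
    exact_mod_cast (mul_pos (Real.cosh_pos _) (gauss_pos x)).ne'
  exact (mul_eq_zero.1 hx).resolve_left hne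

/-! ### The domain of the Fokker-Planck operator -/

/-- Makes the resolvent construction available for `𝓛` alone. -/
theorem conditionC_zero (β : ℝ) : ConditionC β 0 fun _ => 0 where
  fourier_eq φ := by simp
  analytic := analyticOnNhd_const
  bounded := ⟨0, by simp⟩
  zero_mean := rfl
  re_bounded := ⟨0, by simp⟩

/-- The a priori bound is deduced from uniqueness: `f` must coincide with the constructed solution
for `k = 0`, `ζ = 2`, and that one obeys the resolvent estimate. -/
theorem exists_norm_le_of_ode (hβ : 0 < β) : ∃ C : ℝ, 0 ≤ C ∧ ∀ f g : WSpace β,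
    (∀ z ∈ strip β, z * deriv (fourierT f) z = (0 - z ^ 2 - 2) * fourierT f z + fourierT g z) →
    ‖f‖ ≤ C * ‖g‖ := by
  have hζ : -((0 : ℕ) : ℝ) < (2 : ℂ).re := by simp
  obtain ⟨C, hC, h⟩ := exists_resolvent hβ (conditionC_zero β) hζ
  obtain ⟨C', hC', h'⟩ := exists_integral_norm_mul_exp_le hβ (c := β / 4) (by linarith)
  refine ⟨C * (C' + 1), by positivity, fun f g hfg => ?_⟩
  have hg := (g.expDecay hβ).differentiableOn_fourierT
  have hg0 : ∀ z ∈ strip β, fourierT g z = z ^ 0 * fourierT g z := by simp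
  obtain ⟨f₁, hf₁, hle⟩ := h g _ hg hg0 (C' * ‖g‖) (by positivity) fun z hz => by
    rw [pow_zero, mul_one]
    exact ((g.expDecay hβ).norm_fourierT_le (by linarith) hz).trans (h' g).2
  have heq := eq_resolventFT hβ (conditionC_zero β) hζ hg hg0
    (f.expDecay hβ).differentiableOn_fourierT (F := fourierT f) (by simp) hfg
  have : f = f₁ := WSpace.eq_of_fourierT_eq hβ fun t => by
    rw [hf₁ _ (ofReal_mem_strip hβ t), heq (ofReal_mem_strip hβ t)]
  rw [this]
  exact hle.trans_eq (by ring)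

/-- For the converse, `2f - u` is approximated by a Gaussian polynomial, which is `(2 - L)` of
another one lying in the domain. The a priori bound applied to the difference shows that the
solutions, and hence their images, are close. -/
theorem mem_fpGraph_iff (hβ : 0 < β) {f u : WSpace β} : (f, u) ∈ fpGraph β ↔
    ∀ z ∈ strip β, fourierT u z = -z ^ 2 * fourierT f z - z * deriv (fourierT f) z := by
  refine ⟨fun h z hz => fourierT_of_mem_fpGraph hβ h hz, fun h => ?_⟩
  obtain ⟨C, hC, hbound⟩ := exists_norm_le_of_ode hβ
  have hclosed : IsClosed (fpGraph β) := isClosed_closure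
  rw [← hclosed.closure_eq, Metric.mem_closure_iff]
  intro ε hε
  set g : WSpace β := (2 : ℂ) • f - u
  have hg : g ∈ closure (LinearMap.range (gaussPolyW β) : Set (WSpace β)) := by
    rw [← Submodule.topologicalClosure_coe, dense_range_gaussPolyW hβ]
    trivial
  -- An error `δ` in `2f - u` costs at most `Cδ` in `f` and `(2C + 1)δ` in `u`; hence the
  -- denominator.
  obtain ⟨_, ⟨q, rfl⟩, hq⟩ := Metric.mem_closure_iff.1 hg (ε / (2 * C + 2)) (by positivity)
  obtain ⟨p, rfl⟩ := exists_two_sub_fp_eq q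
  set v := gaussPolyW β (derivative (derivative p) - Polynomial.X * derivative p)
  set w := gaussPolyW β p
  have hmem : (w, v) ∈ fpGraph β := gaussPolyW_mem_fpGraph p
  rw [map_sub, map_smul, dist_eq_norm] at hq
  have hle := hbound (f - w) (g - ((2 : ℂ) • w - v)) fun z hz => by
    obtain ⟨Λ, hΛ⟩ := exists_clm_deriv_fourierT hβ hz
    simp only [g]
    simp only [WSpace.fourierT_sub hβ hz, WSpace.fourierT_smul hβ hz, h z hz,
      fourierT_of_mem_fpGraph hβ hmem hz, ← hΛ, map_sub]
    ring
  have hd : (2 * C + 1) * ‖g - ((2 : ℂ) • w - v)‖ < ε := by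
    rw [lt_div_iff₀ (by positivity)] at hq
    nlinarith [norm_nonneg (g - ((2 : ℂ) • w - v))]
  refine ⟨_, hmem, ?_⟩
  rw [Prod.dist_eq, max_lt_iff, dist_eq_norm, dist_eq_norm]
  have hn := norm_nonneg (g - ((2 : ℂ) • w - v))
  constructor
  · simp only
    nlinarith
  · have hu : u - v = (2 : ℂ) • (f - w) - (g - ((2 : ℂ) • w - v)) := by
      simp only [g]
      module
    simp only
    rw [hu]
    refine (norm_sub_le _ _).trans_lt ?_
    rw [norm_smul]
    simp only [Complex.norm_ofNat]
    nlinarith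

end FokkerPlanck

namespace FokkerPlanck

open Filter Topology

variable {β : ℝ}

/-! ### The subspaces `𝓔_k` -/

theorem exists_norm_pow_le {c : ℝ} (hc : 0 < c) (n : ℕ) (x : ℝ) :
    ‖(x : ℂ) ^ n‖ ≤ n.factorial / c ^ n * Real.exp (c * |x|) := by
  rw [norm_pow, norm_real, Real.norm_eq_abs]
  have := Real.pow_div_factorial_le_exp (c * |x|) (by positivity) n
  rw [div_le_iff₀' (by positivity), mul_pow] at this
  rw [div_mul_eq_mul_div, le_div_iff₀' (by positivity)]
  exact this

theorem WSpace.integrable_mul_pow (hβ : 0 < β) (f : WSpace β) (n : ℕ) :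
    Integrable fun x : ℝ => f x * (x : ℂ) ^ n :=
  f.integrable_mul hβ (by fun_prop : Continuous fun x : ℝ => (x : ℂ) ^ n).aestronglyMeasurable
    (by linarith : β / 4 < β / 2) (exists_norm_pow_le (by linarith) n)

theorem exists_clm_moment (hβ : 0 < β) (n : ℕ) :
    ∃ Λ : WSpace β →L[ℂ] ℂ, ∀ f, Λ f = ∫ x, f x * (x : ℂ) ^ n :=
  exists_clm_integral_mul hβ
    (by fun_prop : Continuous fun x : ℝ => (x : ℂ) ^ n).aestronglyMeasurable
    (by linarith : β / 4 < β / 2) (exists_norm_pow_le (by linarith) n)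

theorem WSpace.integral_mul_eval (hβ : 0 < β) (f : WSpace β) (p : Polynomial ℂ) :
    ∫ x : ℝ, f x * p.eval (x : ℂ) =
      ∑ i ∈ Finset.range (p.natDegree + 1), p.coeff i * ∫ x : ℝ, f x * (x : ℂ) ^ i := by
  simp_rw [← integral_const_mul]
  rw [← integral_finsetSum _ fun i _ => (f.integrable_mul_pow hβ i).const_mul _]
  refine integral_congr_ae (.of_forall fun x => ?_)
  simp only
  rw [Polynomial.eval_eq_sum_range, Finset.mul_sum]
  exact Finset.sum_congr rfl fun i _ => by ring

/-- The complex Hermite polynomials, as a sequence of polynomials of increasing degree. -/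
noncomputable def hermiteSeq : Polynomial.Sequence ℂ where
  elems' n := (Polynomial.hermite n).map (Int.castRingHom ℂ)
  degree_eq' n := by
    rw [Polynomial.degree_map_eq_of_injective (RingHom.injective_int _), Polynomial.degree_hermite]

theorem hermiteSeq_apply (n : ℕ) :
    hermiteSeq n = (Polynomial.hermite n).map (Int.castRingHom ℂ) := rfl

theorem hermiteFun_eq (n : ℕ) (x : ℝ) :
    (hermiteFun n x : ℂ) = (-1) ^ n * (hermiteSeq n).eval (x : ℂ) := by
  have h1 : gauss = fun y => Real.exp (-(y ^ 2 / 2)) := by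
    ext y
    rw [gauss, neg_div]
  have h2 : hermiteFun n x = (-1) ^ n * Polynomial.aeval x (Polynomial.hermite n) := by
    rw [hermiteFun, iteratedDeriv_eq_iterate, h1, Polynomial.deriv_gaussian_eq_hermite_mul_gaussian]
    field_simp
  rw [h2, hermiteSeq_apply, Polynomial.eval_map, Polynomial.aeval_def]
  push_cast
  congr 1
  rw [← ofRealHom_eq_coe, Polynomial.hom_eval₂]
  congr 1

theorem innerE_muFun (f : ℝ → ℂ) (n : ℕ) :
    innerE f (fun y => (muFun n y : ℂ)) =
      ((Real.sqrt (2 * Real.pi))⁻¹ : ℝ) * (-1) ^ n * ∫ x : ℝ, f x * (hermiteSeq n).eval (x : ℂ) := by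
  rw [innerE, ← integral_const_mul]
  refine integral_congr_ae (.of_forall fun x => ?_)
  have h : (gauss x : ℂ) ≠ 0 := by exact_mod_cast (gauss_pos x).ne'
  simp only [conj_ofReal]
  rw [muFun]
  push_cast
  rw [hermiteFun_eq]
  field_simp

theorem eq_zero_of_gaussPoly_ae_eq_zero {p : Polynomial ℂ} (h : ∀ᵐ x : ℝ, gaussPoly p x = 0) :
    p = 0 := by
  have h0 : gaussPoly p = fun _ => 0 :=
    (contDiff_gaussPoly p).continuous.ae_eq_iff_eq volume continuous_const |>.1 h
  refine Polynomial.eq_zero_of_infinite_isRoot p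
    ((Set.infinite_range_of_injective ofReal_injective).mono ?_)
  rintro _ ⟨x, rfl⟩
  have h : (gauss x : ℂ) ≠ 0 := by exact_mod_cast (gauss_pos x).ne'
  exact (mul_eq_zero.1 (congrFun h0 x)).resolve_right h

/-- The sum of projections is a Gaussian times a combination of Hermite polynomials; their linear
independence makes each coefficient vanish separately. -/
theorem integral_hermiteSeq_eq_zero {k : ℕ} {f : ℝ → ℂ}
    (h : ∀ᵐ x : ℝ, ∑ j ∈ Finset.range k, specProj j f x = 0) :
    ∀ j < k, ∫ x : ℝ, f x * (hermiteSeq j).eval (x : ℂ) = 0 := by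
  have hpi : ((Real.sqrt (2 * Real.pi) : ℝ) : ℂ) ≠ 0 := by
    exact_mod_cast (Real.sqrt_pos.2 Real.two_pi_pos).ne'
  set a : ℕ → ℂ := fun j => (((Real.sqrt (2 * Real.pi) / (j.factorial : ℝ) : ℝ) : ℂ) *
    innerE f (fun y => (muFun j y : ℂ)) * ((Real.sqrt (2 * Real.pi))⁻¹ : ℝ) * (-1) ^ j)
  have hp : ∑ j ∈ Finset.range k, a j • hermiteSeq j = 0 := by
    refine eq_zero_of_gaussPoly_ae_eq_zero ?_
    filter_upwards [h] with x hx
    rw [← hx, gaussPoly, Polynomial.eval_finsetSum, Finset.sum_mul]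
    refine Finset.sum_congr rfl fun j _ => ?_
    rw [specProj, muFun, Polynomial.eval_smul, smul_eq_mul]
    push_cast
    rw [hermiteFun_eq]
    simp only [a]
    push_cast
    ring
  intro j hj
  have h1 := linearIndependent_iff'.1 hermiteSeq.linearIndependent _ a hp j (Finset.mem_range.2 hj)
  simp only [a, innerE_muFun] at h1
  have hf : (j.factorial : ℂ) ≠ 0 := by exact_mod_cast j.factorial_ne_zero
  have hm : ((-1 : ℂ)) ^ j ≠ 0 := pow_ne_zero _ (by norm_num)
  generalize Real.sqrt (2 * Real.pi) = r at h1 hpi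
  have hr : r ≠ 0 := by exact_mod_cast hpi
  push_cast at h1
  simpa [hr, hf, hm] using h1

/-- Triangularity: the `j`-th Hermite polynomial has degree exactly `j`, so the lower moments drop
out by induction. -/
theorem moments_eq_zero_of_integral_hermiteSeq (hβ : 0 < β) {k : ℕ} {f : WSpace β}
    (h : ∀ j < k, ∫ x : ℝ, f x * (hermiteSeq j).eval (x : ℂ) = 0) :
    ∀ j < k, ∫ x : ℝ, f x * (x : ℂ) ^ j = 0 := by
  intro j
  induction j using Nat.strong_induction_on with
  | _ j ih =>
    intro hj
    have h1 := h j hj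
    rw [f.integral_mul_eval hβ, hermiteSeq.natDegree_eq, Finset.sum_range_succ,
      Finset.sum_eq_zero fun i hi => by
        rw [ih i (Finset.mem_range.1 hi) ((Finset.mem_range.1 hi).trans hj), mul_zero],
      zero_add] at h1
    have h2 : (hermiteSeq j).coeff j ≠ 0 := by
      have := Polynomial.leadingCoeff_ne_zero.2 (hermiteSeq.ne_zero j)
      rwa [Polynomial.leadingCoeff, hermiteSeq.natDegree_eq] at this
    exact (mul_eq_zero.1 h1).resolve_left h2

theorem memLp_gaussPoly_gaussMeasure (p : Polynomial ℂ) :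
    MemLp (gaussPoly p) 2 gaussMeasure := by
  refine ⟨(contDiff_gaussPoly p).continuous.aestronglyMeasurable, ?_⟩
  obtain ⟨C, hC, h⟩ := exists_norm_eval_le p
  have hgm : Measurable fun x : ℝ => ENNReal.ofReal (gauss x)⁻¹ :=
    (contDiff_gauss.continuous.inv₀ fun x => (gauss_pos x).ne').measurable.ennreal_ofReal
  suffices hs : eLpNorm (gaussPoly p) 2 gaussMeasure ^ 2 < ⊤ from
    (ENNReal.pow_lt_top_iff.1 hs).resolve_right two_ne_zero
  rw [eLpNorm_two_sq, gaussMeasure,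
    lintegral_withDensity_eq_lintegral_mul_non_measurable _ hgm (by simp)]
  have hi : Integrable fun x : ℝ => C ^ 2 * Real.exp 4 * Real.exp (-(1 / 4) * x ^ 2) :=
    (integrable_exp_neg_mul_sq (by norm_num)).const_mul _
  refine (lintegral_mono fun x => ?_).trans_lt hi.lintegral_lt_top
  rw [Pi.mul_apply, ← ofReal_norm, ← ENNReal.ofReal_pow (norm_nonneg _),
    ← ENNReal.ofReal_mul (inv_nonneg.2 (gauss_pos x).le)]
  refine ENNReal.ofReal_le_ofReal ?_
  have hg := gauss_pos x
  have h3 : Real.exp |x| ^ 2 * gauss x ≤ Real.exp 4 * Real.exp (-(1 / 4) * x ^ 2) := by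
    rw [gauss, ← Real.exp_nat_mul, ← Real.exp_add, ← Real.exp_add, Real.exp_le_exp]
    push_cast
    nlinarith [sq_nonneg (|x| - 4), sq_abs x]
  rw [gaussPoly, norm_mul, norm_real, Real.norm_of_nonneg hg.le]
  calc (gauss x)⁻¹ * (‖p.eval (x : ℂ)‖ * gauss x) ^ 2 = ‖p.eval (x : ℂ)‖ ^ 2 * gauss x := by
        field_simp
    _ ≤ (C * Real.exp |x|) ^ 2 * gauss x := by gcongr; exact h x
    _ = C ^ 2 * (Real.exp |x| ^ 2 * gauss x) := by ring
    _ ≤ C ^ 2 * (Real.exp 4 * Real.exp (-(1 / 4) * x ^ 2)) := by gcongr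
    _ = _ := by ring

/-- A dense subspace meets a closed subspace of finite codimension in a dense subspace. -/
theorem mem_closure_of_forall_lt_eq_zero {V : Type*} [NormedAddCommGroup V] [NormedSpace ℂ V]
    {D : Submodule ℂ V} (Λ : ℕ → V →L[ℂ] ℂ) {f : V} (hf : f ∈ closure (D : Set V)) (k : ℕ)
    (h : ∀ j < k, Λ j f = 0) : f ∈ closure {v : V | v ∈ D ∧ ∀ j < k, Λ j v = 0} := by
  induction k with
  | zero => simpa using hf
  | succ k ih =>
    have hfk := ih fun j hj => h j (hj.trans (Nat.lt_succ_self k))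
    -- Either some `e` in `D` satisfies the earlier conditions but not the new one, and subtracting
    -- a multiple of it corrects an approximating sequence, or the new condition already follows
    -- from the earlier ones on `D`.
    by_cases hΛ : ∃ e ∈ D, (∀ j < k, Λ j e = 0) ∧ Λ k e ≠ 0
    · obtain ⟨e, heD, he, hek⟩ := hΛ
      have hφ : Continuous fun v : V => v - (Λ k v / Λ k e) • e := by fun_prop
      have h1 := map_mem_closure hφ hfk
        (t := {v : V | v ∈ D ∧ ∀ j < k + 1, Λ j v = 0}) fun v hv => by
          refine ⟨D.sub_mem hv.1 (D.smul_mem _ heD), fun j hj => ?_⟩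
          rw [map_sub, map_smul, smul_eq_mul]
          rcases Nat.lt_succ_iff_lt_or_eq.1 hj with hj | rfl
          · rw [hv.2 j hj, he j hj, mul_zero, sub_zero]
          · rw [div_mul_cancel₀ _ hek, sub_self]
      simpa [h k (Nat.lt_succ_self k)] using h1
    · push Not at hΛ
      refine closure_mono ?_ hfk
      rintro v ⟨hv₁, hv₂⟩
      refine ⟨hv₁, fun j hj => ?_⟩
      rcases Nat.lt_succ_iff_lt_or_eq.1 hj with hj | rfl
      · exact hv₂ j hj
      · exact hΛ v hv₁ hv₂

/-- Vanishing moments are closed conditions, which gives one direction. For the other, Gaussian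
polynomials satisfying these conditions are dense among all such elements of `𝓔`, and they belong to
`E_k`. -/
theorem mem_WSub_iff (hβ : 0 < β) {k : ℕ} {g : WSpace β} :
    g ∈ WSub β k ↔ ∀ j < k, ∫ x : ℝ, g x * (x : ℂ) ^ j = 0 := by
  choose Λ hΛ using exists_clm_moment hβ
  constructor
  · intro hg
    have hclosed : IsClosed {f : WSpace β | ∀ j < k, Λ j f = 0} := by
      simp only [Set.ofPred_forall]
      exact isClosed_iInter fun j => isClosed_iInter fun _ =>
        isClosed_eq (Λ j).continuous continuous_const
    have hsub : gaussKernel β k ⊆ {f : WSpace β | ∀ j < k, Λ j f = 0} := by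
      intro f hf j hj
      rw [hΛ]
      exact moments_eq_zero_of_integral_hermiteSeq hβ (integral_hermiteSeq_eq_zero hf.2) j hj
    have h : ∀ j < k, Λ j g = 0 := closure_minimal hsub hclosed hg
    simpa only [hΛ] using h
  · intro hg
    have hd : g ∈ closure (LinearMap.range (gaussPolyW β) : Set (WSpace β)) := by
      rw [← Submodule.topologicalClosure_coe, dense_range_gaussPolyW hβ]
      trivial
    refine closure_mono ?_ (mem_closure_of_forall_lt_eq_zero Λ hd k (by simpa only [hΛ] using hg))
    rintro _ ⟨⟨p, rfl⟩, hp⟩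
    refine ⟨(memLp_congr_ae ((withDensity_absolutelyContinuous _ _).ae_eq
      (coeFn_gaussPolyW p))).2 (memLp_gaussPoly_gaussMeasure p), .of_forall fun x => ?_⟩
    refine Finset.sum_eq_zero fun j hj => ?_
    rw [specProj, innerE_muFun, WSpace.integral_mul_eval hβ, Finset.sum_eq_zero]
    · simp
    · intro i hi
      rw [hermiteSeq.natDegree_eq] at hi
      rw [← hΛ, hp i (by rw [Finset.mem_range] at hi hj; omega), mul_zero]

/-- Up to powers of `-i`, the moments are the derivatives of the transform at the origin. -/
theorem mem_WSub_iff_exists_eq_pow_mul (hβ : 0 < β) {k : ℕ} {g : WSpace β} :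
    g ∈ WSub β k ↔ ∃ H : ℂ → ℂ, DifferentiableOn ℂ H (strip β) ∧
      ∀ z ∈ strip β, fourierT g z = z ^ k * H z := by
  have hg := g.expDecay hβ
  have hI : (-I) ≠ 0 := neg_ne_zero.2 I_ne_zero
  rw [mem_WSub_iff hβ]
  constructor
  · intro h
    obtain ⟨H, hH, hgH⟩ := exists_eq_pow_mul hβ hg.differentiableOn_fourierT (k := k) fun j hj => by
      rw [iteratedDeriv_fourierT_zero hβ hg, h j hj, mul_zero]
    exact ⟨H, hH, fun z _ => hgH z⟩
  · rintro ⟨H, hH, hgH⟩ j hj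
    have := iteratedDeriv_pow_mul_eq_zero hβ hH hj hgH
    rw [iteratedDeriv_fourierT_zero hβ hg] at this
    exact (mul_eq_zero.1 this).resolve_left (pow_ne_zero _ hI)

end FokkerPlanck

namespace FokkerPlanck

open Filter Topology

variable {β : ℝ} {θ : 𝓢'(ℝ, ℂ)} {θhat : ℂ → ℂ}

/-! ### The resolvent equation -/

theorem solvesResolvent_iff (hβ : 0 < β) (hθ : ConditionC β θ θhat) {ζ : ℂ} {g f : WSpace β} :
    SolvesResolvent θ ζ g f ↔ ∀ z ∈ strip β, z * deriv (fourierT f) z =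
      (θhat z - z ^ 2 - ζ) * fourierT f z + fourierT g z := by
  constructor
  · rintro ⟨u, h, hu, hh, rfl⟩ z hz
    rw [WSpace.fourierT_sub hβ hz, WSpace.fourierT_sub hβ hz, WSpace.fourierT_smul hβ hz,
      (mem_fpGraph_iff hβ).1 hu z hz, (isConvolution_iff hβ hθ f h).1 hh z hz]
    ring
  · intro hode
    obtain ⟨h, hh⟩ := exists_isConvolution hβ hθ f
    -- The equation forces the value of `𝓛 f`; that this candidate lies in the graph is then exactly
    -- the differential equation.
    refine ⟨ζ • f - h - g, h, (mem_fpGraph_iff hβ).2 fun z hz => ?_, hh, by abel⟩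
    rw [WSpace.fourierT_sub hβ hz, WSpace.fourierT_sub hβ hz, WSpace.fourierT_smul hβ hz,
      (isConvolution_iff hβ hθ f h).1 hh z hz, hode z hz]
    ring

theorem exists_fourierT_eq_groundFT (hβ : 0 < β) (hθ : ConditionC β θ θhat) :
    ∃ f : WSpace β, ∀ z ∈ strip β, fourierT f z = groundFT θhat z := by
  obtain ⟨M, -, hM⟩ := hθ.exists_abs_re_le hβ
  set K : ℝ := Real.exp (M + β ^ 2 / 8)
  have hb : ∀ z ∈ strip β, ‖groundFT θhat z‖ ≤ K * Real.exp (-(1 / 2) * z.re ^ 2) := by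
    intro z hz
    have hz' : |z.im| < β / 2 := hz
    have hre : (-z ^ 2 / 2 : ℂ).re = (z.im ^ 2 - z.re ^ 2) / 2 := by
      rw [show (-z ^ 2 / 2 : ℂ) = ((1 / 2 : ℝ) : ℂ) * -z ^ 2 by push_cast; ring, re_ofReal_mul]
      simp [sq]
      ring
    rw [groundFT, norm_exp, ← Real.exp_add, Real.exp_le_exp, add_re, hre]
    have := (le_abs_self _).trans (hM z hz)
    have hsq : z.im ^ 2 ≤ (β / 2) ^ 2 := sq_le_sq' (abs_lt.1 hz').1.le (abs_lt.1 hz').2.le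
    nlinarith
  have hi : Integrable fun t : ℝ => K ^ 2 * Real.exp (-1 * t ^ 2) :=
    (integrable_exp_neg_mul_sq one_pos).const_mul _
  obtain ⟨f, hf, -⟩ := exists_fourierT_eq hβ (hθ.differentiableOn_groundFT hβ)
    (fun c hc => ⟨K, fun z hz => (hb z (hz.trans_lt hc)).trans
      (mul_le_of_le_one_right (Real.exp_pos _).le (Real.exp_le_one_iff.2 (by nlinarith [sq_nonneg z.re])))⟩)
    hi.lintegral_lt_top.ne fun b hb' => lintegral_mono fun t => by
      have h1 := hb _ (add_mul_I_mem_strip hb' t)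
      rw [← ofReal_norm, ← ENNReal.ofReal_pow (norm_nonneg _)]
      refine ENNReal.ofReal_le_ofReal ((pow_le_pow_left₀ (norm_nonneg _) h1 2).trans_eq ?_)
      rw [mul_pow]
      congr 1
      rw [← Real.exp_nat_mul]
      congr 1
      simp
  exact ⟨f, hf⟩

/-- For `‖z‖ ≤ β/4` the analytic quotient is bounded by compactness; farther out `‖z‖^k` is bounded
below and the transform is bounded on the smaller strip. -/
theorem WSpace.exists_norm_fourierT_le (hβ : 0 < β) (g : WSpace β) {k : ℕ} {H : ℂ → ℂ}
    (hH : DifferentiableOn ℂ H (strip β)) (hg : ∀ z ∈ strip β, fourierT g z = z ^ k * H z) :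
    ∃ A : ℝ, 0 ≤ A ∧ ∀ z : ℂ, |z.im| ≤ β / 4 → ‖fourierT g z‖ ≤ A * ‖z‖ ^ k := by
  have hs : Metric.closedBall (0 : ℂ) (β / 4) ⊆ strip β := fun z hz => by
    rw [mem_closedBall_zero_iff] at hz
    exact ((abs_im_le_norm z).trans hz).trans_lt (by linarith)
  obtain ⟨B, hB⟩ := (isCompact_closedBall (0 : ℂ) (β / 4)).exists_bound_of_continuousOn
    (hH.continuousOn.mono hs)
  obtain ⟨B', hB'⟩ := (g.expDecay hβ).boundedOnSubstrips (β / 4) (by linarith)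
  refine ⟨|B| + |B'| / (β / 4) ^ k, by positivity, fun z hz => ?_⟩
  rw [add_mul]
  rcases le_total ‖z‖ (β / 4) with h | h
  · have hz' : z ∈ Metric.closedBall (0 : ℂ) (β / 4) := mem_closedBall_zero_iff.2 h
    rw [hg z (hs hz'), norm_mul, norm_pow, mul_comm]
    refine le_add_of_le_of_nonneg ?_ (by positivity)
    gcongr
    exact (hB z hz').trans (le_abs_self B)
  · refine le_add_of_nonneg_of_le (by positivity) ?_
    rw [div_mul_eq_mul_div, le_div_iff₀ (by positivity)]
    gcongr
    exact (hB' z hz).trans (le_abs_self B')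

theorem exists_solvesResolvent (hβ : 0 < β) (hθ : ConditionC β θ θhat) {k : ℕ} {ζ : ℂ}
    (hζ : -(k : ℝ) < ζ.re) {g : WSpace β} (hg : g ∈ WSub β k) :
    ∃ f ∈ WSub β k, SolvesResolvent θ ζ g f ∧
      ∀ z ∈ strip β, fourierT f z = resolventFT θhat ζ (fourierT g) z := by
  obtain ⟨H, hH, hgH⟩ := (mem_WSub_iff_exists_eq_pow_mul hβ).1 hg
  obtain ⟨A, hA, hgA⟩ := g.exists_norm_fourierT_le hβ hH hgH
  obtain ⟨C, -, hC⟩ := exists_resolvent hβ hθ hζ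
  obtain ⟨f, hf, -⟩ := hC g H hH hgH A hA hgA
  refine ⟨f, (mem_WSub_iff_exists_eq_pow_mul hβ).2 ⟨fun z => groundFT θhat z *
      rayIntegral (ζ + k) (fun w => H w / groundFT θhat w) z, ?_, fun z hz => ?_⟩,
    (solvesResolvent_iff hβ hθ).2 fun z hz => ?_, hf⟩
  · exact (hθ.differentiableOn_groundFT hβ).mul
      (differentiableOn_rayIntegral (by simp; linarith) (hθ.differentiableOn_div hβ hH))
  · rw [hf z hz, resolventFT_eq hgH hz]
  · have hev : fourierT f =ᶠ[𝓝 z] resolventFT θhat ζ (fourierT g) :=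
      Filter.eventually_of_mem ((isOpen_strip β).mem_nhds hz) hf
    rw [hev.deriv_eq, resolventFT_ode hβ hθ hζ hH hgH hz, hf z hz]

theorem SolvesResolvent.fourierT_eq (hβ : 0 < β) (hθ : ConditionC β θ θhat) {k : ℕ} {ζ : ℂ}
    (hζ : -(k : ℝ) < ζ.re) {g f : WSpace β} (hg : g ∈ WSub β k) (hf : f ∈ WSub β k)
    (h : SolvesResolvent θ ζ g f) :
    ∀ z ∈ strip β, fourierT f z = resolventFT θhat ζ (fourierT g) z := by
  obtain ⟨H, hH, hgH⟩ := (mem_WSub_iff_exists_eq_pow_mul hβ).1 hg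
  obtain ⟨P, hP, hfP⟩ := (mem_WSub_iff_exists_eq_pow_mul hβ).1 hf
  exact eq_resolventFT hβ hθ hζ hH hgH hP hfP ((solvesResolvent_iff hβ hθ).1 h)

end FokkerPlanck

/-! ### The theorem: stationary state and resolvent formula. -/

theorem propositionB1 (β : ℝ) (hβ : 0 < β) (θ : 𝓢'(ℝ, ℂ)) (θhat : ℂ → ℂ)
    (hθ : ConditionC β θ θhat) :
    ∃ f₀ : WSpace β,
      SolvesResolvent θ 0 0 f₀ ∧
      (∀ ξ ∈ strip β, fourierT f₀ ξ =
        cexp (-ξ ^ 2 / 2 + ∫ s in (0 : ℝ)..1, θhat (ξ * (s : ℂ)) / (s : ℂ))) ∧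
      ∀ (k : ℕ) (ζ : ℂ), -(k : ℝ) < ζ.re → ∀ g ∈ WSub β k,
        ∃ f ∈ WSub β k,
          SolvesResolvent θ ζ g f ∧
          (∀ f' ∈ WSub β k, SolvesResolvent θ ζ g f' → f' = f) ∧
          ∀ ξ ∈ strip β,
            IntervalIntegrable
              (fun s : ℝ => fourierT g ((s : ℂ) * ξ) / fourierT f₀ ((s : ℂ) * ξ) *
                (s : ℂ) ^ (ζ - 1)) volume 0 1 ∧
            fourierT f ξ = fourierT f₀ ξ *
              ∫ s in (0 : ℝ)..1, fourierT g ((s : ℂ) * ξ) / fourierT f₀ ((s : ℂ) * ξ) *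
                (s : ℂ) ^ (ζ - 1) := by
  obtain ⟨f₀, hf₀⟩ := exists_fourierT_eq_groundFT hβ hθ
  refine ⟨f₀, (solvesResolvent_iff hβ hθ).2 fun z hz => ?_, hf₀, fun k ζ hζ g hg => ?_⟩
  · obtain ⟨q, hq, hq'⟩ := hθ.hasDerivAt_groundFT hβ hz
    have hev : fourierT f₀ =ᶠ[nhds z] groundFT θhat :=
      Filter.eventually_of_mem ((isOpen_strip β).mem_nhds hz) hf₀
    have h0 : fourierT (0 : WSpace β) z = 0 := by
      simpa using WSpace.fourierT_smul hβ hz 0 (0 : WSpace β)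
    rw [hev.deriv_eq, hq.deriv, hq', hf₀ z hz, h0, sub_zero, add_zero]
  obtain ⟨f, hf, hsol, hfT⟩ := exists_solvesResolvent hβ hθ hζ hg
  refine ⟨f, hf, hsol, fun f' hf' hsol' => WSpace.eq_of_fourierT_eq hβ fun t => ?_,
    fun ξ hξ => ?_⟩
  · rw [hfT _ (ofReal_mem_strip hβ t),
      hsol'.fourierT_eq hβ hθ hζ hg hf' _ (ofReal_mem_strip hβ t)]
  obtain ⟨H, hH, hgH⟩ := (mem_WSub_iff_exists_eq_pow_mul hβ).1 hg
  -- The transform of `f₀` is known to agree with `groundFT` only on the strip, which contains the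
  -- whole segment from `0` to `ξ`.
  have hray : ∀ s ∈ Set.uIcc (0 : ℝ) 1, fourierT f₀ ((s : ℂ) * ξ) = groundFT θhat ((s : ℂ) * ξ) :=
    fun s hs => hf₀ _ (mul_mem_strip hξ (uIcc_zero_one hs).1 (uIcc_zero_one hs).2)
  constructor
  · refine (intervalIntegrable_ray_of_vanishing hζ (hθ.differentiableOn_div hβ hH)
      (div_groundFT_eq hgH) hξ).congr fun s hs => ?_
    rw [hray s (Set.uIoc_subset_uIcc hs)]
  · rw [hfT ξ hξ, resolventFT, rayIntegral, hf₀ ξ hξ]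
    congr 1
    refine intervalIntegral.integral_congr fun s hs => ?_
    rw [hray s hs]
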